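/- Let $d\ge 1$ and let $\rho:\mathbb R^d\to\mathbb R$ be continuous, positive and $C^\infty$ on $\mathbb R^d\setminus\{0\}$, with $\rho(t^b\xi)=t\rho(\xi)$ for all $t>0$, $\xi\in\mathbb R^d$, for some fixed $b>0$. Let $(C_n)_{n\ge0}$ be a sequence of real numbers. For $j\ge1$ let $\varphi_j\in C^\infty(\mathbb R)$ be any complex-valued function supported in $[1-2^{-j},\,1-2^{-j-2}]$ with $\|\partial^n\varphi_j\|_\infty\le C_n2^{jn}$ for all $n\ge0$. Define $T_jf(\cdot,t)$ for $t>0$ by $$\widehat{T_jf}(\xi,t)=\varphi_j(\rho(\xi/t))\,\widehat f(\xi),\qquad \mathcal M_jf(x)=\sup_{t>0}|T_jf(x,t)| .$$ For $0<p\le1$ and an integer $M\ge 0$, a $(p,M)$-atom is a measurable function $a:\mathbb R^d\to\mathbb C$ supported on a ball $B$ with $\|a\|_\infty\le \mathrm{vol}(B)^{-1/p}$ and $\int a(x)P(x)\,dx=0$ for all polynomials $P$ of degree at most $M$. **Proposition.** Let $0<p\le1$, with $p<1$ if $d=1$, and let $M\ge0$ be an integer with $M+1>d(1/p-1)$. Then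 there is a constant $A$, depending only on $d,\rho,p,M$ and $(C_n)_{n\ge0}$, such that for all $j\ge1$, all $\varphi_j$ as above and all $(p,M)$-atoms $a$, $$\|\mathcal M_ja\|_{L^p(\mathbb R^d)}\le A\,2^{j\left(d\left(\frac1p-\frac12\right)-\frac12\right)} .$$ -/

import Mathlib

open MeasureTheory
open scoped FourierTransform ENNReal

/-- `ρ` is a homogeneous distance function on `ℝᵈ`: continuous, positive and smooth away from the
origin, with `ρ (t ^ b ξ) = t ρ(ξ)` for all `t > 0`, where `b > 0`. -/
structure IsHomogeneousDistance {d : ℕ} (ρ : EuclideanSpace ℝ (Fin d) → ℝ) (b : ℝ) : Prop where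
  exponent_pos : 0 < b
  continuous : Continuous ρ
  pos : ∀ ξ, ξ ≠ 0 → 0 < ρ ξ
  smooth : ContDiffOn ℝ ((⊤ : ℕ∞) : WithTop ℕ∞) ρ {0}ᶜ
  homogeneous : ∀ t : ℝ, 0 < t → ∀ ξ, ρ ((t ^ b) • ξ) = t * ρ ξ

/-- `φ` is an admissible `j`-th localizing function with derivative constants `C`: it is smooth,
supported in `[1 - 2^{-j}, 1 - 2^{-j-2}]`, and `‖φ⁽ⁿ⁾‖_∞ ≤ C n * 2^{jn}` for every `n`. -/
structure IsLocalizer (C : ℕ → ℝ) (j : ℕ) (φ : ℝ → ℂ) : Prop where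
  smooth : ContDiff ℝ ((⊤ : ℕ∞) : WithTop ℕ∞) φ
  support_subset :
    Function.support φ ⊆ Set.Icc (1 - (2 : ℝ) ^ (-(j : ℝ))) (1 - (2 : ℝ) ^ (-(j : ℝ) - 2))
  deriv_bound : ∀ (n : ℕ) (s : ℝ), ‖iteratedDeriv n φ s‖ ≤ C n * (2 : ℝ) ^ (j * n)

/-- `T f (x, t)`: the multiplier operator with symbol `ξ ↦ φ (ρ (ξ / t))` applied to `f`. The
Fourier transform is normalized with the kernel `exp (-2 π i ⟨x, ξ⟩)`. -/
noncomputable def multiplierPiece {d : ℕ} (ρ : EuclideanSpace ℝ (Fin d) → ℝ) (φ : ℝ → ℂ)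
    (f : EuclideanSpace ℝ (Fin d) → ℂ) (x : EuclideanSpace ℝ (Fin d)) (t : ℝ) : ℂ :=
  𝓕⁻ (fun ξ : EuclideanSpace ℝ (Fin d) => φ (ρ (t⁻¹ • ξ)) * 𝓕 f ξ) x

/-- The maximal function `sup_{t > 0} |T f (x, t)|`, with values in `[0, ∞]`. -/
noncomputable def maximalPiece {d : ℕ} (ρ : EuclideanSpace ℝ (Fin d) → ℝ) (φ : ℝ → ℂ)
    (f : EuclideanSpace ℝ (Fin d) → ℂ) (x : EuclideanSpace ℝ (Fin d)) : ℝ≥0∞ :=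
  ⨆ (t : ℝ) (_ : 0 < t), ‖multiplierPiece ρ φ f x t‖ₑ

/-- `a` is a `(p, M)`-atom: a measurable function supported on a ball `B`, with
`‖a‖_∞ ≤ vol(B)^{-1/p}` and `∫ a P = 0` for all polynomials `P` of degree at most `M`. (Real
polynomials suffice: complex ones are complex linear combinations of them.) -/
def IsHardyAtom {d : ℕ} (p : ℝ) (M : ℕ) (a : EuclideanSpace ℝ (Fin d) → ℂ) : Prop :=
  AEStronglyMeasurable a volume ∧
  (∃ (c : EuclideanSpace ℝ (Fin d)) (r : ℝ), 0 < r ∧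
    Function.support a ⊆ Metric.closedBall c r ∧
    eLpNorm a ⊤ volume ≤ ENNReal.ofReal (volume.real (Metric.closedBall c r) ^ (-(1 / p)))) ∧
  ∀ P : MvPolynomial (Fin d) ℝ, P.totalDegree ≤ M →
    ∫ x, a x * ((MvPolynomial.eval (fun i => x i) P : ℝ) : ℂ) = 0

/-!
The claim is an `Lᵖ` bound for a maximal multiplier operator whose symbol lives on a shell of
thickness `2^{-j}` around the unit sphere of a homogeneous distance `ρ`. Put `s = 2^{-j/2}`.

Atoms may be translated and dilated to the unit ball (`lintegral_maximalPiece_comp_add_smul`). The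
shell is cut into `O(s^{1-d})` caps of width `s`, on which it is flat up to an error `s²`
(`exists_capDecomposition`); hence the kernel of a cap at frequency `t` is bounded by an
`L¹`-normalized box kernel with sides `s⁻¹ / t` and `s⁻² / t`. For `t ≈ T` all these kernels are
bounded by one and the same box kernel, so the supremum over `t ≈ T` costs nothing. The triangle
inequality over the caps produces the factor `s^{1-d} = 2^{j(d-1)/2}`. A box kernel lives on the
ball of radius `2^j / T`, and by Hölder's inequality (`lintegral_rpow_le_of_weight`) passing from `L¹` to
`Lᵖ` costs the volume of that ball to the power `1/p - 1`. At `T = 1` the product of both factors is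
the asserted bound.

It remains to sum over the dyadic scales `T = 2^i`.
* For `T ≤ 1` the vanishing moments make `𝓕 f` vanish to order `M + 1` at the origin, which gains
  `T^{M+1}` and beats the growth `T^{-d(1/p-1)}` of the volume factor (`exists_majorant_low`).
* For `T ≥ 1`, in the ball of radius `2` every cap contributes `O(1)` for all `t` at once
  (`exists_majorant_near`).
* For `T ≥ 1`, off that ball and with `p < 1`, the volume factor decays
  (`exists_majorant_high_of_lt_one`).
* For `p = 1` the volume factor is constant. If `T ≥ 2^j`, the box kernels have radius at most one
  and are small off the unit ball (`exists_majorant_high_of_eq_one`). If `1 ≤ T ≤ 2^j`, each cap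
  only sees the frequencies of `f` in a tube of length `O(T)` and width `O(√T)` through the origin.
  For `d ≥ 2` a frequency lies in only a fraction `O(T^{-1/2})` of the tubes, because tubes through
  one point have almost parallel axes (`sum_norm_sq_tube_le`). Cauchy–Schwarz over the caps and
  Bessel's inequality then gain `T^{-1/4}` (`exists_majorant_mid`). For `d = 1` all tubes have the
  same axis and nothing is gained, which is why `p = 1` is excluded there.
-/

/-! ### Kernels of smooth compactly supported symbols -/


open scoped ContDiff in
theorem iteratedFDeriv_eq_zero_of_norm_gt {V F : Type*} [NormedAddCommGroup V] [NormedSpace ℝ V]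
    [NormedAddCommGroup F] [NormedSpace ℝ F] {g : V → F} {R : ℝ}
    (hg : ∀ x, R < ‖x‖ → g x = 0) (i : ℕ) {x : V} (hx : R < ‖x‖) :
    iteratedFDeriv ℝ i g x = 0 := by
  have h1 : tsupport g ⊆ Metric.closedBall 0 R := by
    apply closure_minimal _ Metric.isClosed_closedBall
    intro y hy
    by_contra h
    exact hy (hg y (by simpa using h))
  by_contra h
  have := h1 (tsupport_iteratedFDeriv_subset (𝕜 := ℝ) (n := i) (f := g) (subset_tsupport _ h))
  simp at this
  linarith

theorem hasCompactSupport_of_norm_gt {V F : Type*} [NormedAddCommGroup V] [ProperSpace V]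
    [Zero F] {g : V → F} {R : ℝ}
    (hg : ∀ x, R < ‖x‖ → g x = 0) : HasCompactSupport g := by
  apply HasCompactSupport.intro (isCompact_closedBall (0 : V) R)
  intro x hx
  exact hg x (by simpa using hx)

section FourierBounds

open scoped ContDiff

variable {V : Type*} [NormedAddCommGroup V] [InnerProductSpace ℝ V] [FiniteDimensional ℝ V]
  [MeasurableSpace V] [BorelSpace V]

/-- Integration by parts: `N` bounded derivatives of a compactly supported symbol give decay of
order `N` of its kernel. -/
theorem exists_norm_fourierInv_le (N : ℕ) (R : ℝ) : ∃ C : ℝ, 0 < C ∧ ∀ (g : V → ℂ) (B : ℝ),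
    ContDiff ℝ ∞ g → (∀ x, R < ‖x‖ → g x = 0) →
    (∀ i ≤ N, ∀ x, ‖iteratedFDeriv ℝ i g x‖ ≤ B) →
    ∀ x, ‖𝓕⁻ g x‖ ≤ C * B * ((1 + ‖x‖) ^ N)⁻¹ := by
  set v : ℝ := volume.real (Metric.closedBall (0 : V) R) + 1 with hv
  have hv0 : 0 < v := by positivity
  refine ⟨2 ^ N * (v + 2 ^ N * ((N + 1) * v)), by positivity, ?_⟩
  intro g B hg hsupp hB x
  have hB0 : 0 ≤ B := (norm_nonneg _).trans (hB 0 (Nat.zero_le _) 0)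
  have hcs := hasCompactSupport_of_norm_gt hsupp
  have hint : ∀ (k n : ℕ), Integrable (fun v : V ↦ ‖v‖ ^ k * ‖iteratedFDeriv ℝ n g v‖) := by
    intro k n
    apply Continuous.integrable_of_hasCompactSupport
    · exact (continuous_norm.pow k).mul
        (hg.continuous_iteratedFDeriv (by exact_mod_cast le_top)).norm
    · exact ((hcs.iteratedFDeriv n).norm).mul_left
  have hI : ∀ i ≤ N, ∫ y : V, ‖y‖ ^ 0 * ‖iteratedFDeriv ℝ i g y‖ ≤ v * B := by
    intro i hi
    have : ∫ y : V, ‖y‖ ^ 0 * ‖iteratedFDeriv ℝ i g y‖ ≤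
        ∫ y : V, (Metric.closedBall (0 : V) R).indicator (fun _ => B) y := by
      apply integral_mono (hint 0 i)
      · rw [integrable_indicator_iff measurableSet_closedBall]
        exact integrableOn_const (by exact measure_closedBall_lt_top.ne)
      · intro y
        simp only [pow_zero, one_mul]
        by_cases hy : y ∈ Metric.closedBall (0 : V) R
        · simpa [Set.indicator_of_mem hy] using hB i hi y
        · rw [Set.indicator_of_notMem hy,
            iteratedFDeriv_eq_zero_of_norm_gt hsupp i (by simpa using hy)]
          simp
    refine this.trans ?_
    rw [integral_indicator measurableSet_closedBall, setIntegral_const, smul_eq_mul]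
    gcongr
    simp [hv]
  have key : ∀ n ≤ N, ‖x‖ ^ n * ‖𝓕⁻ g x‖ ≤ 2 ^ n * ((n + 1) * v) * B := by
    intro n hn
    have h := Real.pow_mul_norm_iteratedFDeriv_fourier_le (f := g) (K := 0) (N := ⊤) (k := 0)
      (n := n) hg (fun k n _ _ => hint k n) le_rfl le_top (-x)
    simp only [norm_iteratedFDeriv_zero, norm_neg, pow_zero, one_mul] at h
    rw [Real.fourierInv_eq_fourier_neg]
    refine h.trans ?_
    have : ∑ p ∈ Finset.range (0 + 1) ×ˢ Finset.range (n + 1),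
        ∫ v : V, ‖v‖ ^ p.1 * ‖iteratedFDeriv ℝ p.2 g v‖ ≤
        ∑ p ∈ Finset.range (0 + 1) ×ˢ Finset.range (n + 1), v * B := by
      apply Finset.sum_le_sum
      rintro ⟨a, b⟩ hp
      simp only [Finset.mem_product, Finset.mem_range] at hp
      have ha : a = 0 := by omega
      subst ha
      exact hI b (by omega)
    rw [Finset.sum_const] at this
    simp only [Finset.card_product, Finset.card_range, nsmul_eq_mul] at this
    push_cast at this
    calc _ ≤ (2 * ((0 : ℕ) : ℝ) + 2) ^ n * (1 * (n + 1) * (v * B)) := by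
            apply mul_le_mul_of_nonneg_left _ (by positivity)
            simpa using this
      _ = _ := by push_cast; ring
  have h0 := key 0 (Nat.zero_le _)
  have hN := key N le_rfl
  have hp : (1 + ‖x‖) ^ N ≤ 2 ^ N * (1 + ‖x‖ ^ N) := by
    have := add_pow_le (zero_le_one (α := ℝ)) (norm_nonneg x) N
    refine this.trans ?_
    rw [one_pow]
    gcongr
    · norm_num
    · omega
  rw [← div_eq_mul_inv, le_div_iff₀ (by positivity)]
  calc ‖𝓕⁻ g x‖ * (1 + ‖x‖) ^ N ≤ ‖𝓕⁻ g x‖ * (2 ^ N * (1 + ‖x‖ ^ N)) := by gcongr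
    _ = 2 ^ N * (‖x‖ ^ 0 * ‖𝓕⁻ g x‖ + ‖x‖ ^ N * ‖𝓕⁻ g x‖) := by ring
    _ ≤ 2 ^ N * (2 ^ 0 * (((0 : ℕ) + 1) * v) * B + 2 ^ N * ((N + 1) * v) * B) := by gcongr
    _ = _ := by push_cast; ring

theorem integral_comp_linearMap {F : Type*} [NormedAddCommGroup F] [NormedSpace ℝ F]
    (A : V →ₗ[ℝ] V) (hA : LinearMap.det A ≠ 0) (f : V → F) :
    ∫ x, f (A x) = |LinearMap.det A|⁻¹ • ∫ x, f x := by
  have e : MeasurableEmbedding A :=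
    (LinearEquiv.ofIsUnitDet (f := A) (v := Module.finBasis ℝ V) (v' := Module.finBasis ℝ V)
      (by simpa using hA)).toContinuousLinearEquiv.toHomeomorph.measurableEmbedding
  rw [← e.integral_map f, Measure.map_linearMap_addHaar_eq_smul_addHaar _ hA,
    integral_smul_measure, ENNReal.toReal_ofReal (abs_nonneg _), abs_inv]

theorem lintegral_comp_linearMap
    (A : V →ₗ[ℝ] V) (hA : LinearMap.det A ≠ 0) (f : V → ℝ≥0∞) :
    ∫⁻ x, f (A x) = ENNReal.ofReal |LinearMap.det A|⁻¹ * ∫⁻ x, f x := by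
  have e : MeasurableEmbedding A :=
    (LinearEquiv.ofIsUnitDet (f := A) (v := Module.finBasis ℝ V) (v' := Module.finBasis ℝ V)
      (by simpa using hA)).toContinuousLinearEquiv.toHomeomorph.measurableEmbedding
  rw [← e.lintegral_map f, Measure.map_linearMap_addHaar_eq_smul_addHaar _ hA,
    lintegral_smul_measure, abs_inv, smul_eq_mul]

/-- Change of variables `ξ = ξ₀ + A ζ` in an inverse Fourier integral, for self-adjoint `A`. -/
theorem norm_fourierInv_affine (A : V →ₗ[ℝ] V) (hA : LinearMap.det A ≠ 0) (hs : A.IsSymmetric)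
    (ξ₀ : V) (m : V → ℂ) (x : V) :
    ‖𝓕⁻ m x‖ = |LinearMap.det A| * ‖𝓕⁻ (fun ζ => m (ξ₀ + A ζ)) (A x)‖ := by
  have h2 : 𝓕⁻ m x = |LinearMap.det A| • ((Real.fourierChar (inner ℝ ξ₀ x) : ℂ) *
      𝓕⁻ (fun ζ => m (ξ₀ + A ζ)) (A x)) := by
    rw [Real.fourierInv_eq, Real.fourierInv_eq, ← integral_add_left_eq_self _ ξ₀,
      ← integral_const_mul]
    have := integral_comp_linearMap A hA
      (fun y => Real.fourierChar (inner ℝ (ξ₀ + y) x) • m (ξ₀ + y))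
    rw [eq_comm, inv_smul_eq_iff₀ (by positivity)] at this
    rw [this]
    congr 2
    ext ζ
    simp only [Circle.smul_def, smul_eq_mul]
    rw [inner_add_left, AddChar.map_add_eq_mul, hs ζ x]
    push_cast
    ring
  rw [h2, norm_smul, norm_mul, Circle.norm_coe, one_mul, Real.norm_eq_abs, abs_abs]

/-- A symbol that, read in the affine coordinates `ξ = ξ₀ + A ζ`, is a bump function adapted to a
fixed ball has a kernel of size `|det A|` concentrated on the dual box `{x | ‖A x‖ ≤ 1}`. -/
theorem exists_norm_fourierInv_box_le (N : ℕ) (R : ℝ) : ∃ C : ℝ, 0 < C ∧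
    ∀ (A : V →ₗ[ℝ] V) (ξ₀ : V) (m : V → ℂ) (B : ℝ), LinearMap.det A ≠ 0 → A.IsSymmetric →
    ContDiff ℝ ∞ m → (∀ ζ, R < ‖ζ‖ → m (ξ₀ + A ζ) = 0) →
    (∀ i ≤ N, ∀ ζ, ‖iteratedFDeriv ℝ i (fun ζ => m (ξ₀ + A ζ)) ζ‖ ≤ B) →
    ∀ x, ‖𝓕⁻ m x‖ ≤ C * B * (|LinearMap.det A| * ((1 + ‖A x‖) ^ N)⁻¹) := by
  obtain ⟨C, hC, h⟩ := exists_norm_fourierInv_le (V := V) N R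
  refine ⟨C, hC, fun A ξ₀ m B hA hs hm hsupp hB x => ?_⟩
  rw [norm_fourierInv_affine A hA hs ξ₀ m x]
  have hA' : ContDiff ℝ ∞ (fun ζ => ξ₀ + A ζ) :=
    contDiff_const.add (LinearMap.toContinuousLinearMap A).contDiff
  have := h (fun ζ => m (ξ₀ + A ζ)) B (hm.comp hA') hsupp hB (A x)
  calc _ ≤ |LinearMap.det A| * (C * B * ((1 + ‖A x‖) ^ N)⁻¹) := by gcongr
    _ = _ := by ring

/-- Applying a Fourier multiplier is convolving with its kernel. -/
theorem fourierInv_mul_fourier {m f : V → ℂ} (hm : Integrable m) (hf : Integrable f) (x : V) :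
    𝓕⁻ (fun ξ => m ξ * 𝓕 f ξ) x = ∫ y, 𝓕⁻ m (x - y) * f y := by
  have h := VectorFourier.integral_fourierIntegral_smul_eq_flip (L := innerₗ V)
    (f := f) (g := fun ξ => Real.fourierChar (inner ℝ ξ x) • m ξ)
    Real.continuous_fourierChar continuous_inner (μ := volume) (ν := volume) hf (by
      have := (Real.fourierIntegral_convergent_iff (V := V) (μ := volume) (f := m) (-x)).2 hm
      simpa using this)
  rw [Real.fourierInv_eq]
  have e1 : (fun v => Real.fourierChar (inner ℝ v x) • (m v * 𝓕 f v)) =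
      fun ξ => VectorFourier.fourierIntegral Real.fourierChar volume (innerₗ V) f ξ •
        (Real.fourierChar (inner ℝ ξ x) • m ξ) := by
    ext ξ
    change _ = 𝓕 f ξ • (Real.fourierChar (inner ℝ ξ x) • m ξ)
    simp only [Circle.smul_def, smul_eq_mul]
    ring
  rw [e1, h]
  congr 1
  ext y
  rw [smul_eq_mul, mul_comm]
  congr 1
  rw [Real.fourierInv_eq]
  simp only [VectorFourier.fourierIntegral]
  congr 1
  ext ξ
  simp only [Circle.smul_def, smul_eq_mul, LinearMap.flip_apply, innerₗ_apply_apply]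
  rw [← mul_assoc, inner_sub_right, sub_eq_neg_add, AddChar.map_add_eq_mul, real_inner_comm]
  push_cast
  rw [real_inner_comm y ξ]

end FourierBounds

/-! ### Fourier transforms of bounded functions on the unit ball -/

section BoundedOnUnitBall

open scoped ContDiff

variable {V : Type*} [NormedAddCommGroup V] [InnerProductSpace ℝ V] [FiniteDimensional ℝ V]
  [MeasurableSpace V] [BorelSpace V]

/-- `f` is measurable, bounded by `K` almost everywhere, and vanishes off the closed unit ball. -/
structure IsBoundedOnUnitBall (K : ℝ) (f : V → ℂ) : Prop where
  aestronglyMeasurable : AEStronglyMeasurable f volume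
  eq_zero : ∀ x, 1 < ‖x‖ → f x = 0
  bound : ∀ᵐ x, ‖f x‖ ≤ K

namespace IsBoundedOnUnitBall

variable {K : ℝ} {f : V → ℂ}

theorem norm_le_indicator (hf : IsBoundedOnUnitBall K f) :
    ∀ᵐ x, ‖f x‖ ≤ (Metric.closedBall (0 : V) 1).indicator (fun _ => K) x := by
  filter_upwards [hf.bound] with x hx
  by_cases h : x ∈ Metric.closedBall (0 : V) 1
  · rwa [Set.indicator_of_mem h]
  · rw [Set.indicator_of_notMem h, hf.eq_zero x (by simpa using h), norm_zero]

theorem integrable_pow_mul (hf : IsBoundedOnUnitBall K f) (n : ℕ) :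
    Integrable (fun x => ‖x‖ ^ n * ‖f x‖) := by
  have hi : Integrable ((Metric.closedBall (0 : V) 1).indicator (fun _ => K)) := by
    rw [integrable_indicator_iff measurableSet_closedBall]
    exact integrableOn_const (by exact measure_closedBall_lt_top.ne)
  refine hi.mono' ((continuous_norm.pow n).aestronglyMeasurable.mul
    hf.aestronglyMeasurable.norm) ?_
  filter_upwards [hf.norm_le_indicator] with x hx
  rw [norm_mul, norm_norm, norm_pow, norm_norm]
  by_cases h : ‖x‖ ≤ 1
  · calc ‖x‖ ^ n * ‖f x‖ ≤ 1 * ‖f x‖ := by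
          gcongr
          exact pow_le_one₀ (norm_nonneg _) h
      _ ≤ _ := by rwa [one_mul]
  · rw [hf.eq_zero x (by linarith), norm_zero, mul_zero]
    rw [hf.eq_zero x (by linarith), norm_zero] at hx
    exact hx

theorem integrable (hf : IsBoundedOnUnitBall K f) : Integrable f := by
  have := hf.integrable_pow_mul 0
  simp only [pow_zero, one_mul] at this
  exact (integrable_norm_iff hf.aestronglyMeasurable).1 this

theorem contDiff_fourier (hf : IsBoundedOnUnitBall K f) : ContDiff ℝ ∞ (𝓕 f) :=
  Real.contDiff_fourier (N := ⊤) fun n _ => hf.integrable_pow_mul n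

theorem integrable_norm_sq (hf : IsBoundedOnUnitBall K f) : Integrable (fun x => ‖f x‖ ^ 2) := by
  refine (hf.integrable.norm.const_mul K).mono' (hf.aestronglyMeasurable.norm.pow 2) ?_
  filter_upwards [hf.bound] with x hx
  rw [norm_pow, norm_norm, pow_two]
  gcongr

theorem integral_norm_sq_le (hf : IsBoundedOnUnitBall K f) :
    ∫ x, ‖f x‖ ^ 2 ≤ volume.real (Metric.closedBall (0 : V) 1) * K ^ 2 := by
  have : ∫ x, ‖f x‖ ^ 2 ≤ ∫ x, (Metric.closedBall (0 : V) 1).indicator (fun _ => K ^ 2) x := by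
    apply integral_mono_ae hf.integrable_norm_sq
    · rw [integrable_indicator_iff measurableSet_closedBall]
      exact integrableOn_const (by exact measure_closedBall_lt_top.ne)
    · filter_upwards [hf.norm_le_indicator] with x hx
      by_cases h : x ∈ Metric.closedBall (0 : V) 1
      · rw [Set.indicator_of_mem h] at hx ⊢
        gcongr
      · rw [Set.indicator_of_notMem h, hf.eq_zero x (by simpa using h)]
        simp
  refine this.trans_eq ?_
  rw [integral_indicator measurableSet_closedBall, setIntegral_const, smul_eq_mul]

theorem lintegral_enorm_le (hf : IsBoundedOnUnitBall K f) :
    ∫⁻ x, ‖f x‖ₑ ≤ volume (Metric.closedBall (0 : V) 1) * ENNReal.ofReal K := by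
  have : ∫⁻ x, ‖f x‖ₑ ≤
      ∫⁻ x, (Metric.closedBall (0 : V) 1).indicator (fun _ => ENNReal.ofReal K) x := by
    apply lintegral_mono_ae
    filter_upwards [hf.bound] with x hx
    by_cases h : x ∈ Metric.closedBall (0 : V) 1
    · rw [Set.indicator_of_mem h, ← ofReal_norm]
      exact ENNReal.ofReal_le_ofReal hx
    · rw [Set.indicator_of_notMem h, hf.eq_zero x (by simpa using h)]
      simp
  refine this.trans_eq ?_
  rw [lintegral_indicator measurableSet_closedBall, setLIntegral_const, mul_comm]

/-- Bessel's inequality for the Fourier transform. The integral `∫ χ² |𝓕 f|²` is `∫ 𝓕 f * g` for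
the Schwartz function `g = χ² conj (𝓕 f)`, so it is `∫ f * 𝓕 g`, and Plancherel's identity for `g`
applies. -/
theorem integral_norm_sq_mul_fourier_le (hf : IsBoundedOnUnitBall K f) {χ : V → ℝ}
    (hχ : ContDiff ℝ ∞ χ) (hc : HasCompactSupport χ) (h0 : ∀ x, 0 ≤ χ x) (h1 : ∀ x, χ x ≤ 1) :
    ∫ ξ, χ ξ ^ 2 * ‖𝓕 f ξ‖ ^ 2 ≤ ∫ x, ‖f x‖ ^ 2 := by
  let g : V → ℂ := fun ξ => (χ ξ : ℂ) ^ 2 * (starRingEnd ℂ) (𝓕 f ξ)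
  have hχc : ContDiff ℝ ∞ (fun ξ => (χ ξ : ℂ)) := Complex.ofRealCLM.contDiff.comp hχ
  have hg : ContDiff ℝ ∞ g :=
    (hχc.pow 2).mul (Complex.conjCLE.contDiff.comp hf.contDiff_fourier)
  have hgc : HasCompactSupport g := by
    apply HasCompactSupport.mul_right
    exact hc.comp_left (g := fun y : ℝ => (y : ℂ) ^ 2) (by simp)
  let G := hgc.toSchwartzMap hg
  have hG : ∀ ξ, G ξ = g ξ := fun ξ => rfl
  have hFG : ∀ ξ, 𝓕 G ξ = 𝓕 g ξ := by
    intro ξ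
    rw [SchwartzMap.fourier_coe]
    rfl
  have key : ∫ ξ, 𝓕 f ξ • g ξ = ∫ x, f x • 𝓕 g x := by
    have h := VectorFourier.integral_fourierIntegral_smul_eq_flip (L := innerₗ V)
      (f := f) (g := g) Real.continuous_fourierChar continuous_inner (μ := volume) (ν := volume)
      hf.integrable G.integrable
    rw [flip_innerₗ] at h
    exact h
  have e1 : ∫ ξ, 𝓕 f ξ • g ξ = ((∫ ξ, χ ξ ^ 2 * ‖𝓕 f ξ‖ ^ 2 : ℝ) : ℂ) := by
    rw [← integral_complex_ofReal]
    congr 1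
    ext ξ
    simp only [g, smul_eq_mul]
    rw [mul_left_comm, Complex.mul_conj, Complex.normSq_eq_norm_sq]
    push_cast
    ring
  have hI0 : 0 ≤ ∫ ξ, χ ξ ^ 2 * ‖𝓕 f ξ‖ ^ 2 := integral_nonneg fun ξ => by positivity
  have hFc : Continuous (𝓕 f) := hf.contDiff_fourier.continuous
  have hi1 : Integrable (fun ξ => χ ξ ^ 2 * ‖𝓕 f ξ‖ ^ 2) := by
    apply Continuous.integrable_of_hasCompactSupport
    · exact (hχ.continuous.pow 2).mul (hFc.norm.pow 2)
    · apply HasCompactSupport.mul_right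
      exact hc.comp_left (g := fun y : ℝ => y ^ 2) (by simp)
  have hpl : ∫ ξ, ‖𝓕 g ξ‖ ^ 2 ≤ ∫ ξ, χ ξ ^ 2 * ‖𝓕 f ξ‖ ^ 2 := by
    have := SchwartzMap.integral_norm_sq_fourier G
    simp only [hFG, hG] at this
    rw [this]
    apply integral_mono _ hi1
    · intro ξ
      simp only [g, norm_mul, norm_pow, Complex.norm_real, RCLike.norm_conj, mul_pow]
      gcongr
      rw [Real.norm_eq_abs, sq_abs]
      nlinarith [h0 ξ, h1 ξ]
    · apply Continuous.integrable_of_hasCompactSupport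
      · exact (hg.continuous.norm.pow 2)
      · exact hgc.comp_left (g := fun y : ℂ => ‖y‖ ^ 2) (by simp)
  have hi2 : Integrable (fun ξ => ‖𝓕 g ξ‖ ^ 2) := by
    have h3 : MemLp (fun ξ => 𝓕 g ξ) 2 := by
      have := (𝓕 G).memLp 2
      simpa only [hFG] using! this
    exact (memLp_two_iff_integrable_sq_norm h3.1).1 h3
  have e2 : ‖∫ x, f x • 𝓕 g x‖ ≤ ((∫ x, ‖f x‖ ^ 2) + ∫ ξ, ‖𝓕 g ξ‖ ^ 2) / 2 := by
    rw [← integral_add hf.integrable_norm_sq hi2, ← integral_div]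
    apply norm_integral_le_of_norm_le ((hf.integrable_norm_sq.add hi2).div_const 2)
    filter_upwards with x
    rw [norm_smul]
    simp only [Pi.add_apply]
    nlinarith [sq_nonneg (‖f x‖ - ‖𝓕 g x‖)]
  rw [← key, e1, Complex.norm_real, Real.norm_eq_abs, abs_of_nonneg hI0] at e2
  linarith

end IsBoundedOnUnitBall

theorem integral_norm_sq_fourierInv {h : V → ℂ} (hh : ContDiff ℝ ∞ h) (hc : HasCompactSupport h) :
    ∫ x, ‖𝓕⁻ h x‖ ^ 2 = ∫ ξ, ‖h ξ‖ ^ 2 := by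
  let G := hc.toSchwartzMap hh
  have := SchwartzMap.integral_norm_sq_fourier (𝓕⁻ G)
  rw [show (𝓕 (𝓕⁻ G : SchwartzMap V ℂ) : SchwartzMap V ℂ) = G from
    FourierTransform.fourier_fourierInv_eq G,
    SchwartzMap.fourierInv_coe] at this
  exact this.symm

theorem memLp_fourierInv {h : V → ℂ} (hh : ContDiff ℝ ∞ h) (hc : HasCompactSupport h) (p : ℝ≥0∞) :
    MemLp (𝓕⁻ h) p := by
  let G := hc.toSchwartzMap hh
  have := (𝓕⁻ G).memLp p
  rw [SchwartzMap.fourierInv_coe] at this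
  exact this

theorem fourier_fourierInv_of_contDiff {h : V → ℂ} (hh : ContDiff ℝ ∞ h)
    (hc : HasCompactSupport h) : 𝓕 (𝓕⁻ h) = h := by
  let G := hc.toSchwartzMap hh
  have : (𝓕 (𝓕⁻ G : SchwartzMap V ℂ) : SchwartzMap V ℂ) = G :=
    FourierTransform.fourier_fourierInv_eq G
  have h2 : (⇑(𝓕 (𝓕⁻ G : SchwartzMap V ℂ) : SchwartzMap V ℂ) : V → ℂ) = 𝓕 (𝓕⁻ (G : V → ℂ)) := by
    rw [SchwartzMap.fourier_coe, SchwartzMap.fourierInv_coe]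
  rw [this] at h2
  exact h2.symm

theorem lintegral_enorm_fourierInv_sq {h : V → ℂ} (hh : ContDiff ℝ ∞ h)
    (hc : HasCompactSupport h) :
    ∫⁻ x, ‖𝓕⁻ h x‖ₑ ^ 2 = ENNReal.ofReal (∫ ξ, ‖h ξ‖ ^ 2) := by
  rw [← integral_norm_sq_fourierInv hh hc, ofReal_integral_eq_lintegral_ofReal]
  · congr 1
    ext x
    rw [← ofReal_norm, ENNReal.ofReal_pow (norm_nonneg _)]
  · exact (memLp_two_iff_integrable_sq_norm (memLp_fourierInv hh hc 2).1).1
      (memLp_fourierInv hh hc 2)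
  · filter_upwards with x
    positivity

variable {K : ℝ} {f : V → ℂ}

/-- If the cutoff `χ` equals one on the support of `m`, then the multiplier `m` only sees the piece
`𝓕⁻ (χ 𝓕 f)` of `f`. -/
theorem fourierInv_mul_fourier_eq_of_cutoff (hf : IsBoundedOnUnitBall K f) {m χ : V → ℂ}
    (hm : Integrable m) (hχ : ContDiff ℝ ∞ χ) (hc : HasCompactSupport χ)
    (hmχ : ∀ ξ, m ξ * χ ξ = m ξ) (x : V) :
    𝓕⁻ (fun ξ => m ξ * 𝓕 f ξ) x =
      ∫ y, 𝓕⁻ m (x - y) * 𝓕⁻ (fun ξ => χ ξ * 𝓕 f ξ) y := by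
  have h1 : ContDiff ℝ ∞ (fun ξ => χ ξ * 𝓕 f ξ) := hχ.mul hf.contDiff_fourier
  have h2 : HasCompactSupport (fun ξ => χ ξ * 𝓕 f ξ) := hc.mul_right
  rw [← fourierInv_mul_fourier hm (memLp_one_iff_integrable.1 (memLp_fourierInv h1 h2 1)) x,
    fourier_fourierInv_of_contDiff h1 h2]
  simp only [← mul_assoc, hmχ]

/-- The `L¹` norm of the piece `𝓕⁻ (χ 𝓕 f)` is controlled by its `L²` norm on the ball of radius
`2`. Off that ball, the kernel `𝓕⁻ χ` only acts over distances at least `1`. -/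
theorem lintegral_enorm_fourierInv_mul_fourier_le (hf : IsBoundedOnUnitBall K f) {χ : V → ℂ}
    (hχ : ContDiff ℝ ∞ χ) (hc : HasCompactSupport χ) :
    ∫⁻ x, ‖𝓕⁻ (fun ξ => χ ξ * 𝓕 f ξ) x‖ₑ ≤
      ENNReal.ofReal (∫ ξ, ‖χ ξ * 𝓕 f ξ‖ ^ 2) ^ (1 / 2 : ℝ) *
        volume (Metric.closedBall (0 : V) 2) ^ (1 / 2 : ℝ) +
      (∫⁻ x in {x : V | 1 ≤ ‖x‖}, ‖𝓕⁻ χ x‖ₑ) * ∫⁻ x, ‖f x‖ₑ := by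
  have h1 : ContDiff ℝ ∞ (fun ξ => χ ξ * 𝓕 f ξ) := hχ.mul hf.contDiff_fourier
  have h2 : HasCompactSupport (fun ξ => χ ξ * 𝓕 f ξ) := hc.mul_right
  have hχi : Integrable χ := hχ.continuous.integrable_of_hasCompactSupport hc
  have hm1 := (memLp_fourierInv h1 h2 1).1
  have hm2 := (memLp_fourierInv hχ hc 1).1
  have hmc : Continuous (𝓕⁻ χ) := by
    have := (𝓕⁻ (hc.toSchwartzMap hχ)).continuous
    rw [SchwartzMap.fourierInv_coe] at this
    exact this
  rw [← lintegral_add_compl _ (measurableSet_closedBall (x := (0 : V)) (ε := 2))]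
  apply add_le_add
  · have h := ENNReal.lintegral_mul_norm_pow_le (μ := volume.restrict (Metric.closedBall (0 : V) 2))
      (f := fun x => ‖𝓕⁻ (fun ξ => χ ξ * 𝓕 f ξ) x‖ₑ ^ 2) (g := fun _ => 1)
      (hm1.restrict.enorm.pow_const 2) aemeasurable_const (p := 1 / 2) (q := 1 / 2)
      (by norm_num) (by norm_num) (by norm_num)
    simp only [ENNReal.one_rpow, mul_one, lintegral_one, Measure.restrict_apply_univ] at h
    have e : ∀ y : ℝ≥0∞, (y ^ 2) ^ (1 / 2 : ℝ) = y := by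
      intro y
      rw [← ENNReal.rpow_natCast, ← ENNReal.rpow_mul]
      norm_num
    simp only [e] at h
    refine h.trans ?_
    gcongr
    rw [← lintegral_enorm_fourierInv_sq h1 h2]
    exact setLIntegral_le_lintegral _ _
  · have hpt : ∀ x ∈ (Metric.closedBall (0 : V) 2)ᶜ, ‖𝓕⁻ (fun ξ => χ ξ * 𝓕 f ξ) x‖ₑ ≤
        ∫⁻ y, {x : V | 1 ≤ ‖x‖}.indicator (fun z => ‖𝓕⁻ χ z‖ₑ) (x - y) * ‖f y‖ₑ := by
      intro x hx
      rw [fourierInv_mul_fourier hχi hf.integrable]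
      refine (enorm_integral_le_lintegral_enorm _).trans ?_
      apply lintegral_mono
      intro y
      simp only [enorm_mul]
      by_cases hy : 1 < ‖y‖
      · simp [hf.eq_zero y hy]
      · rw [Set.indicator_of_mem]
        simp only [Set.mem_compl_iff, Metric.mem_closedBall, dist_zero_right, not_le] at hx
        simp only [Set.mem_ofPred_eq]
        have := norm_sub_norm_le x y
        linarith
    have hmeas : Measurable ({x : V | 1 ≤ ‖x‖}.indicator (fun z => ‖𝓕⁻ χ z‖ₑ)) :=
      hmc.enorm.measurable.indicator (measurableSet_le measurable_const measurable_norm)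
    refine (setLIntegral_mono' measurableSet_closedBall.compl hpt).trans ?_
    refine (setLIntegral_le_lintegral _ _).trans ?_
    rw [lintegral_lintegral_swap]
    · have : ∀ y, ∫⁻ x, {x : V | 1 ≤ ‖x‖}.indicator (fun z => ‖𝓕⁻ χ z‖ₑ) (x - y) * ‖f y‖ₑ =
          (∫⁻ x in {x : V | 1 ≤ ‖x‖}, ‖𝓕⁻ χ x‖ₑ) * ‖f y‖ₑ := by
        intro y
        rw [lintegral_mul_const _ (by fun_prop), lintegral_sub_right_eq_self,
          lintegral_indicator (measurableSet_le measurable_const measurable_norm)]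
      simp only [this]
      rw [lintegral_const_mul'' _ hf.aestronglyMeasurable.enorm]
    · apply AEMeasurable.mul
      · exact (hmeas.comp (measurable_fst.sub measurable_snd)).aemeasurable
      · exact hf.aestronglyMeasurable.enorm.comp_snd

end BoundedOnUnitBall

/-! ### Anisotropic dilations -/

section Stretch

variable {V : Type*} [NormedAddCommGroup V] [InnerProductSpace ℝ V]

/-- The self-adjoint map that multiplies the direction of the unit vector `n` by `β` and the
orthogonal complement of `n` by `α`. -/
noncomputable def stretch (α β : ℝ) (n : V) : V →L[ℝ] V :=
  α • ContinuousLinearMap.id ℝ V + (β - α) • (innerSL ℝ n).smulRight n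

theorem stretch_apply (α β : ℝ) (n x : V) :
    stretch α β n x = α • x + ((β - α) * inner ℝ n x) • n := by
  simp [stretch, smul_smul]

theorem stretch_isSymmetric (α β : ℝ) (n : V) :
    (stretch α β n : V →ₗ[ℝ] V).IsSymmetric := by
  intro x y
  simp only [ContinuousLinearMap.coe_coe, stretch_apply, inner_add_left, inner_add_right,
    real_inner_smul_left, real_inner_smul_right]
  rw [real_inner_comm n x]
  ring

theorem inner_stretch {α β : ℝ} {n : V} (hn : ‖n‖ = 1) (x : V) :
    inner ℝ n (stretch α β n x) = β * inner ℝ n x := by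
  rw [stretch_apply, inner_add_right, real_inner_smul_right, real_inner_smul_right,
    real_inner_self_eq_norm_sq, hn]
  ring

theorem stretch_sub_inner_smul {α β : ℝ} {n : V} (hn : ‖n‖ = 1) (x : V) :
    stretch α β n x - inner ℝ n (stretch α β n x) • n = α • (x - inner ℝ n x • n) := by
  rw [inner_stretch hn, stretch_apply]
  module

theorem norm_sub_inner_smul_sq {n : V} (hn : ‖n‖ = 1) (x : V) :
    ‖x - inner ℝ n x • n‖ ^ 2 = ‖x‖ ^ 2 - inner ℝ n x ^ 2 := by
  rw [norm_sub_sq_real, real_inner_smul_right, norm_smul, hn, mul_one, Real.norm_eq_abs, sq_abs,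
    real_inner_comm]
  ring

theorem norm_stretch_sq {α β : ℝ} {n : V} (hn : ‖n‖ = 1) (x : V) :
    ‖stretch α β n x‖ ^ 2 = α ^ 2 * (‖x‖ ^ 2 - inner ℝ n x ^ 2) + β ^ 2 * inner ℝ n x ^ 2 := by
  have h := norm_sub_inner_smul_sq hn (stretch α β n x)
  rw [stretch_sub_inner_smul hn, norm_smul, mul_pow, norm_sub_inner_smul_sq hn, inner_stretch hn,
    Real.norm_eq_abs, sq_abs] at h
  linarith

theorem inner_sq_le {n : V} (hn : ‖n‖ = 1) (x : V) : inner ℝ n x ^ 2 ≤ ‖x‖ ^ 2 := by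
  have := norm_sub_inner_smul_sq hn x
  nlinarith [sq_nonneg ‖x - inner ℝ n x • n‖]

theorem norm_stretch_le {α β γ : ℝ} {n : V} (hn : ‖n‖ = 1) (hα : |α| ≤ γ) (hβ : |β| ≤ γ) (x : V) :
    ‖stretch α β n x‖ ≤ γ * ‖x‖ := by
  have hγ : 0 ≤ γ := (abs_nonneg _).trans hα
  apply le_of_sq_le_sq _ (by positivity)
  rw [norm_stretch_sq hn, mul_pow]
  have h1 : α ^ 2 ≤ γ ^ 2 := sq_le_sq' (abs_le.1 hα).1 (abs_le.1 hα).2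
  have h2 : β ^ 2 ≤ γ ^ 2 := sq_le_sq' (abs_le.1 hβ).1 (abs_le.1 hβ).2
  nlinarith [inner_sq_le hn x, sq_nonneg (inner ℝ n x),
    mul_le_mul_of_nonneg_right h1 (sub_nonneg.2 (inner_sq_le hn x)),
    mul_le_mul_of_nonneg_right h2 (sq_nonneg (inner ℝ n x))]

theorem le_norm_stretch {α β γ : ℝ} {n : V} (hn : ‖n‖ = 1) (hγ : 0 ≤ γ) (hα : γ ≤ α) (hβ : γ ≤ β)
    (x : V) : γ * ‖x‖ ≤ ‖stretch α β n x‖ := by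
  apply le_of_sq_le_sq _ (by positivity)
  rw [norm_stretch_sq hn, mul_pow]
  have h1 : γ ^ 2 ≤ α ^ 2 := by gcongr
  have h2 : γ ^ 2 ≤ β ^ 2 := by gcongr
  nlinarith [inner_sq_le hn x, sq_nonneg (inner ℝ n x),
    mul_le_mul_of_nonneg_right h1 (sub_nonneg.2 (inner_sq_le hn x)),
    mul_le_mul_of_nonneg_right h2 (sq_nonneg (inner ℝ n x))]

theorem opNorm_stretch_le {α β γ : ℝ} {n : V} (hn : ‖n‖ = 1) (hα : |α| ≤ γ) (hβ : |β| ≤ γ) :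
    ‖stretch α β n‖ ≤ γ :=
  ContinuousLinearMap.opNorm_le_bound _ ((abs_nonneg _).trans hα) (norm_stretch_le hn hα hβ)

theorem det_stretch_ne_zero [FiniteDimensional ℝ V] {α β : ℝ} {n : V} (hn : ‖n‖ = 1) (hα : 0 < α)
    (hβ : 0 < β) : LinearMap.det (stretch α β n : V →ₗ[ℝ] V) ≠ 0 := by
  intro h
  obtain ⟨x, hx, hx0⟩ := (Submodule.ne_bot_iff _).1 (LinearMap.bot_lt_ker_of_det_eq_zero h).ne'
  have h1 := le_norm_stretch hn (le_min hα.le hβ.le) (min_le_left α β) (min_le_right α β) x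
  have h2 : stretch α β n x = 0 := by simpa using hx
  rw [h2, norm_zero] at h1
  have h3 : 0 < min α β * ‖x‖ := mul_pos (lt_min hα hβ) (norm_pos_iff.2 hx0)
  linarith

end Stretch

/-! ### Bounds for derivatives -/

section DerivativeBounds

open scoped ContDiff

variable {V W F : Type*} [NormedAddCommGroup V] [NormedSpace ℝ V]
  [NormedAddCommGroup W] [NormedSpace ℝ W] [NormedAddCommGroup F] [NormedSpace ℝ F]

theorem norm_iteratedFDeriv_comp_affine_le {f : W → F} (hf : ContDiff ℝ ∞ f) (c : W)
    (A : V →L[ℝ] W) (i : ℕ) (x : V) :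
    ‖iteratedFDeriv ℝ i (fun x => f (c + A x)) x‖ ≤ ‖iteratedFDeriv ℝ i f (c + A x)‖ * ‖A‖ ^ i := by
  have h1 : ContDiff ℝ ∞ (fun y => f (c + y)) := hf.comp (contDiff_const.add contDiff_id)
  have h := A.iteratedFDeriv_comp_right h1 x (i := i) (by exact_mod_cast le_top)
  have e : (fun y => f (c + y)) ∘ A = fun x => f (c + A x) := rfl
  rw [e, iteratedFDeriv_comp_add_left] at h
  rw [h]
  refine (ContinuousMultilinearMap.norm_compContinuousLinearMap_le _ _).trans_eq ?_
  simp

theorem norm_iteratedFDeriv_mul_le_of_le {f g : V → ℂ} (hf : ContDiff ℝ ∞ f)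
    (hg : ContDiff ℝ ∞ g) {N : ℕ} {x : V} {B D : ℝ}
    (hB : ∀ i ≤ N, ‖iteratedFDeriv ℝ i f x‖ ≤ B) (hD : ∀ i ≤ N, ‖iteratedFDeriv ℝ i g x‖ ≤ D) :
    ∀ i ≤ N, ‖iteratedFDeriv ℝ i (fun x => f x * g x) x‖ ≤ 2 ^ N * (B * D) := by
  intro i hi
  have hB0 : 0 ≤ B := (norm_nonneg _).trans (hB 0 (Nat.zero_le _))
  have hD0 : 0 ≤ D := (norm_nonneg _).trans (hD 0 (Nat.zero_le _))
  refine (norm_iteratedFDeriv_mul_le hf hg x (n := i) (by exact_mod_cast le_top)).trans ?_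
  calc _ ≤ ∑ k ∈ Finset.range (i + 1), (i.choose k : ℝ) * (B * D) := by
        apply Finset.sum_le_sum
        intro k hk
        rw [Finset.mem_range] at hk
        rw [mul_assoc]
        gcongr
        · exact hB k (by omega)
        · exact hD (i - k) (by omega)
    _ = 2 ^ i * (B * D) := by
        rw [← Finset.sum_mul]
        congr 1
        exact_mod_cast Nat.sum_range_choose i
    _ ≤ _ := by
        gcongr
        norm_num

theorem norm_fderiv_sub_fderiv_le {f : V → F} (hf : ContDiff ℝ ∞ f) {B : ℝ}
    (hB : ∀ x, ‖iteratedFDeriv ℝ 2 f x‖ ≤ B) (x y : V) :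
    ‖fderiv ℝ f y - fderiv ℝ f x‖ ≤ B * ‖y - x‖ := by
  have hd : ContDiff ℝ ∞ (fderiv ℝ f) := hf.fderiv_right (by simp)
  apply Convex.norm_image_sub_le_of_norm_fderiv_le (𝕜 := ℝ) (s := Set.univ)
    (fun z _ => (hd.differentiable (by simp)) z) _ convex_univ (Set.mem_univ _) (Set.mem_univ _)
  intro z _
  rw [← norm_iteratedFDeriv_one, norm_iteratedFDeriv_fderiv]
  exact hB z

theorem norm_sub_sub_fderiv_le {f : V → F} (hf : ContDiff ℝ ∞ f) {B : ℝ}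
    (hB : ∀ x, ‖iteratedFDeriv ℝ 2 f x‖ ≤ B) (x h : V) :
    ‖f (x + h) - f x - fderiv ℝ f x h‖ ≤ B * ‖h‖ ^ 2 := by
  have hB0 : 0 ≤ B := (norm_nonneg _).trans (hB x)
  have := Convex.norm_image_sub_le_of_norm_fderiv_le' (𝕜 := ℝ) (f := f)
    (s := Metric.closedBall x ‖h‖) (x := x) (y := x + h) (φ := fderiv ℝ f x) (C := B * ‖h‖)
    (fun z _ => (hf.differentiable (by simp)) z) (fun z hz => by
      refine (norm_fderiv_sub_fderiv_le hf hB x z).trans ?_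
      gcongr
      simpa [dist_eq_norm] using hz) (convex_closedBall _ _) (by simp) (by simp)
  simpa [pow_two, mul_assoc] using this

end DerivativeBounds

/-! ### Symbols localized to a cap -/

section CapSymbols

open scoped ContDiff

variable {V : Type*} [NormedAddCommGroup V] [InnerProductSpace ℝ V]

/-- Second order Taylor expansion of `ρ` shows that the part of the shell `|ρ - ρ(ξ₀)| ≤ s²` within
distance `r s` of `ξ₀` has width `s` in the tangential directions and `s²` in the normal direction
`n`. -/
theorem exists_norm_le_of_mem_cap {B c r : ℝ} (hc : 0 < c) : ∃ R : ℝ, 0 < R ∧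
    ∀ (ρ : V → ℝ) (ξ₀ n : V) (s γ : ℝ), ContDiff ℝ ∞ ρ → 0 < s → ‖n‖ = 1 →
    (∀ v, fderiv ℝ ρ ξ₀ v = γ * inner ℝ n v) → c ≤ γ → (∀ x, ‖iteratedFDeriv ℝ 2 ρ x‖ ≤ B) →
    ∀ ζ, ‖stretch s (s ^ 2) n ζ‖ ≤ r * s → |ρ (ξ₀ + stretch s (s ^ 2) n ζ) - ρ ξ₀| ≤ s ^ 2 →
    ‖ζ‖ ≤ R := by
  refine ⟨|r| + (1 + |B| * r ^ 2) / c, by positivity, ?_⟩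
  intro ρ ξ₀ n s γ hρ hs hn hγ hcγ hB ζ h1 h2
  set L := stretch s (s ^ 2) n with hL
  have hB0 : 0 ≤ B := (norm_nonneg _).trans (hB 0)
  have hr : 0 ≤ r := by
    have : 0 ≤ r * s := (norm_nonneg _).trans h1
    exact nonneg_of_mul_nonneg_left this hs
  rw [abs_of_nonneg hr, abs_of_nonneg hB0]
  have t1 := norm_sub_sub_fderiv_le hρ hB ξ₀ (L ζ)
  rw [hγ, inner_stretch hn, Real.norm_eq_abs] at t1
  have t2 : |γ * (s ^ 2 * inner ℝ n ζ)| ≤ s ^ 2 * (1 + B * r ^ 2) := by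
    have e : γ * (s ^ 2 * inner ℝ n ζ) = (ρ (ξ₀ + L ζ) - ρ ξ₀) -
      (ρ (ξ₀ + L ζ) - ρ ξ₀ - γ * (s ^ 2 * inner ℝ n ζ)) := by ring
    rw [e]
    refine (abs_sub _ _).trans ?_
    have : B * ‖L ζ‖ ^ 2 ≤ B * (r * s) ^ 2 := by gcongr
    nlinarith
  have t3 : |inner ℝ n ζ| ≤ (1 + B * r ^ 2) / c := by
    rw [le_div_iff₀ hc]
    rw [abs_mul, abs_mul, abs_of_pos (hc.trans_le hcγ),
      abs_of_pos (by positivity : 0 < s ^ 2)] at t2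
    have : s ^ 2 * (γ * |inner ℝ n ζ|) ≤ s ^ 2 * (1 + B * r ^ 2) := by linarith
    have := le_of_mul_le_mul_left this (by positivity)
    nlinarith [abs_nonneg (inner ℝ n ζ)]
  have t4 : ‖ζ - inner ℝ n ζ • n‖ ≤ r := by
    have h := stretch_sub_inner_smul (α := s) (β := s ^ 2) hn ζ
    have h5 : s * ‖ζ - inner ℝ n ζ • n‖ ≤ r * s := by
      rw [← abs_of_pos hs, ← Real.norm_eq_abs, ← norm_smul, ← h, Real.norm_eq_abs, abs_of_pos hs]
      refine le_trans ?_ h1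
      apply le_of_sq_le_sq _ (norm_nonneg _)
      rw [norm_sub_inner_smul_sq hn]
      nlinarith [sq_nonneg (inner ℝ n (L ζ))]
    nlinarith
  calc ‖ζ‖ = ‖(ζ - inner ℝ n ζ • n) + inner ℝ n ζ • n‖ := by rw [sub_add_cancel]
    _ ≤ ‖ζ - inner ℝ n ζ • n‖ + ‖inner ℝ n ζ • n‖ := norm_add_le _ _
    _ ≤ r + (1 + B * r ^ 2) / c := by
      rw [norm_smul, hn, mul_one, Real.norm_eq_abs]
      exact add_le_add t4 t3

/-- In the coordinates `ξ = ξ₀ + L ζ` of a cap, the defining function `s⁻² ρ` has bounded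
derivatives: the normal direction is scaled by `s²`, and in the tangential directions the gradient
of `ρ` vanishes to first order. -/
theorem norm_iteratedFDeriv_comp_cap_le {B R : ℝ} {N : ℕ} {ρ : V → ℝ} {φ : ℝ → ℂ} {Cφ : ℝ}
    {ξ₀ n : V} {s γ : ℝ} (hρ : ContDiff ℝ ∞ ρ) (hφ : ContDiff ℝ ∞ φ) (hs : 0 < s) (hs1 : s ≤ 1)
    (hn : ‖n‖ = 1) (hγ : ∀ v, fderiv ℝ ρ ξ₀ v = γ * inner ℝ n v)
    (hB : ∀ i, 1 ≤ i → i ≤ N + 2 → ∀ x, ‖iteratedFDeriv ℝ i ρ x‖ ≤ B)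
    (hC : ∀ i ≤ N, ∀ t, ‖iteratedDeriv i φ t‖ ≤ Cφ * ((s ^ 2)⁻¹) ^ i)
    {ζ : V} (hζ : ‖ζ‖ ≤ R) :
    ∀ i ≤ N, ‖iteratedFDeriv ℝ i (fun ζ => φ (ρ (ξ₀ + stretch s (s ^ 2) n ζ))) ζ‖ ≤
      N.factorial * Cφ * (1 + B + B * R) ^ N := by
  intro i hi
  set L := stretch s (s ^ 2) n with hL
  have hs2 : s ^ 2 ≤ s := by nlinarith
  have hLs : ‖L‖ ≤ s :=
    opNorm_stretch_le hn (abs_of_pos hs).le (by rwa [abs_of_pos (by positivity)])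
  have hB0 : 0 ≤ B := (norm_nonneg _).trans (hB 1 le_rfl (by omega) 0)
  have hC0 : 0 ≤ Cφ := by
    have := (norm_nonneg _).trans (hC 0 (Nat.zero_le _) 0)
    simpa using this
  have hR0 : 0 ≤ R := (norm_nonneg _).trans hζ
  have hD1 : 1 ≤ 1 + B + B * R := by nlinarith [mul_nonneg hB0 hR0]
  -- rescale so that both factors of the composition have bounded derivatives
  let Φ : ℝ → ℂ := fun v => φ (0 + ((s ^ 2) • ContinuousLinearMap.id ℝ ℝ) v)
  let h : V → ℝ := fun ζ => (s ^ 2)⁻¹ • ρ (ξ₀ + L ζ)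
  have hΦh : (fun ζ => φ (ρ (ξ₀ + L ζ))) = Φ ∘ h := by
    ext ζ
    simp only [Φ, h, Function.comp, zero_add, smul_apply,
      ContinuousLinearMap.id_apply, smul_eq_mul]
    rw [mul_inv_cancel_left₀ (by positivity)]
  have hΦs : ContDiff ℝ ∞ Φ := hφ.comp (contDiff_const.add (ContinuousLinearMap.contDiff _))
  have hρL : ContDiff ℝ ∞ (fun ζ => ρ (ξ₀ + L ζ)) :=
    hρ.comp (contDiff_const.add L.contDiff)
  have hhs : ContDiff ℝ ∞ h := hρL.const_smul _
  rw [hΦh]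
  have main := norm_iteratedFDeriv_comp_le hΦs hhs (n := i) (by exact_mod_cast le_top) ζ
    (C := Cφ) (D := 1 + B + B * R) ?_ ?_
  · refine main.trans ?_
    gcongr
  · intro k hk
    refine (norm_iteratedFDeriv_comp_affine_le hφ 0 _ k _).trans ?_
    rw [norm_iteratedFDeriv_eq_norm_iteratedDeriv]
    have h2 : ‖(s ^ 2) • ContinuousLinearMap.id ℝ ℝ‖ ≤ s ^ 2 := by
      rw [norm_smul, Real.norm_eq_abs, abs_of_pos (by positivity)]
      have := ContinuousLinearMap.norm_id_le (𝕜 := ℝ) (E := ℝ)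
      nlinarith [sq_nonneg s]
    calc _ ≤ (Cφ * ((s ^ 2)⁻¹) ^ k) * (s ^ 2) ^ k := by
          gcongr
          exact hC k (hk.trans hi) _
      _ = Cφ := by rw [mul_assoc, ← mul_pow, inv_mul_cancel₀ (by positivity), one_pow, mul_one]
  · intro k hk1 hk
    refine le_trans ?_ (le_self_pow₀ hD1 (by omega))
    simp only [h]
    rw [iteratedFDeriv_const_smul_apply' (hρL.contDiffAt.of_le (by exact_mod_cast le_top)),
      norm_smul, Real.norm_eq_abs, abs_of_pos (by positivity), inv_mul_le_iff₀ (by positivity)]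
    rcases Nat.lt_or_ge k 2 with hk2 | hk2
    · have : k = 1 := by omega
      subst this
      rw [norm_iteratedFDeriv_one]
      have hd : fderiv ℝ (fun ζ => ρ (ξ₀ + L ζ)) ζ = (fderiv ℝ ρ (ξ₀ + L ζ)).comp L := by
        have h3 : HasFDerivAt (fun ζ => ξ₀ + L ζ) L ζ := L.hasFDerivAt.const_add ξ₀
        exact ((hρ.differentiable (by simp) _).hasFDerivAt.comp ζ h3).fderiv
      rw [hd]
      apply ContinuousLinearMap.opNorm_le_bound _ (by positivity)
      intro v
      have hγB : |γ| ≤ B := by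
        have h4 := (fderiv ℝ ρ ξ₀).le_opNorm n
        rw [hγ, real_inner_self_eq_norm_sq, hn, ← norm_iteratedFDeriv_one] at h4
        have := hB 1 le_rfl (by omega) ξ₀
        simp only [one_pow, mul_one, Real.norm_eq_abs] at h4
        linarith
      have h5 : ‖(fderiv ℝ ρ (ξ₀ + L ζ) - fderiv ℝ ρ ξ₀) (L v)‖ ≤ B * (s * R) * (s * ‖v‖) := by
        refine (ContinuousLinearMap.le_opNorm _ _).trans ?_
        have h6 := norm_fderiv_sub_fderiv_le hρ (hB 2 (by omega) (by omega)) ξ₀ (ξ₀ + L ζ)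
        have h7 : ‖L ζ‖ ≤ s * R := (L.le_opNorm ζ).trans (by gcongr)
        have h8 : ‖L v‖ ≤ s * ‖v‖ := (L.le_opNorm v).trans (by gcongr)
        rw [add_sub_cancel_left] at h6
        gcongr
        exact h6.trans (by gcongr)
      have h9 : ‖fderiv ℝ ρ ξ₀ (L v)‖ ≤ B * (s ^ 2 * ‖v‖) := by
        rw [hγ, inner_stretch hn, Real.norm_eq_abs, abs_mul, abs_mul,
          abs_of_pos (by positivity : 0 < s ^ 2)]
        gcongr
        have := abs_real_inner_le_norm n v
        rwa [hn, one_mul] at this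
      calc ‖fderiv ℝ ρ (ξ₀ + L ζ) (L v)‖
          = ‖fderiv ℝ ρ ξ₀ (L v) + (fderiv ℝ ρ (ξ₀ + L ζ) - fderiv ℝ ρ ξ₀) (L v)‖ := by
            simp
        _ ≤ B * (s ^ 2 * ‖v‖) + B * (s * R) * (s * ‖v‖) :=
          (norm_add_le _ _).trans (add_le_add h9 h5)
        _ = s ^ 2 * (B + B * R) * ‖v‖ := by ring
        _ ≤ s ^ 2 * (1 + B + B * R) * ‖v‖ := by
            gcongr
            linarith
    · refine (norm_iteratedFDeriv_comp_affine_le hρ ξ₀ L k ζ).trans ?_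
      have h2 : ‖L‖ ^ k ≤ s ^ 2 := by
        calc ‖L‖ ^ k ≤ s ^ k := by gcongr
          _ ≤ s ^ 2 := pow_le_pow_of_le_one hs.le hs1 hk2
      have h1 := hB k hk1 (by omega) (ξ₀ + L ζ)
      calc _ ≤ B * s ^ 2 := by gcongr
        _ ≤ _ := by nlinarith [mul_nonneg hB0 hR0, sq_nonneg s]

/-- The symbol of a cap, multiplied by a smooth function `u`, is a bump function adapted to a fixed
ball in the coordinates `ξ = ξ₀ + L ζ`, where `L` scales the normal direction by `s²` and the
tangential directions by `s`. -/
theorem exists_cap_symbol_bound (N : ℕ) {B c δ r Cφ P : ℝ} (hc : 0 < c) (hδ : 0 < δ) :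
    ∃ R K : ℝ, 0 < R ∧ 0 < K ∧
    ∀ (ρ : V → ℝ) (φ : ℝ → ℂ) (ψ u : V → ℂ) (ξ₀ n w : V) (s γ U : ℝ), ContDiff ℝ ∞ ρ →
    ContDiff ℝ ∞ φ → ContDiff ℝ ∞ ψ → ContDiff ℝ ∞ u → 0 < s → s ≤ 1 → ‖n‖ = 1 →
    (∀ v, fderiv ℝ ρ ξ₀ v = γ * inner ℝ n v) → c ≤ γ →
    (∀ i, 1 ≤ i → i ≤ N + 2 → ∀ x, ‖iteratedFDeriv ℝ i ρ x‖ ≤ B) →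
    (∀ i ≤ N, ∀ t, ‖iteratedDeriv i φ t‖ ≤ Cφ * ((s ^ 2)⁻¹) ^ i) →
    (∀ t, φ t ≠ 0 → |t - ρ ξ₀| ≤ s ^ 2) →
    (∀ i ≤ N, ∀ x, ‖iteratedFDeriv ℝ i ψ x‖ ≤ P) →
    (∀ ξ, ψ ((δ * s)⁻¹ • ξ - w) ≠ 0 → ‖ξ - ξ₀‖ ≤ r * s) →
    (∀ i ≤ N, ∀ x, ‖x - ξ₀‖ ≤ R → ‖iteratedFDeriv ℝ i u x‖ ≤ U) →
    (∀ ζ, R < ‖ζ‖ → φ (ρ (ξ₀ + stretch s (s ^ 2) n ζ)) *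
      ψ ((δ * s)⁻¹ • (ξ₀ + stretch s (s ^ 2) n ζ) - w) * u (ξ₀ + stretch s (s ^ 2) n ζ) = 0) ∧
    ∀ i ≤ N, ∀ ζ, ‖iteratedFDeriv ℝ i (fun ζ => φ (ρ (ξ₀ + stretch s (s ^ 2) n ζ)) *
      ψ ((δ * s)⁻¹ • (ξ₀ + stretch s (s ^ 2) n ζ) - w) * u (ξ₀ + stretch s (s ^ 2) n ζ)) ζ‖ ≤
        K * U := by
  obtain ⟨R, hR, hsupp⟩ := exists_norm_le_of_mem_cap (V := V) (B := B) (c := c) (r := r) hc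
  refine ⟨R, 2 ^ N * (2 ^ N * (N.factorial * |Cφ| * (1 + |B| + |B| * R) ^ N * (|P| *
    (1 + δ⁻¹) ^ N))) + 1, hR, by positivity, ?_⟩
  intro ρ φ ψ u ξ₀ n w s γ U hρ hφ hψ hu hs hs1 hn hγ hcγ hB hCφ hφs hP hψs hU
  set L := stretch s (s ^ 2) n with hL
  have hs2 : s ^ 2 ≤ s := by nlinarith
  have hLs : ‖L‖ ≤ s :=
    opNorm_stretch_le hn (abs_of_pos hs).le (by rwa [abs_of_pos (by positivity)])
  have hB0 : 0 ≤ B := (norm_nonneg _).trans (hB 1 le_rfl (by omega) 0)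
  have hC0 : 0 ≤ Cφ := by
    have := (norm_nonneg _).trans (hCφ 0 (Nat.zero_le _) 0)
    simpa using this
  have hP0 : 0 ≤ P := (norm_nonneg _).trans (hP 0 (Nat.zero_le _) 0)
  have hU0 : 0 ≤ U := (norm_nonneg _).trans (hU 0 (Nat.zero_le _) ξ₀ (by simpa using hR.le))
  rw [abs_of_nonneg hB0, abs_of_nonneg hC0, abs_of_nonneg hP0]
  have hzero : ∀ ζ, R < ‖ζ‖ → φ (ρ (ξ₀ + L ζ)) * ψ ((δ * s)⁻¹ • (ξ₀ + L ζ) - w) *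
      u (ξ₀ + L ζ) = 0 := by
    intro ζ hζ
    by_contra h0
    have h1 : φ (ρ (ξ₀ + L ζ)) ≠ 0 := fun h => h0 (by rw [h, zero_mul, zero_mul])
    have h2 : ψ ((δ * s)⁻¹ • (ξ₀ + L ζ) - w) ≠ 0 := fun h => h0 (by rw [h, mul_zero, zero_mul])
    have h3 := hψs _ h2
    rw [add_sub_cancel_left] at h3
    exact absurd (hsupp ρ ξ₀ n s γ hρ hs hn hγ hcγ (hB 2 (by omega) (by omega)) ζ h3 (hφs _ h1))
      (not_le.2 hζ)
  refine ⟨hzero, ?_⟩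
  intro i hi ζ
  by_cases hζ : R < ‖ζ‖
  · rw [iteratedFDeriv_eq_zero_of_norm_gt hzero i hζ, norm_zero]
    positivity
  rw [not_lt] at hζ
  have b1 := norm_iteratedFDeriv_comp_cap_le hρ hφ hs hs1 hn hγ hB hCφ hζ
  have hψe : (fun ζ => ψ ((δ * s)⁻¹ • (ξ₀ + L ζ) - w)) =
      fun ζ => ψ (((δ * s)⁻¹ • ξ₀ - w) + ((δ * s)⁻¹ • L) ζ) := by
    ext ζ
    congr 1
    rw [smul_apply, smul_add]
    abel
  have b2 : ∀ i ≤ N, ‖iteratedFDeriv ℝ i (fun ζ => ψ ((δ * s)⁻¹ • (ξ₀ + L ζ) - w)) ζ‖ ≤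
      P * (1 + δ⁻¹) ^ N := by
    intro k hk
    rw [hψe]
    refine (norm_iteratedFDeriv_comp_affine_le hψ _ _ k ζ).trans ?_
    have h1 : ‖(δ * s)⁻¹ • L‖ ≤ 1 + δ⁻¹ := by
      rw [norm_smul, Real.norm_eq_abs, abs_of_pos (by positivity), inv_mul_le_iff₀ (by positivity)]
      have : δ * s * (1 + δ⁻¹) = δ * s + s := by field_simp
      rw [this]
      nlinarith [mul_pos hδ hs]
    calc _ ≤ P * (1 + δ⁻¹) ^ k := by
          gcongr
          exact hP k hk _
      _ ≤ _ := by
          gcongr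
          linarith [inv_pos.2 hδ]
  have b3 : ∀ i ≤ N, ‖iteratedFDeriv ℝ i (fun ζ => u (ξ₀ + L ζ)) ζ‖ ≤ U := by
    intro k hk
    refine (norm_iteratedFDeriv_comp_affine_le hu _ _ k ζ).trans ?_
    have h1 : ‖L‖ ^ k ≤ 1 := pow_le_one₀ (norm_nonneg _) (hLs.trans hs1)
    have h2 : ‖L ζ‖ ≤ R := (L.le_opNorm ζ).trans (by
      nlinarith [norm_nonneg L, norm_nonneg ζ, hLs.trans hs1])
    calc _ ≤ U * 1 := by
          gcongr
          exact hU k hk _ (by rwa [add_sub_cancel_left])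
      _ = U := mul_one U
  have hL' : ContDiff ℝ ∞ (fun ζ => ξ₀ + L ζ) := contDiff_const.add L.contDiff
  have c1 : ContDiff ℝ ∞ (fun ζ => φ (ρ (ξ₀ + L ζ))) := hφ.comp (hρ.comp hL')
  have c2 : ContDiff ℝ ∞ (fun ζ => ψ ((δ * s)⁻¹ • (ξ₀ + L ζ) - w)) :=
    hψ.comp ((hL'.const_smul _).sub contDiff_const)
  have c3 : ContDiff ℝ ∞ (fun ζ => u (ξ₀ + L ζ)) := hu.comp hL'
  refine (norm_iteratedFDeriv_mul_le_of_le (c1.mul c2) c3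
    (norm_iteratedFDeriv_mul_le_of_le c1 c2 b1 b2) b3 i hi).trans ?_
  rw [← mul_assoc]
  gcongr
  linarith

end CapSymbols

/-! ### Geometry of the shell -/

section ShellGeometry

open scoped ContDiff

variable {d : ℕ} {ρ : EuclideanSpace ℝ (Fin d) → ℝ} {b : ℝ}

namespace IsHomogeneousDistance

theorem map_zero (hρ : IsHomogeneousDistance ρ b) : ρ 0 = 0 := by
  have := hρ.homogeneous 2 two_pos 0
  rw [smul_zero] at this
  linarith

theorem nonneg (hρ : IsHomogeneousDistance ρ b) (ξ : EuclideanSpace ℝ (Fin d)) : 0 ≤ ρ ξ := by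
  by_cases h : ξ = 0
  · rw [h, hρ.map_zero]
  · exact (hρ.pos ξ h).le

/-- Euler's identity for homogeneous functions. -/
theorem fderiv_self (hρ : IsHomogeneousDistance ρ b) {ξ : EuclideanSpace ℝ (Fin d)} (hξ : ξ ≠ 0) :
    b * fderiv ℝ ρ ξ ξ = ρ ξ := by
  have hd : DifferentiableAt ℝ ρ ξ :=
    (hρ.smooth.contDiffAt (isOpen_compl_singleton.mem_nhds hξ)).differentiableAt (by simp)
  have h1 : HasDerivAt (fun t : ℝ => t ^ b) b 1 := by
    simpa using Real.hasDerivAt_rpow_const (x := 1) (p := b) (Or.inl one_ne_zero)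
  have h2 : HasDerivAt (fun t : ℝ => (t ^ b) • ξ) (b • ξ) 1 := h1.smul_const ξ
  have h3 : HasDerivAt (fun t : ℝ => ρ ((t ^ b) • ξ)) (fderiv ℝ ρ ξ (b • ξ)) 1 := by
    have h4 : HasFDerivAt ρ (fderiv ℝ ρ ξ) (((1 : ℝ) ^ b) • ξ) := by
      rw [Real.one_rpow, one_smul]
      exact hd.hasFDerivAt
    exact h4.comp_hasDerivAt 1 h2
  have h5 : HasDerivAt (fun t : ℝ => ρ ((t ^ b) • ξ)) (ρ ξ) 1 := by
    have h6 : HasDerivAt (fun t : ℝ => t * ρ ξ) (ρ ξ) 1 := by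
      simpa using (hasDerivAt_id (1 : ℝ)).mul_const (ρ ξ)
    apply h6.congr_of_eventuallyEq
    filter_upwards [lt_mem_nhds one_pos] with t ht
    exact hρ.homogeneous t ht ξ
  have := h3.unique h5
  rwa [map_smul, smul_eq_mul] at this

theorem exists_norm_ge (hρ : IsHomogeneousDistance ρ b) :
    ∃ r : ℝ, 0 < r ∧ ∀ ξ, 1 / 2 ≤ ρ ξ → r ≤ ‖ξ‖ := by
  have h := Metric.continuousAt_iff.1 (hρ.continuous.continuousAt (x := 0)) (1 / 2) (by norm_num)
  obtain ⟨r, hr, h⟩ := h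
  refine ⟨r, hr, fun ξ hξ => ?_⟩
  by_contra hlt
  have := h (x := ξ) (by simpa using hlt)
  rw [hρ.map_zero, Real.dist_eq, sub_zero, abs_of_nonneg (hρ.nonneg ξ)] at this
  linarith

theorem exists_norm_le (hρ : IsHomogeneousDistance ρ b) (hd : 1 ≤ d) :
    ∃ R : ℝ, 0 < R ∧ ∀ ξ, ρ ξ ≤ 1 → ‖ξ‖ ≤ R := by
  have : Nonempty (Fin d) := ⟨⟨0, hd⟩⟩
  obtain ⟨x₀, hx₀, hmin⟩ := (isCompact_sphere (0 : EuclideanSpace ℝ (Fin d)) 1).exists_isMinOn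
    (NormedSpace.sphere_nonempty.2 zero_le_one) hρ.continuous.continuousOn
  have hx₀' : x₀ ≠ 0 := by
    rintro rfl
    simp at hx₀
  have hc := hρ.pos x₀ hx₀'
  have hb := hρ.exponent_pos
  refine ⟨((ρ x₀)⁻¹) ^ b, by positivity, fun ξ hξ => ?_⟩
  by_cases h0 : ξ = 0
  · rw [h0, norm_zero]
    positivity
  have hn : 0 < ‖ξ‖ := norm_pos_iff.2 h0
  have h1 := hρ.homogeneous (‖ξ‖ ^ (1 / b)) (by positivity) (‖ξ‖⁻¹ • ξ)
  rw [← Real.rpow_mul hn.le, one_div_mul_cancel hb.ne', Real.rpow_one, smul_smul,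
    mul_inv_cancel₀ hn.ne', one_smul] at h1
  have h2 : ρ x₀ ≤ ρ (‖ξ‖⁻¹ • ξ) := hmin (by simp [norm_smul, hn.ne'])
  have h3 : ‖ξ‖ ^ (1 / b) ≤ (ρ x₀)⁻¹ := by
    rw [← one_div, le_div_iff₀ hc]
    calc ‖ξ‖ ^ (1 / b) * ρ x₀ ≤ ‖ξ‖ ^ (1 / b) * ρ (‖ξ‖⁻¹ • ξ) := by gcongr
      _ ≤ 1 := by rw [← h1]; exact hξ
  calc ‖ξ‖ = (‖ξ‖ ^ (1 / b)) ^ b := by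
        rw [← Real.rpow_mul hn.le, one_div_mul_cancel hb.ne', Real.rpow_one]
    _ ≤ _ := Real.rpow_le_rpow (by positivity) h3 hb.le

end IsHomogeneousDistance

/-- Near the shell `1/2 ≤ ρ ≤ 1`, which lies in the annulus `inner ≤ ‖ξ‖ ≤ outer`, the distance
function `ρ` agrees with a function `model` that is smooth on the whole space with all derivatives
bounded, and whose gradient does not vanish on the shell. -/
structure ShellModel (ρ : EuclideanSpace ℝ (Fin d) → ℝ) where
  inner : ℝ
  outer : ℝ
  model : EuclideanSpace ℝ (Fin d) → ℝ
  slope : ℝ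
  inner_pos : 0 < inner
  outer_pos : 0 < outer
  inner_le : ∀ ξ, 1 / 2 ≤ ρ ξ → inner ≤ ‖ξ‖
  le_outer : ∀ ξ, ρ ξ ≤ 1 → ‖ξ‖ ≤ outer
  smooth : ContDiff ℝ ∞ model
  bound : ∀ N : ℕ, ∃ B : ℝ, ∀ i ≤ N, ∀ x, ‖iteratedFDeriv ℝ i model x‖ ≤ B
  eq : ∀ ξ, inner / 2 ≤ ‖ξ‖ → ‖ξ‖ ≤ 2 * outer → model ξ = ρ ξ
  slope_pos : 0 < slope
  gradient : ∀ ξ, 1 / 2 ≤ ρ ξ → ρ ξ ≤ 1 → ∃ (n : EuclideanSpace ℝ (Fin d)) (γ : ℝ),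
    ‖n‖ = 1 ∧ slope ≤ γ ∧ ∀ v, fderiv ℝ model ξ v = γ * Inner.inner ℝ n v

theorem exists_forall_norm_iteratedFDeriv_le {V F : Type*} [NormedAddCommGroup V] [NormedSpace ℝ V]
    [NormedAddCommGroup F] [NormedSpace ℝ F] {f : V → F} (hf : ContDiff ℝ ∞ f)
    (hc : HasCompactSupport f) (N : ℕ) :
    ∃ B : ℝ, 0 ≤ B ∧ ∀ i ≤ N, ∀ x, ‖iteratedFDeriv ℝ i f x‖ ≤ B := by
  have h : ∀ i : ℕ, ∃ B : ℝ, ∀ x, ‖iteratedFDeriv ℝ i f x‖ ≤ B := fun i =>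
    (hf.continuous_iteratedFDeriv (by exact_mod_cast le_top)).bounded_above_of_compact_support
      (hc.iteratedFDeriv i)
  choose B hB using h
  have hB0 : ∀ i, 0 ≤ B i := fun i => (norm_nonneg _).trans (hB i 0)
  refine ⟨∑ i ∈ Finset.range (N + 1), B i, Finset.sum_nonneg fun i _ => hB0 i, fun i hi x => ?_⟩
  exact (hB i x).trans (Finset.single_le_sum (f := B) (fun i _ => hB0 i) (by simp; omega))

/-- Smooth radial cutoff: one on the annulus `r ≤ ‖x‖ ≤ R`, zero for `‖x‖ ≤ r / 2`, and of compact
support. -/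
theorem exists_annulus_cutoff {V : Type*} [NormedAddCommGroup V] [InnerProductSpace ℝ V]
    [FiniteDimensional ℝ V] {r R : ℝ} (hr : 0 < r) (hR : 0 < R) :
    ∃ η : V → ℝ, ContDiff ℝ ∞ η ∧ HasCompactSupport η ∧ (∀ x, |η x| ≤ 1) ∧
      (∀ x, r ≤ ‖x‖ → ‖x‖ ≤ R → η x = 1) ∧ ∀ x, ‖x‖ ≤ r / 2 → η x = 0 := by
  let f₁ : ContDiffBump (0 : V) := ⟨R, 2 * R, hR, by linarith⟩
  let f₂ : ContDiffBump (0 : V) := ⟨r / 2, r, by linarith, by linarith⟩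
  refine ⟨fun x => f₁ x * (1 - f₂ x), f₁.contDiff.mul (contDiff_const.sub f₂.contDiff),
    f₁.hasCompactSupport.mul_right, ?_, ?_, ?_⟩
  · intro x
    rw [abs_mul, abs_of_nonneg f₁.nonneg, abs_of_nonneg (sub_nonneg.2 f₂.le_one)]
    nlinarith [f₁.nonneg (x := x), f₁.le_one (x := x), f₂.nonneg (x := x), f₂.le_one (x := x)]
  · intro x h1 h2
    dsimp only
    rw [f₁.one_of_mem_closedBall (by simpa using h2), f₂.zero_of_le_dist (by simpa using h1)]
    ring
  · intro x hx
    dsimp only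
    rw [f₂.one_of_mem_closedBall (by simpa using hx)]
    ring

theorem IsHomogeneousDistance.nonempty_shellModel (hρ : IsHomogeneousDistance ρ b) (hd : 1 ≤ d) :
    Nonempty (ShellModel ρ) := by
  obtain ⟨r, hr, hr'⟩ := hρ.exists_norm_ge
  obtain ⟨R, hR, hR'⟩ := hρ.exists_norm_le hd
  obtain ⟨η, hη, hηc, -, hη1, hη0⟩ := exists_annulus_cutoff (V := EuclideanSpace ℝ (Fin d))
    (r := r / 4) (R := 4 * R) (by linarith) (by linarith)
  have hb := hρ.exponent_pos
  have hs : ContDiff ℝ ∞ (fun ξ => η ξ * ρ ξ) := by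
    rw [contDiff_iff_contDiffAt]
    intro x
    by_cases hx : x = 0
    · have : (fun ξ => η ξ * ρ ξ) =ᶠ[nhds x] fun _ => 0 := by
        rw [hx]
        filter_upwards [Metric.ball_mem_nhds (0 : EuclideanSpace ℝ (Fin d))
          (show 0 < r / 4 / 2 by linarith)] with y hy
        rw [hη0 y (by simpa using (Metric.mem_ball.1 hy).le), zero_mul]
      exact contDiffAt_const.congr_of_eventuallyEq this
    · exact hη.contDiffAt.mul (hρ.smooth.contDiffAt (isOpen_compl_singleton.mem_nhds hx))
  have heq : ∀ ξ, r / 4 ≤ ‖ξ‖ → ‖ξ‖ ≤ 4 * R → η ξ * ρ ξ = ρ ξ := by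
    intro ξ h1 h2
    rw [hη1 ξ h1 h2, one_mul]
  refine ⟨⟨r, R, fun ξ => η ξ * ρ ξ, 1 / (2 * b * R), hr, hR, hr', hR', hs, ?_,
    fun ξ h1 h2 => heq ξ (by linarith) (by linarith), by positivity, ?_⟩⟩
  · intro N
    obtain ⟨B, -, hB⟩ := exists_forall_norm_iteratedFDeriv_le hs hηc.mul_right N
    exact ⟨B, hB⟩
  · intro ξ h1 h2
    have hn1 := hr' ξ h1
    have hn2 := hR' ξ h2
    have hξ : ξ ≠ 0 := norm_pos_iff.1 (hr.trans_le hn1)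
    have hev : (fun ξ => η ξ * ρ ξ) =ᶠ[nhds ξ] ρ := by
      filter_upwards [(continuous_norm.tendsto ξ).eventually_const_lt
        (show r / 4 < ‖ξ‖ by linarith),
        (continuous_norm.tendsto ξ).eventually_lt_const (show ‖ξ‖ < 4 * R by linarith)] with y h3 h4
      exact heq y h3.le h4.le
    rw [hev.fderiv_eq]
    set G := (InnerProductSpace.toDual ℝ (EuclideanSpace ℝ (Fin d))).symm (fderiv ℝ ρ ξ) with hG
    have hGv : ∀ v, Inner.inner ℝ G v = fderiv ℝ ρ ξ v := fun v => by
      rw [hG, InnerProductSpace.toDual_symm_apply]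
    have hE := hρ.fderiv_self hξ
    have hGle : 1 / (2 * b * R) ≤ ‖G‖ := by
      have h3 := real_inner_le_norm G ξ
      rw [hGv] at h3
      have h4 : ‖G‖ * ‖ξ‖ ≤ ‖G‖ * R := by gcongr
      rw [div_le_iff₀ (by positivity)]
      have h5 : b * fderiv ℝ ρ ξ ξ ≤ b * (‖G‖ * R) := by
        gcongr
        linarith
      nlinarith
    have hGpos : 0 < ‖G‖ := lt_of_lt_of_le (by positivity) hGle
    refine ⟨‖G‖⁻¹ • G, ‖G‖, ?_, hGle, fun v => ?_⟩
    · rw [norm_smul, norm_inv, norm_norm, inv_mul_cancel₀ hGpos.ne']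
    · rw [real_inner_smul_left, hGv, mul_inv_cancel_left₀ hGpos.ne']

end ShellGeometry

/-! ### Counting lattice cells near the shell -/

section Counting

open scoped Pointwise

variable {d : ℕ} {ρ : EuclideanSpace ℝ (Fin d) → ℝ} {b : ℝ}

theorem EuclideanSpace.norm_le_of_forall_abs_le {x : EuclideanSpace ℝ (Fin d)} {c : ℝ} (hc : 0 ≤ c)
    (h : ∀ i, |x i| ≤ c) : ‖x‖ ≤ d * c := by
  rw [EuclideanSpace.norm_eq, Real.sqrt_le_left (by positivity)]
  calc ∑ i, ‖x i‖ ^ 2 ≤ ∑ _i : Fin d, c ^ 2 := by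
        apply Finset.sum_le_sum
        intro i _
        rw [Real.norm_eq_abs]
        gcongr
        exact h i
    _ = d * c ^ 2 := by simp
    _ ≤ (d * c) ^ 2 := by
        have : (d : ℝ) ≤ (d : ℝ) ^ 2 := by exact_mod_cast Nat.le_self_pow two_ne_zero d
        nlinarith [sq_nonneg c]

theorem EuclideanSpace.abs_apply_le_norm (x : EuclideanSpace ℝ (Fin d)) (i : Fin d) :
    |x i| ≤ ‖x‖ := by
  simpa using PiLp.norm_apply_le x i

/-- The half-open cube of side `σ` with lowest corner `σ k`. -/
def latticeCube (σ : ℝ) (k : Fin d → ℤ) : Set (EuclideanSpace ℝ (Fin d)) :=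
  {y | ∀ i, y i ∈ Set.Ico (σ * k i) (σ * k i + σ)}

theorem latticeCube_eq_preimage (σ : ℝ) (k : Fin d → ℤ) : latticeCube σ k =
    (WithLp.ofLp : EuclideanSpace ℝ (Fin d) → Fin d → ℝ) ⁻¹'
      Set.pi Set.univ fun i => Set.Ico (σ * k i) (σ * k i + σ) := by
  ext y
  simp [latticeCube, Set.mem_pi]

theorem measurableSet_latticeCube (σ : ℝ) (k : Fin d → ℤ) : MeasurableSet (latticeCube σ k) := by
  rw [latticeCube_eq_preimage]
  exact (PiLp.volume_preserving_ofLp (Fin d)).measurable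
    (MeasurableSet.univ_pi fun i => measurableSet_Ico)

theorem volume_latticeCube (σ : ℝ) (k : Fin d → ℤ) :
    volume (latticeCube σ k) = ENNReal.ofReal σ ^ d := by
  rw [latticeCube_eq_preimage,
    (PiLp.volume_preserving_ofLp (Fin d)).measure_preimage
      (MeasurableSet.univ_pi fun i => measurableSet_Ico).nullMeasurableSet, Real.volume_pi_Ico]
  simp

theorem disjoint_latticeCube {σ : ℝ} (hσ : 0 < σ) {k l : Fin d → ℤ} (h : k ≠ l) :
    Disjoint (latticeCube σ k) (latticeCube σ l) := by
  rw [Set.disjoint_left]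
  intro y hk hl
  apply h
  ext i
  have h1 := hk i
  have h2 := hl i
  simp only [Set.mem_Ico] at h1 h2
  have h3 : σ * k i < σ * (l i + 1) := by linarith
  have h4 : σ * l i < σ * (k i + 1) := by linarith
  have h5 : (k i : ℝ) < l i + 1 := lt_of_mul_lt_mul_left h3 hσ.le
  have h6 : (l i : ℝ) < k i + 1 := lt_of_mul_lt_mul_left h4 hσ.le
  have h7 : k i < l i + 1 := by exact_mod_cast h5
  have h8 : l i < k i + 1 := by exact_mod_cast h6
  omega

theorem card_mul_le_volume {σ : ℝ} (hσ : 0 < σ) (I : Finset (Fin d → ℤ))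
    {T : Set (EuclideanSpace ℝ (Fin d))} (h : ∀ k ∈ I, latticeCube σ k ⊆ T) :
    (I.card : ℝ≥0∞) * ENNReal.ofReal σ ^ d ≤ volume T := by
  calc (I.card : ℝ≥0∞) * ENNReal.ofReal σ ^ d = ∑ k ∈ I, volume (latticeCube σ k) := by
        simp [volume_latticeCube]
    _ = volume (⋃ k ∈ I, latticeCube σ k) := by
        rw [measure_biUnion_finset]
        · intro k _ l _ hkl
          exact disjoint_latticeCube hσ hkl
        · intro k _
          exact measurableSet_latticeCube σ k
    _ ≤ volume T := measure_mono (Set.iUnion₂_subset h)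

namespace IsHomogeneousDistance

/-- The sublevel sets of `ρ` in a cone are dilates of each other. -/
theorem volume_cone_inter_lt (hρ : IsHomogeneousDistance ρ b)
    {Γ : Set (EuclideanSpace ℝ (Fin d))} (hΓ : ∀ t : ℝ, 0 < t → ∀ x, x ∈ Γ → t • x ∈ Γ)
    {s : ℝ} (hs : 0 < s) :
    volume (Γ ∩ {ξ | ρ ξ < s}) =
      ENNReal.ofReal (s ^ (b * d)) * volume (Γ ∩ {ξ | ρ ξ < 1}) := by
  have e : Γ ∩ {ξ | ρ ξ < s} = (s ^ b) • (Γ ∩ {ξ | ρ ξ < 1}) := by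
    ext x
    have hsb : 0 < s ^ b := by positivity
    rw [Set.mem_smul_set_iff_inv_smul_mem₀ hsb.ne']
    have h1 : ρ x = s * ρ ((s ^ b)⁻¹ • x) := by
      rw [← hρ.homogeneous s hs, smul_smul, mul_inv_cancel₀ hsb.ne', one_smul]
    constructor
    · rintro ⟨h2, h3⟩
      refine ⟨hΓ _ (by positivity) _ h2, ?_⟩
      simp only [Set.mem_ofPred_eq] at h3 ⊢
      rw [h1] at h3
      nlinarith
    · rintro ⟨h2, h3⟩
      refine ⟨?_, ?_⟩
      · have := hΓ _ hsb _ h2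
        rwa [smul_smul, mul_inv_cancel₀ hsb.ne', one_smul] at this
      · simp only [Set.mem_ofPred_eq] at h3 ⊢
        rw [h1]
        nlinarith
  rw [e, Measure.addHaar_smul, finrank_euclideanSpace_fin, abs_of_pos (by positivity),
    ← Real.rpow_natCast, ← Real.rpow_mul hs.le]

theorem exists_rpow_sub_le {q : ℝ} (hq : 0 < q) : ∃ C : ℝ, 0 < C ∧
    ∀ u : ℝ, 0 < u → u ≤ 1 / 2 → (1 + u) ^ q - (1 - u) ^ q ≤ C * u := by
  refine ⟨q * (3 / 2) ^ q * 2 * 2, by positivity, fun u hu hu2 => ?_⟩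
  have := Convex.norm_image_sub_le_of_norm_deriv_le (𝕜 := ℝ) (f := fun x : ℝ => x ^ q)
    (s := Set.Icc (1 / 2) (3 / 2)) (x := 1 - u) (y := 1 + u) (C := q * (3 / 2) ^ q * 2) ?_ ?_
    (convex_Icc _ _) ⟨by linarith, by linarith⟩ ⟨by linarith, by linarith⟩
  · rw [Real.norm_eq_abs, Real.norm_eq_abs] at this
    have h2 : |1 + u - (1 - u)| = 2 * u := by rw [abs_of_pos (by linarith)]; ring
    rw [h2] at this
    have := (le_abs_self _).trans this
    linarith
  · intro x hx
    exact (Real.hasDerivAt_rpow_const (Or.inl (by linarith [hx.1]))).differentiableAt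
  · intro x hx
    have hx0 : 0 < x := by linarith [hx.1]
    rw [(Real.hasDerivAt_rpow_const (Or.inl hx0.ne')).deriv, Real.rpow_sub_one hx0.ne',
      Real.norm_eq_abs, abs_of_pos (by positivity)]
    have h1 : x ^ q ≤ (3 / 2) ^ q := Real.rpow_le_rpow hx0.le hx.2 hq.le
    rw [mul_assoc]
    gcongr
    rw [div_le_iff₀ hx0]
    have h2 : 0 < (3 / 2 : ℝ) ^ q := by positivity
    nlinarith [hx.1]

/-- A cone meets the shell `|ρ - 1| ≤ u` in a set of measure proportional to `u`. -/
theorem exists_volume_shell_le (hρ : IsHomogeneousDistance ρ b) (hd : 1 ≤ d) (U : ℝ) :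
    ∃ C : ℝ, 0 < C ∧ ∀ (u : ℝ) (Γ : Set (EuclideanSpace ℝ (Fin d))), 0 < u → u ≤ U →
    MeasurableSet Γ → (∀ t : ℝ, 0 < t → ∀ x, x ∈ Γ → t • x ∈ Γ) →
    volume (Γ ∩ {ξ | 1 - u ≤ ρ ξ ∧ ρ ξ < 1 + u}) ≤
      ENNReal.ofReal (C * u) * volume (Γ ∩ {ξ | ρ ξ < 1}) := by
  have hb := hρ.exponent_pos
  have hq : 0 < b * d := by
    have : (0 : ℝ) < d := by exact_mod_cast hd
    positivity
  obtain ⟨C, hC, h⟩ := exists_rpow_sub_le hq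
  refine ⟨C + 2 * (1 + |U|) ^ (b * d), by positivity, fun u Γ hu huU hΓm hΓ => ?_⟩
  by_cases hu2 : u ≤ 1 / 2
  · by_cases htop : volume (Γ ∩ {ξ | ρ ξ < 1}) = ⊤
    · rw [htop, ENNReal.mul_top]
      · exact le_top
      · simpa using by positivity
    have e : Γ ∩ {ξ | 1 - u ≤ ρ ξ ∧ ρ ξ < 1 + u} =
        (Γ ∩ {ξ | ρ ξ < 1 + u}) \ (Γ ∩ {ξ | ρ ξ < 1 - u}) := by
      ext x
      simp only [Set.mem_inter_iff, Set.mem_ofPred_eq, Set.mem_sdiff, not_and, not_lt]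
      tauto
    have hm : MeasurableSet (Γ ∩ {ξ | ρ ξ < 1 - u}) :=
      hΓm.inter (measurableSet_lt hρ.continuous.measurable measurable_const)
    have h1 := hρ.volume_cone_inter_lt hΓ (s := 1 - u) (by linarith)
    have h2 := hρ.volume_cone_inter_lt hΓ (s := 1 + u) (by linarith)
    rw [e, measure_sdiff _ hm.nullMeasurableSet, h1, h2]
    · rw [← ENNReal.sub_mul (fun _ _ => htop), ← ENNReal.ofReal_sub _
        (Real.rpow_nonneg (by linarith) _)]
      gcongr
      refine (h u hu hu2).trans ?_
      gcongr
      have : 0 < (1 + |U|) ^ (b * d) := by positivity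
      linarith
    · rw [h1]
      exact ENNReal.mul_ne_top ENNReal.ofReal_ne_top htop
    · intro x hx
      refine ⟨hx.1, ?_⟩
      have := hx.2
      simp only [Set.mem_ofPred_eq] at this ⊢
      linarith
  -- for `u` of size one the shell is estimated by the whole sublevel set
  · calc volume (Γ ∩ {ξ | 1 - u ≤ ρ ξ ∧ ρ ξ < 1 + u}) ≤ volume (Γ ∩ {ξ | ρ ξ < 1 + u}) :=
          measure_mono fun x hx => ⟨hx.1, hx.2.2⟩
      _ = _ := hρ.volume_cone_inter_lt hΓ (by linarith)
      _ ≤ _ := by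
          gcongr
          have h3 : (1 + u) ^ (b * d) ≤ (1 + |U|) ^ (b * d) := by
            apply Real.rpow_le_rpow (by linarith) _ hq.le
            linarith [le_abs_self U]
          have h4 : 0 < (1 + |U|) ^ (b * d) := by positivity
          nlinarith

end IsHomogeneousDistance

theorem det_stretch {V : Type*} [NormedAddCommGroup V] [InnerProductSpace ℝ V]
    [FiniteDimensional ℝ V] {α β : ℝ} (hα : α ≠ 0) {n : V} (hn : ‖n‖ = 1) :
    LinearMap.det (stretch α β n : V →ₗ[ℝ] V) = α ^ Module.finrank ℝ V * (β / α) := by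
  have e : (stretch α β n : V →ₗ[ℝ] V) =
      α • LinearMap.transvection (((β - α) / α) • (innerₗ V n)) n := by
    ext x
    simp only [ContinuousLinearMap.coe_coe, stretch_apply, LinearMap.smul_apply,
      LinearMap.transvection.apply, innerₗ_apply_apply, smul_eq_mul]
    rw [smul_add, smul_smul, ← mul_assoc, mul_div_cancel₀ _ hα]
  rw [e, LinearMap.det_smul, LinearMap.transvection.det]
  congr 1
  simp only [LinearMap.smul_apply, innerₗ_apply_apply, smul_eq_mul,
    real_inner_self_eq_norm_sq, hn]
  field_simp
  ring

/-- The cone of vectors whose angle to the line spanned by `f` has sine at most `θ`. -/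
def lineCone {V : Type*} [NormedAddCommGroup V] [InnerProductSpace ℝ V] (f : V) (θ : ℝ) : Set V :=
  {y | ‖y - inner ℝ f y • f‖ ≤ θ * ‖y‖}

theorem measurableSet_lineCone (f : EuclideanSpace ℝ (Fin d)) (θ : ℝ) :
    MeasurableSet (lineCone f θ) :=
  (isClosed_le (by fun_prop) (by fun_prop)).measurableSet

theorem smul_mem_lineCone {V : Type*} [NormedAddCommGroup V] [InnerProductSpace ℝ V] {f : V} {θ : ℝ}
    (t : ℝ) (ht : 0 < t) (x : V) (hx : x ∈ lineCone f θ) : t • x ∈ lineCone f θ := by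
  simp only [lineCone, Set.mem_ofPred_eq] at hx ⊢
  rw [real_inner_smul_right, ← smul_smul, ← smul_sub, norm_smul, norm_smul, Real.norm_eq_abs,
    abs_of_pos ht]
  nlinarith

/-- A cone of aperture `θ` inside a ball is contained in the image of a ball under a linear map with
determinant `θ ^ (d - 1) ≤ θ`. -/
theorem volume_lineCone_inter_closedBall_le (hd : 2 ≤ d) {R θ : ℝ} (hR : 0 < R) (hθ : 0 < θ)
    {f : EuclideanSpace ℝ (Fin d)} (hf : ‖f‖ = 1) :
    volume (lineCone f θ ∩ Metric.closedBall 0 R) ≤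
      ENNReal.ofReal θ * volume (Metric.closedBall (0 : EuclideanSpace ℝ (Fin d)) (2 * R)) := by
  by_cases hθ1 : 1 < θ
  · calc _ ≤ volume (Metric.closedBall (0 : EuclideanSpace ℝ (Fin d)) (2 * R)) := by
          apply measure_mono
          refine Set.inter_subset_right.trans (Metric.closedBall_subset_closedBall (by linarith))
      _ = 1 * _ := (one_mul _).symm
      _ ≤ _ := by
          gcongr
          rw [ENNReal.one_le_ofReal]
          exact hθ1.le
  rw [not_lt] at hθ1
  have hsub : lineCone f θ ∩ Metric.closedBall 0 R ⊆
      (stretch θ 1 f : EuclideanSpace ℝ (Fin d) →ₗ[ℝ] EuclideanSpace ℝ (Fin d)) ''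
        Metric.closedBall 0 (2 * R) := by
    rintro y ⟨h1, h2⟩
    simp only [lineCone, Set.mem_ofPred_eq, mem_closedBall_zero_iff] at h1 h2
    refine ⟨θ⁻¹ • (y - inner ℝ f y • f) + inner ℝ f y • f, ?_, ?_⟩
    · rw [mem_closedBall_zero_iff]
      refine (norm_add_le _ _).trans ?_
      rw [norm_smul, norm_smul, hf, mul_one, norm_inv, Real.norm_eq_abs, abs_of_pos hθ]
      have h3 : θ⁻¹ * ‖y - inner ℝ f y • f‖ ≤ R := by
        rw [inv_mul_le_iff₀ hθ]
        nlinarith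
      have h4 := abs_real_inner_le_norm f y
      rw [hf, one_mul] at h4
      rw [Real.norm_eq_abs]
      linarith
    · have h5 : inner ℝ f (θ⁻¹ • (y - inner ℝ f y • f) + inner ℝ f y • f) = inner ℝ f y := by
        simp only [inner_add_right, real_inner_smul_right, inner_sub_right,
          real_inner_self_eq_norm_sq, hf]
        ring
      rw [ContinuousLinearMap.coe_coe, stretch_apply, h5, smul_add, smul_smul,
        mul_inv_cancel₀ hθ.ne']
      module
  refine (measure_mono hsub).trans ?_
  rw [Measure.addHaar_image_linearMap, det_stretch hθ.ne' hf, finrank_euclideanSpace_fin]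
  gcongr
  obtain ⟨m, rfl⟩ : ∃ m, d = m + 2 := ⟨d - 2, by omega⟩
  rw [abs_of_pos (by positivity)]
  have : θ ^ (m + 2) * (1 / θ) = θ ^ m * θ := by
    field_simp
    ring
  rw [this]
  have : θ ^ m ≤ 1 := pow_le_one₀ hθ.le hθ1
  nlinarith

/-- Cells of side `δ s` near a cone are counted by volume: those meeting the shell
`1 - s² ≤ ρ ≤ 1` fill out a part of the `O(s)`-neighbourhood of the shell. -/
theorem exists_card_cone_le (hρ : IsHomogeneousDistance ρ b) (hd : 1 ≤ d) (S : ShellModel ρ)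
    {δ : ℝ} (hδ : 0 < δ) (hδS : 2 * d * δ ≤ S.inner / 2) : ∃ C : ℝ, 0 < C ∧
    ∀ (s : ℝ) (I : Finset (Fin d → ℤ)) (ξ : (Fin d → ℤ) → EuclideanSpace ℝ (Fin d))
      (Γ : Set (EuclideanSpace ℝ (Fin d))), 0 < s → s ≤ 1 → MeasurableSet Γ →
    (∀ t : ℝ, 0 < t → ∀ x, x ∈ Γ → t • x ∈ Γ) →
    (∀ k ∈ I, 1 / 2 ≤ ρ (ξ k) ∧ ρ (ξ k) ≤ 1 ∧ 1 - s ^ 2 ≤ ρ (ξ k) ∧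
      ∀ i, |ξ k i - δ * s * k i| ≤ δ * s) →
    (∀ k ∈ I, ∀ y, ‖y - ξ k‖ ≤ 2 * d * δ * s → S.inner / 2 ≤ ‖y‖ → y ∈ Γ) →
    (I.card : ℝ≥0∞) * ENNReal.ofReal s ^ (d - 1) ≤
      ENNReal.ofReal C * volume (Γ ∩ {ξ | ρ ξ < 1}) := by
  obtain ⟨B, hB⟩ := S.bound 1
  have hB0 : 0 ≤ B := (norm_nonneg _).trans (hB 0 (by omega) 0)
  set U : ℝ := 2 + B * (2 * d * δ) with hU
  have hU0 : 0 < U := by positivity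
  obtain ⟨C, hC, hvol⟩ := hρ.exists_volume_shell_le hd U
  refine ⟨C * U * (δ ^ d)⁻¹, by positivity, ?_⟩
  intro s I ξ Γ hs hs1 hΓm hΓ hI hIΓ
  have hsδ : 0 < δ * s := by positivity
  -- the cells lie in the shell `|ρ - 1| ≤ U s`, because `ρ` is Lipschitz near the unit shell
  have hcube : ∀ k ∈ I, latticeCube (δ * s) k ⊆
      Γ ∩ {ξ | 1 - U * s ≤ ρ ξ ∧ ρ ξ < 1 + U * s} := by
    intro k hk y hy
    obtain ⟨h1, h2, h3, h4⟩ := hI k hk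
    have hyξ : ‖y - ξ k‖ ≤ 2 * d * δ * s := by
      have := EuclideanSpace.norm_le_of_forall_abs_le (x := y - ξ k) (c := 2 * (δ * s))
        (by positivity) (fun i => by
          have h5 := hy i
          have h6 := abs_le.1 (h4 i)
          simp only [Set.mem_Ico] at h5
          rw [PiLp.sub_apply, abs_le]
          constructor <;> linarith)
      linarith
    have hle : 2 * d * δ * s ≤ S.inner / 2 := by
      have : 2 * d * δ * s ≤ 2 * d * δ * 1 := by gcongr
      linarith
    have n1 := S.inner_le _ h1
    have n2 := S.le_outer _ h2
    have ho : S.inner ≤ S.outer := n1.trans n2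
    have n3 : S.inner / 2 ≤ ‖y‖ := by
      have := norm_sub_norm_le (ξ k) y
      rw [norm_sub_rev] at this
      linarith
    have n4 : ‖y‖ ≤ 2 * S.outer := by
      have := norm_sub_norm_le y (ξ k)
      linarith [S.inner_pos]
    have hLip : |ρ y - ρ (ξ k)| ≤ B * (2 * d * δ * s) := by
      rw [← S.eq y n3 n4, ← S.eq (ξ k) (by linarith [S.inner_pos]) (by linarith [S.outer_pos]),
        ← Real.norm_eq_abs]
      refine (Convex.norm_image_sub_le_of_norm_fderiv_le (𝕜 := ℝ) (f := S.model) (s := Set.univ)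
        (C := B) (fun z _ => S.smooth.differentiable (by simp) z) (fun z _ => ?_) convex_univ
        (Set.mem_univ _) (Set.mem_univ _)).trans (by gcongr)
      rw [← norm_iteratedFDeriv_one]
      exact hB 1 le_rfl z
    have h7 := abs_le.1 hLip
    have h8 : s ^ 2 ≤ s := by nlinarith
    refine ⟨hIΓ k hk y hyξ n3, ?_, ?_⟩
    · rw [hU]; nlinarith
    · rw [hU]; nlinarith
  have h1 := (card_mul_le_volume hsδ I hcube).trans
    (hvol (U * s) Γ (by positivity) (by nlinarith) hΓm hΓ)
  obtain ⟨m, rfl⟩ : ∃ m, d = m + 1 := ⟨d - 1, by omega⟩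
  rw [Nat.add_sub_cancel]
  have hs' : ENNReal.ofReal s ≠ 0 := by simpa using hs
  have hd0 : ENNReal.ofReal δ ^ (m + 1) ≠ 0 := pow_ne_zero _ (by simpa using hδ)
  have e1 : ENNReal.ofReal (C * (U * s)) = ENNReal.ofReal (C * U) * ENNReal.ofReal s := by
    rw [← mul_assoc, ENNReal.ofReal_mul (by positivity)]
  have e2 : ENNReal.ofReal (C * U * (δ ^ (m + 1))⁻¹) =
      ENNReal.ofReal (C * U) * (ENNReal.ofReal δ ^ (m + 1))⁻¹ := by
    rw [ENNReal.ofReal_mul (by positivity), ENNReal.ofReal_inv_of_pos (by positivity),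
      ENNReal.ofReal_pow hδ.le]
  rw [e1, ENNReal.ofReal_mul hδ.le, mul_pow, pow_succ (ENNReal.ofReal s)] at h1
  rw [e2]
  rw [← ENNReal.mul_le_mul_iff_left (c := ENNReal.ofReal s * ENNReal.ofReal δ ^ (m + 1))
    (mul_ne_zero hs' hd0) (by finiteness)]
  calc _ = (I.card : ℝ≥0∞) *
        (ENNReal.ofReal δ ^ (m + 1) * (ENNReal.ofReal s ^ m * ENNReal.ofReal s)) := by ring
    _ ≤ _ := h1
    _ = ENNReal.ofReal (C * U) * ENNReal.ofReal s * volume (Γ ∩ {ξ | ρ ξ < 1}) *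
          ((ENNReal.ofReal δ ^ (m + 1))⁻¹ * ENNReal.ofReal δ ^ (m + 1)) := by
        rw [ENNReal.inv_mul_cancel hd0 (by finiteness), mul_one]
    _ = _ := by ring

/-- There are `O(s ^ (1 - d))` cells of side `δ s` that meet the shell `1 - s ^ 2 ≤ ρ ≤ 1`, and only
the fraction `θ` of them lies within distance `θ` of a given line. -/
theorem exists_card_cap_le (hρ : IsHomogeneousDistance ρ b) (hd : 1 ≤ d) (S : ShellModel ρ)
    {δ : ℝ} (hδ : 0 < δ) (hδS : 2 * d * δ ≤ S.inner / 2) : ∃ C : ℝ, 0 < C ∧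
    ∀ (s : ℝ) (I : Finset (Fin d → ℤ)) (ξ : (Fin d → ℤ) → EuclideanSpace ℝ (Fin d)),
    0 < s → s ≤ 1 →
    (∀ k ∈ I, 1 / 2 ≤ ρ (ξ k) ∧ ρ (ξ k) ≤ 1 ∧ 1 - s ^ 2 ≤ ρ (ξ k) ∧
      ∀ i, |ξ k i - δ * s * k i| ≤ δ * s) →
    (I.card : ℝ) ≤ C * (s ^ (d - 1))⁻¹ ∧
    (2 ≤ d → ∀ (f : EuclideanSpace ℝ (Fin d)) (θ : ℝ), ‖f‖ = 1 → s ≤ θ →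
      (∀ k ∈ I, ‖ξ k - inner ℝ f (ξ k) • f‖ ≤ θ) →
      (I.card : ℝ) ≤ C * (s ^ (d - 1))⁻¹ * θ) := by
  obtain ⟨C, hC, h⟩ := exists_card_cone_le hρ hd S hδ hδS
  set R := S.outer
  set v : ℝ := volume.real (Metric.closedBall (0 : EuclideanSpace ℝ (Fin d)) (2 * R)) with hv
  have hvE : volume (Metric.closedBall (0 : EuclideanSpace ℝ (Fin d)) (2 * R)) =
      ENNReal.ofReal v := by
    rw [hv, Measure.real, ENNReal.ofReal_toReal measure_closedBall_lt_top.ne]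
  have hv0 : 0 ≤ v := measureReal_nonneg
  have hR := S.outer_pos
  have hr := S.inner_pos
  set κ : ℝ := (1 + 2 * d * δ) * (2 / S.inner) with hκ
  have hκ0 : 0 < κ := by positivity
  refine ⟨C * (v + 1) * (1 + κ), by positivity, ?_⟩
  intro s I ξ hs hs1 hI
  have conv : ∀ Γ : Set (EuclideanSpace ℝ (Fin d)), ∀ w : ℝ, 0 ≤ w →
      volume (Γ ∩ {ξ | ρ ξ < 1}) ≤ ENNReal.ofReal w →
      (I.card : ℝ≥0∞) * ENNReal.ofReal s ^ (d - 1) ≤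
        ENNReal.ofReal C * volume (Γ ∩ {ξ | ρ ξ < 1}) →
      (I.card : ℝ) ≤ C * w * (s ^ (d - 1))⁻¹ := by
    intro Γ w hw h1 h2
    have h3 : (I.card : ℝ≥0∞) * ENNReal.ofReal s ^ (d - 1) ≤
        ENNReal.ofReal C * ENNReal.ofReal w := h2.trans (by gcongr)
    rw [← ENNReal.ofReal_mul hC.le, ← ENNReal.ofReal_pow hs.le, ← ENNReal.ofReal_natCast,
      ← ENNReal.ofReal_mul (by positivity), ENNReal.ofReal_le_ofReal_iff (by positivity)] at h3
    rw [← div_eq_mul_inv, le_div_iff₀ (by positivity)]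
    exact h3
  have hsubR : {ξ | ρ ξ < 1} ⊆ Metric.closedBall 0 R := fun x hx => by
    simpa using S.le_outer x (le_of_lt hx)
  refine ⟨?_, ?_⟩
  · have := conv Set.univ v hv0 ?_ (h s I ξ Set.univ hs hs1 MeasurableSet.univ
      (fun _ _ _ _ => Set.mem_univ _) hI (fun _ _ _ _ _ => Set.mem_univ _))
    · refine this.trans ?_
      rw [mul_assoc C (v + 1)]
      gcongr
      nlinarith
    · rw [← hvE]
      apply measure_mono
      refine Set.inter_subset_right.trans (hsubR.trans ?_)
      exact Metric.closedBall_subset_closedBall (by linarith)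
  · intro hd2 f θ hf hsθ hcone
    have hθ : 0 < θ := hs.trans_le hsθ
    -- a point within distance `O(s)` of a center near the line lies in the cone around the line
    have := conv (lineCone f (κ * θ)) (κ * θ * v) (by positivity) ?_
      (h s I ξ (lineCone f (κ * θ)) hs hs1 (measurableSet_lineCone _ _)
        smul_mem_lineCone hI ?_)
    · calc (I.card : ℝ) ≤ C * (κ * θ * v) * (s ^ (d - 1))⁻¹ := this
        _ = C * (v * κ) * (s ^ (d - 1))⁻¹ * θ := by ring
        _ ≤ C * ((v + 1) * (1 + κ)) * (s ^ (d - 1))⁻¹ * θ := by gcongr <;> linarith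
        _ = _ := by ring
    · refine (measure_mono (Set.inter_subset_inter_right _ hsubR)).trans ?_
      refine (volume_lineCone_inter_closedBall_le hd2 hR (by positivity) hf).trans ?_
      rw [hvE, ← ENNReal.ofReal_mul (by positivity)]
    · intro k hk y hy hyr
      have h1 := hcone k hk
      have h2 : ‖(y - ξ k) - inner ℝ f (y - ξ k) • f‖ ≤ ‖y - ξ k‖ := by
        apply le_of_sq_le_sq _ (norm_nonneg _)
        rw [norm_sub_inner_smul_sq hf]
        nlinarith [sq_nonneg (inner ℝ f (y - ξ k))]
      have h3 : y - inner ℝ f y • f =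
          ((y - ξ k) - inner ℝ f (y - ξ k) • f) + (ξ k - inner ℝ f (ξ k) • f) := by
        rw [inner_sub_right]
        module
      simp only [lineCone, Set.mem_ofPred_eq]
      rw [h3]
      refine (norm_add_le _ _).trans ?_
      have h4 : 2 * d * δ * s ≤ 2 * d * δ * θ := by gcongr
      have h5 : (1 + 2 * d * δ) * θ ≤ κ * θ * ‖y‖ := by
        have : 1 ≤ 2 / S.inner * ‖y‖ := by
          rw [div_mul_eq_mul_div, le_div_iff₀ hr]
          linarith
        calc (1 + 2 * d * δ) * θ = (1 + 2 * d * δ) * θ * 1 := by ring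
          _ ≤ (1 + 2 * d * δ) * θ * (2 / S.inner * ‖y‖) := by gcongr
          _ = κ * θ * ‖y‖ := by rw [hκ]; ring
      linarith

end Counting

/-! ### A smooth partition of unity over a lattice -/

section LatticePartition

open scoped ContDiff

variable {d : ℕ}

/-- A smooth function supported in `[-1, 1]` whose integer translates sum to one. -/
noncomputable def stepBump (x : ℝ) : ℝ := Real.smoothTransition (x + 1) - Real.smoothTransition x

theorem contDiff_stepBump : ContDiff ℝ ∞ stepBump :=
  (Real.smoothTransition.contDiff.comp (contDiff_id.add contDiff_const)).sub
    Real.smoothTransition.contDiff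

theorem abs_le_one_of_stepBump_ne_zero {x : ℝ} (h : stepBump x ≠ 0) : |x| ≤ 1 := by
  by_contra hx
  apply h
  rw [stepBump]
  rcases lt_abs.1 (not_le.1 hx) with h1 | h1
  · rw [Real.smoothTransition.one_of_one_le (by linarith),
      Real.smoothTransition.one_of_one_le h1.le, sub_self]
  · rw [Real.smoothTransition.zero_of_nonpos (by linarith),
      Real.smoothTransition.zero_of_nonpos (by linarith), sub_self]

theorem sum_stepBump (n : ℕ) {x : ℝ} (hx : |x| ≤ n) :
    ∑ k ∈ Finset.Icc (-((n + 1 : ℕ) : ℤ)) ((n + 1 : ℕ) : ℤ), stepBump (x - k) = 1 := by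
  have e : ∑ k ∈ Finset.Icc (-((n + 1 : ℕ) : ℤ)) ((n + 1 : ℕ) : ℤ), stepBump (x - k) =
      ∑ i ∈ Finset.range (2 * (n + 1) + 1), stepBump (x - (((i : ℤ) - (n + 1 : ℕ) : ℤ) : ℝ)) := by
    symm
    apply Finset.sum_bij' (fun (i : ℕ) _ => (i : ℤ) - (n + 1 : ℕ))
      (fun (k : ℤ) _ => (k + (n + 1 : ℕ)).toNat)
    · intro i hi
      simp only [Finset.mem_range, Finset.mem_Icc] at *
      omega
    · intro k hk
      simp only [Finset.mem_range, Finset.mem_Icc] at *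
      omega
    · intro i hi
      simp only [Finset.mem_range] at *
      omega
    · intro k hk
      simp only [Finset.mem_Icc] at *
      omega
    · intro i hi
      rfl
  rw [e]
  have h2 : ∀ i : ℕ, stepBump (x - (((i : ℤ) - (n + 1 : ℕ) : ℤ) : ℝ)) =
      Real.smoothTransition (x - i + n + 2) - Real.smoothTransition (x - (i + 1 : ℕ) + n + 2) := by
    intro i
    rw [stepBump]
    congr 2 <;> push_cast <;> ring
  simp only [h2]
  rw [Finset.sum_range_sub' (fun i : ℕ => Real.smoothTransition (x - i + n + 2))]
  have := abs_le.1 hx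
  rw [Real.smoothTransition.one_of_one_le (by push_cast; linarith),
    Real.smoothTransition.zero_of_nonpos (by push_cast; linarith), sub_zero]

/-- The point of the integer lattice with coordinates `k`. -/
def latticePoint (k : Fin d → ℤ) : EuclideanSpace ℝ (Fin d) := WithLp.toLp 2 fun i => (k i : ℝ)

theorem latticePoint_apply (k : Fin d → ℤ) (i : Fin d) : latticePoint k i = k i := rfl

/-- A smooth function supported in the cube `[-1, 1]ᵈ` whose lattice translates sum to one. -/
noncomputable def latticeBump (x : EuclideanSpace ℝ (Fin d)) : ℂ := ∏ i, (stepBump (x i) : ℂ)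

theorem contDiff_latticeBump : ContDiff ℝ ∞ (latticeBump (d := d)) := by
  apply contDiff_prod
  intro i _
  exact Complex.ofRealCLM.contDiff.comp
    (contDiff_stepBump.comp (EuclideanSpace.proj (𝕜 := ℝ) i).contDiff)

theorem abs_le_one_of_latticeBump_ne_zero {x : EuclideanSpace ℝ (Fin d)} (h : latticeBump x ≠ 0)
    (i : Fin d) : |x i| ≤ 1 := by
  apply abs_le_one_of_stepBump_ne_zero
  have := Finset.prod_ne_zero_iff.1 h i (Finset.mem_univ i)
  exact_mod_cast this

theorem hasCompactSupport_latticeBump : HasCompactSupport (latticeBump (d := d)) := by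
  apply hasCompactSupport_of_norm_gt (R := d * 1)
  intro x hx
  by_contra h
  exact absurd (EuclideanSpace.norm_le_of_forall_abs_le zero_le_one
    (abs_le_one_of_latticeBump_ne_zero h)) (not_le.2 hx)

theorem sum_latticeBump (n : ℕ) {x : EuclideanSpace ℝ (Fin d)} (hx : ‖x‖ ≤ n) :
    ∑ k ∈ Fintype.piFinset fun _ : Fin d =>
      Finset.Icc (-((n + 1 : ℕ) : ℤ)) ((n + 1 : ℕ) : ℤ), latticeBump (x - latticePoint k) = 1 := by
  simp only [latticeBump, PiLp.sub_apply, latticePoint_apply]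
  rw [← Finset.prod_univ_sum (fun _ : Fin d => Finset.Icc (-((n + 1 : ℕ) : ℤ)) ((n + 1 : ℕ) : ℤ))
    (fun i (m : ℤ) => (stepBump (x i - m) : ℂ))]
  apply Finset.prod_eq_one
  intro i _
  have := sum_stepBump n ((EuclideanSpace.abs_apply_le_norm x i).trans hx)
  exact_mod_cast congrArg (fun y : ℝ => (y : ℂ)) this

end LatticePartition

/-! ### Decomposition of the symbol into caps -/

section CapDecomposition

open scoped ContDiff

/-- The `L¹`-normalized function `|det A| (1 + ‖A x‖)^{-N}`, concentrated on the box
`{x | ‖A x‖ ≤ 1}`. -/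
noncomputable def boxKernel {V : Type*} [NormedAddCommGroup V] [NormedSpace ℝ V] (A : V →L[ℝ] V)
    (N : ℕ) (x : V) : ℝ :=
  |LinearMap.det (A : V →ₗ[ℝ] V)| * ((1 + ‖A x‖) ^ N)⁻¹

theorem stretch_mul_left {V : Type*} [NormedAddCommGroup V] [InnerProductSpace ℝ V] (t α β : ℝ)
    (n x : V) : stretch (t * α) (t * β) n x = t • stretch α β n x := by
  simp only [stretch_apply]
  module

variable {d : ℕ} {ρ : EuclideanSpace ℝ (Fin d) → ℝ} {b : ℝ}

/-- The tangential width `2 ^ (-j / 2)` of the caps into which the shell of thickness `2 ^ (-j)`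
is cut. -/
noncomputable def capWidth (j : ℕ) : ℝ := (2 : ℝ) ^ (-(j : ℝ) / 2)

theorem capWidth_pos (j : ℕ) : 0 < capWidth j := Real.rpow_pos_of_pos two_pos _

theorem capWidth_le_one (j : ℕ) : capWidth j ≤ 1 := by
  apply Real.rpow_le_one_of_one_le_of_nonpos one_le_two
  have : (0 : ℝ) ≤ j := Nat.cast_nonneg j
  linarith

theorem capWidth_sq (j : ℕ) : capWidth j ^ 2 = (2 : ℝ) ^ (-(j : ℝ)) := by
  rw [capWidth, ← Real.rpow_natCast, ← Real.rpow_mul two_pos.le]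
  congr 1
  push_cast
  ring

theorem capWidth_sq_inv (j : ℕ) : (capWidth j ^ 2)⁻¹ = (2 : ℝ) ^ j := by
  rw [capWidth_sq, Real.rpow_neg two_pos.le, inv_inv, Real.rpow_natCast]

/-- A decomposition `φ ∘ ρ = ∑ m k` of the symbol into smooth pieces, the `k`-th of which lives on
the cap of radius `O(s)` around `center k`, where `s = 2^{-j/2}`. Its kernel, also after
multiplication of the symbol by a smooth function `u`, is bounded by the function adapted to the box
with sides `s⁻²` in the direction `normal k` and `s⁻¹` in the orthogonal directions. There are
`O(s^{1-d})` caps, and `card_cone_le` bounds the number of those that lie close to a given line.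
Outside `index` the functions `symbol`, `center` and `normal` carry no information. -/
structure CapDecomposition (ρ : EuclideanSpace ℝ (Fin d) → ℝ) (φ : ℝ → ℂ) (j N : ℕ)
    (r R K : ℝ) where
  index : Finset (Fin d → ℤ)
  symbol : (Fin d → ℤ) → EuclideanSpace ℝ (Fin d) → ℂ
  center : (Fin d → ℤ) → EuclideanSpace ℝ (Fin d)
  normal : (Fin d → ℤ) → EuclideanSpace ℝ (Fin d)
  norm_normal : ∀ k ∈ index, ‖normal k‖ = 1
  contDiff_symbol : ∀ k ∈ index, ContDiff ℝ ∞ (symbol k)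
  sum_symbol : ∀ ξ, φ (ρ ξ) = ∑ k ∈ index, symbol k ξ
  symbol_support : ∀ k ∈ index, ∀ ξ, symbol k ξ ≠ 0 →
    r ≤ ‖ξ‖ ∧ ‖ξ‖ ≤ R ∧ ‖ξ - center k‖ ≤ R * capWidth j
  center_mem : ∀ k ∈ index, r ≤ ‖center k‖ ∧ ‖center k‖ ≤ R
  kernel_le : ∀ k ∈ index, ∀ (u : EuclideanSpace ℝ (Fin d) → ℂ) (U : ℝ), ContDiff ℝ ∞ u →
    (∀ i ≤ N, ∀ η, ‖η‖ ≤ R → ‖iteratedFDeriv ℝ i u η‖ ≤ U) → ∀ t : ℝ, 0 < t → ∀ x,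
    ‖𝓕⁻ (fun ξ => symbol k (t⁻¹ • ξ) * u (t⁻¹ • ξ)) x‖ ≤
      K * U * boxKernel (stretch (t * capWidth j) (t * capWidth j ^ 2) (normal k)) N x
  card_le : (index.card : ℝ) ≤ K * (capWidth j ^ (d - 1))⁻¹
  card_cone_le : 2 ≤ d → ∀ (f : EuclideanSpace ℝ (Fin d)) (θ : ℝ), ‖f‖ = 1 → capWidth j ≤ θ →
    ∀ J ⊆ index, (∀ k ∈ J, ‖center k - inner ℝ f (center k) • f‖ ≤ θ) →
    (J.card : ℝ) ≤ K * (capWidth j ^ (d - 1))⁻¹ * θ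

theorem IsLocalizer.mem_shell {C : ℕ → ℝ} {j : ℕ} (hj : 1 ≤ j) {φ : ℝ → ℂ} (hφ : IsLocalizer C j φ)
    {t : ℝ} (ht : φ t ≠ 0) : 1 / 2 ≤ t ∧ t ≤ 1 ∧ 1 - capWidth j ^ 2 ≤ t := by
  have h := hφ.support_subset ht
  rw [capWidth_sq]
  have h1 : (2 : ℝ) ^ (-(j : ℝ)) ≤ 1 / 2 := by
    have : (2 : ℝ) ^ (-(j : ℝ)) ≤ 2 ^ (-(1 : ℝ)) := by
      apply Real.rpow_le_rpow_of_exponent_le one_le_two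
      have : (1 : ℝ) ≤ j := by exact_mod_cast hj
      linarith
    rw [Real.rpow_neg_one] at this
    linarith
  have h2 : 0 < (2 : ℝ) ^ (-(j : ℝ) - 2) := by positivity
  exact ⟨by linarith [h.1], by linarith [h.2], h.1⟩

open Classical in
/-- The symbol is cut by a partition of unity over a lattice of mesh `O(s)`, `s = 2^{-j/2}`. On a
cell of this size the shell of thickness `s² = 2^{-j}` is flat up to an error comparable with its
thickness. The constants `r`, `R`, `K` do not depend on `j` and `φ`. -/
theorem exists_capDecomposition (hρ : IsHomogeneousDistance ρ b) (hd : 1 ≤ d) (C : ℕ → ℝ) (N : ℕ) :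
    ∃ r R K : ℝ, 0 < r ∧ 0 < R ∧ 0 < K ∧ ∀ (j : ℕ), 1 ≤ j → ∀ φ : ℝ → ℂ, IsLocalizer C j φ →
      Nonempty (CapDecomposition ρ φ j N r R K) := by
  obtain ⟨S⟩ := hρ.nonempty_shellModel hd
  have hd0 : (0 : ℝ) < d := by exact_mod_cast hd
  have hin := S.inner_pos
  have hout := S.outer_pos
  -- the mesh is so small that cells meeting the shell stay in the region where `ρ` is smooth
  set δ : ℝ := S.inner / (4 * d) with hδ
  have hδ0 : 0 < δ := by positivity
  have hδS : 2 * d * δ ≤ S.inner / 2 := by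
    rw [hδ]
    apply le_of_eq
    field_simp
    ring
  obtain ⟨B, hB⟩ := S.bound (N + 2)
  obtain ⟨P, -, hP⟩ := exists_forall_norm_iteratedFDeriv_le (contDiff_latticeBump (d := d))
    hasCompactSupport_latticeBump N
  obtain ⟨R₁, K₁, hR₁, hK₁, hcap⟩ := exists_cap_symbol_bound (V := EuclideanSpace ℝ (Fin d)) N
    (B := B) (r := 2 * d * δ) (Cφ := ∑ i ∈ Finset.range (N + 1), |C i|) (P := P) S.slope_pos hδ0
  obtain ⟨C₂, hC₂, hbox⟩ := exists_norm_fourierInv_box_le (V := EuclideanSpace ℝ (Fin d)) N R₁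
  obtain ⟨C₃, hC₃, hcard⟩ := exists_card_cap_le hρ hd S hδ0 hδS
  set R : ℝ := 2 * S.outer + R₁ + 2 * d * δ with hR
  refine ⟨S.inner / 2, R, C₂ * K₁ + C₃, by positivity, by positivity, by positivity, ?_⟩
  intro j hj φ hφ
  set s := capWidth j with hs
  have hs0 : 0 < s := capWidth_pos j
  have hs1 : s ≤ 1 := capWidth_le_one j
  have hδs : 0 < δ * s := by positivity
  obtain ⟨m, hm⟩ := exists_nat_ge ((δ * s)⁻¹ * S.outer)
  let box := Fintype.piFinset fun _ : Fin d =>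
      Finset.Icc (-((m + 1 : ℕ) : ℤ)) ((m + 1 : ℕ) : ℤ)
  -- a cell takes part if its cube contains a point where the symbol does not vanish, which then
  -- serves as its center
  let act : (Fin d → ℤ) → Prop := fun k => ∃ ξ : EuclideanSpace ℝ (Fin d), φ (ρ ξ) ≠ 0 ∧
    ∀ i, |ξ i - δ * s * k i| ≤ δ * s
  let index := box.filter act
  let center : (Fin d → ℤ) → EuclideanSpace ℝ (Fin d) := fun k =>
    if h : act k then h.choose else 0
  have hcenter : ∀ k ∈ index, φ (ρ (center k)) ≠ 0 ∧
      ∀ i, |center k i - δ * s * k i| ≤ δ * s := by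
    intro k hk
    have hk' : act k := (Finset.mem_filter.1 hk).2
    simp only [center, dif_pos hk']
    exact hk'.choose_spec
  have hshell : ∀ k ∈ index, 1 / 2 ≤ ρ (center k) ∧ ρ (center k) ≤ 1 ∧
      1 - s ^ 2 ≤ ρ (center k) := fun k hk => hφ.mem_shell hj (hcenter k hk).1
  have hgrad : ∀ k, ∃ (n : EuclideanSpace ℝ (Fin d)) (γ : ℝ), k ∈ index →
      ‖n‖ = 1 ∧ S.slope ≤ γ ∧ ∀ v, fderiv ℝ S.model (center k) v = γ * inner ℝ n v := by
    intro k
    by_cases hk : k ∈ index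
    · obtain ⟨n, γ, h⟩ := S.gradient _ (hshell k hk).1 (hshell k hk).2.1
      exact ⟨n, γ, fun _ => h⟩
    · exact ⟨0, 0, fun h => absurd h hk⟩
  choose n γ hnγ using hgrad
  let ψ : (Fin d → ℤ) → EuclideanSpace ℝ (Fin d) → ℂ := fun k ξ =>
    latticeBump ((δ * s)⁻¹ • ξ - latticePoint k)
  have hψ : ∀ k ξ, ψ k ξ ≠ 0 → ∀ i, |ξ i - δ * s * k i| ≤ δ * s := by
    intro k ξ h i
    have := abs_le_one_of_latticeBump_ne_zero h i
    rw [PiLp.sub_apply, PiLp.smul_apply, latticePoint_apply, smul_eq_mul] at this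
    have e : ξ i - δ * s * k i = (δ * s) * ((δ * s)⁻¹ * ξ i - k i) := by
      rw [mul_sub, mul_inv_cancel_left₀ hδs.ne']
    rw [e, abs_mul, abs_of_pos hδs]
    nlinarith
  have hψc : ∀ k ∈ index, ∀ ξ, ψ k ξ ≠ 0 → ‖ξ - center k‖ ≤ 2 * d * δ * s := by
    intro k hk ξ h
    have h1 := hψ k ξ h
    have h2 := (hcenter k hk).2
    have := EuclideanSpace.norm_le_of_forall_abs_le (x := ξ - center k) (c := 2 * (δ * s))
      (by positivity) (fun i => by
        have h3 := abs_le.1 (h1 i)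
        have h4 := abs_le.1 (h2 i)
        rw [PiLp.sub_apply, abs_le]
        constructor <;> linarith)
    linarith
  have hδs2 : 2 * d * δ * s ≤ S.inner / 2 := by
    have : 2 * d * δ * s ≤ 2 * d * δ * 1 := by gcongr
    linarith
  have hnorm : ∀ k ∈ index, S.inner ≤ ‖center k‖ ∧ ‖center k‖ ≤ S.outer := fun k hk =>
    ⟨S.inner_le _ (hshell k hk).1, S.le_outer _ (hshell k hk).2.1⟩
  have hnormξ : ∀ k ∈ index, ∀ ξ, ψ k ξ ≠ 0 → S.inner / 2 ≤ ‖ξ‖ ∧ ‖ξ‖ ≤ 2 * S.outer := by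
    intro k hk ξ h
    have h1 := hψc k hk ξ h
    have h2 := hnorm k hk
    constructor
    · have := norm_sub_norm_le (center k) ξ
      rw [norm_sub_rev] at this
      linarith
    · have := norm_sub_norm_le ξ (center k)
      linarith
  -- on the support of the cutoffs `ρ` may be replaced by a function smooth on the whole space
  have hmodel : ∀ k ∈ index, ∀ ξ, φ (ρ ξ) * ψ k ξ = φ (S.model ξ) * ψ k ξ := by
    intro k hk ξ
    by_cases h : ψ k ξ = 0
    · rw [h, mul_zero, mul_zero]
    · rw [S.eq ξ (hnormξ k hk ξ h).1 (hnormξ k hk ξ h).2]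
  have hψs : ∀ k, ContDiff ℝ ∞ (ψ k) := fun k =>
    contDiff_latticeBump.comp ((contDiff_id.const_smul _).sub contDiff_const)
  have hsmooth : ∀ k ∈ index, ContDiff ℝ ∞ (fun ξ => φ (ρ ξ) * ψ k ξ) := by
    intro k hk
    rw [funext (hmodel k hk)]
    exact (hφ.smooth.comp S.smooth).mul (hψs k)
  refine ⟨⟨index, fun k ξ => φ (ρ ξ) * ψ k ξ, center, n, fun k hk => (hnγ k hk).1, hsmooth,
    ?_, ?_, ?_, ?_, ?_, ?_⟩⟩
  · intro ξ
    by_cases h : φ (ρ ξ) = 0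
    · simp [h]
    have h1 := S.le_outer ξ (hφ.mem_shell hj h).2.1
    have h2 : ‖(δ * s)⁻¹ • ξ‖ ≤ m := by
      rw [norm_smul, Real.norm_eq_abs, abs_of_pos (by positivity)]
      refine le_trans ?_ hm
      gcongr
    have h3 : ∑ k ∈ index, ψ k ξ = 1 := by
      rw [← sum_latticeBump m h2]
      apply Finset.sum_subset (Finset.filter_subset _ _)
      intro k hk hk'
      by_contra h0
      exact hk' (Finset.mem_filter.2 ⟨hk, ξ, h, hψ k ξ h0⟩)
    rw [← Finset.mul_sum, h3, mul_one]
  · intro k hk ξ h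
    have h1 : ψ k ξ ≠ 0 := right_ne_zero_of_mul h
    refine ⟨(hnormξ k hk ξ h1).1, ?_, ?_⟩
    · have := (hnormξ k hk ξ h1).2
      have : 0 < 2 * d * δ := by positivity
      linarith
    · refine (hψc k hk ξ h1).trans ?_
      gcongr
      linarith
  · intro k hk
    have := hnorm k hk
    have : 0 < 2 * d * δ := by positivity
    constructor <;> linarith
  · intro k hk u U hu hU t ht x
    obtain ⟨hn1, hγ, hfd⟩ := hnγ k hk
    have hcapk := hcap S.model φ latticeBump u (center k) (n k) (latticePoint k) s (γ k) U
      S.smooth hφ.smooth contDiff_latticeBump hu hs0 hs1 hn1 hfd hγ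
      (fun i _ hi x => hB i hi x) ?_ ?_ hP (hψc k hk) ?_
    · obtain ⟨hz, hb⟩ := hcapk
      have hdet : LinearMap.det (stretch (t * s) (t * s ^ 2) (n k) :
          EuclideanSpace ℝ (Fin d) →ₗ[ℝ] EuclideanSpace ℝ (Fin d)) ≠ 0 :=
        det_stretch_ne_zero hn1 (by positivity) (by positivity)
      have hsym := stretch_isSymmetric (t * s) (t * s ^ 2) (n k)
      have hms : ContDiff ℝ ∞ (fun ξ : EuclideanSpace ℝ (Fin d) =>
          φ (ρ (t⁻¹ • ξ)) * ψ k (t⁻¹ • ξ) * u (t⁻¹ • ξ)) := by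
        have h1 : ContDiff ℝ ∞ (fun ξ : EuclideanSpace ℝ (Fin d) => t⁻¹ • ξ) :=
          contDiff_id.const_smul _
        exact ((hsmooth k hk).comp h1).mul (hu.comp h1)
      have e : ∀ ζ, t⁻¹ • (t • center k + stretch (t * s) (t * s ^ 2) (n k) ζ) =
          center k + stretch s (s ^ 2) (n k) ζ := by
        intro ζ
        rw [stretch_mul_left, ← smul_add, smul_smul, inv_mul_cancel₀ ht.ne', one_smul]
      have e2 : (fun ζ => φ (ρ (t⁻¹ • (t • center k + stretch (t * s) (t * s ^ 2) (n k) ζ))) *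
          ψ k (t⁻¹ • (t • center k + stretch (t * s) (t * s ^ 2) (n k) ζ)) *
          u (t⁻¹ • (t • center k + stretch (t * s) (t * s ^ 2) (n k) ζ))) =
          fun ζ => φ (S.model (center k + stretch s (s ^ 2) (n k) ζ)) *
          latticeBump ((δ * s)⁻¹ • (center k + stretch s (s ^ 2) (n k) ζ) - latticePoint k) *
          u (center k + stretch s (s ^ 2) (n k) ζ) := by
        funext ζ
        rw [e, hmodel k hk]
      have hU0 : 0 ≤ U := (norm_nonneg _).trans (hU 0 (Nat.zero_le _) 0 (by
        rw [norm_zero]; positivity))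
      have key := hbox (stretch (t * s) (t * s ^ 2) (n k)) (t • center k) _ (K₁ * U) hdet hsym hms
        (fun ζ hζ => by
          have := congrFun e2 ζ
          simp only [ContinuousLinearMap.coe_coe] at this ⊢
          rw [this]
          exact hz ζ hζ)
        (fun i hi ζ => by
          simp only [ContinuousLinearMap.coe_coe]
          rw [e2]
          exact hb i hi ζ) x
      refine key.trans ?_
      rw [boxKernel, ContinuousLinearMap.coe_coe, ← mul_assoc C₂]
      gcongr
      linarith
    · intro i hi t
      refine (hφ.deriv_bound i t).trans ?_
      rw [hs, capWidth_sq_inv, ← pow_mul]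
      gcongr
      exact (le_abs_self _).trans (Finset.single_le_sum (f := fun i => |C i|)
        (fun i _ => abs_nonneg _) (by simp; omega))
    · intro t ht
      have h1 := hφ.support_subset ht
      have h2 := hφ.support_subset (hcenter k hk).1
      have h3 := hshell k hk
      have h4 := S.eq (center k) (by linarith [(hnorm k hk).1]) (by linarith [(hnorm k hk).2])
      have h5 := hφ.mem_shell hj ht
      rw [h4, abs_le]
      constructor <;> linarith
    · intro i hi η hη
      apply hU i hi η
      have h1 := norm_sub_norm_le η (center k)
      have h2 := (hnorm k hk).2
      have : 0 < 2 * d * δ := by positivity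
      linarith
  · refine (hcard s index center hs0 hs1 (fun k hk => ⟨(hshell k hk).1, (hshell k hk).2.1,
      (hshell k hk).2.2, (hcenter k hk).2⟩)).1.trans ?_
    gcongr
    have := mul_pos hC₂ hK₁
    linarith
  · intro hd2 f θ hf hsθ J hJ hJθ
    have hθ : 0 < θ := hs0.trans_le hsθ
    refine ((hcard s J center hs0 hs1 (fun k hk => ⟨(hshell k (hJ hk)).1, (hshell k (hJ hk)).2.1,
      (hshell k (hJ hk)).2.2, (hcenter k (hJ hk)).2⟩)).2 hd2 f θ hf hsθ hJθ).trans ?_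
    gcongr
    have := mul_pos hC₂ hK₁
    linarith

end CapDecomposition

/-! ### Box kernels -/

section BoxKernels

variable {V : Type*} [NormedAddCommGroup V] [InnerProductSpace ℝ V]

theorem boxKernel_nonneg (A : V →L[ℝ] V) (N : ℕ) (x : V) : 0 ≤ boxKernel A N x := by
  unfold boxKernel
  positivity

theorem continuous_boxKernel (A : V →L[ℝ] V) (N : ℕ) : Continuous (boxKernel A N) := by
  unfold boxKernel
  refine continuous_const.mul (Continuous.inv₀ (by fun_prop) fun x => ?_)
  positivity

/-- Part of the decay of a box kernel may be spent on an isotropic weight. -/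
theorem boxKernel_mul_weight_le {A : V →L[ℝ] V} {μ : ℝ} (hμ : 0 ≤ μ)
    (hA : ∀ x, μ * ‖x‖ ≤ ‖A x‖) (N n : ℕ) (x : V) :
    boxKernel A (N + n) x * (1 + μ * ‖x‖) ^ n ≤ boxKernel A N x := by
  unfold boxKernel
  rw [mul_assoc]
  gcongr
  rw [pow_add, mul_inv, mul_assoc]
  refine mul_le_of_le_one_right (by positivity) ?_
  rw [inv_mul_le_iff₀ (by positivity), mul_one]
  gcongr
  exact hA x

/-- Away from the unit ball a box kernel that concentrates at scale `μ⁻¹` is small. -/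
theorem boxKernel_succ_le {A : V →L[ℝ] V} {μ : ℝ} (hμ : 0 < μ)
    (hA : ∀ x, μ * ‖x‖ ≤ ‖A x‖) (N : ℕ) {x : V} (hx : 1 ≤ ‖x‖) :
    boxKernel A (N + 1) x ≤ μ⁻¹ * boxKernel A N x := by
  have h := boxKernel_mul_weight_le hμ.le hA N 1 x
  rw [pow_one] at h
  have h0 := boxKernel_nonneg A (N + 1) x
  rw [← div_eq_inv_mul, le_div_iff₀ hμ]
  refine le_trans ?_ h
  gcongr
  nlinarith

variable [FiniteDimensional ℝ V] [MeasurableSpace V] [BorelSpace V]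

/-- The integral of `(1 + ‖x‖) ^ (-N)`. -/
noncomputable def decayIntegral (V : Type*) [NormedAddCommGroup V] [InnerProductSpace ℝ V]
    [FiniteDimensional ℝ V] [MeasurableSpace V] [BorelSpace V] (N : ℕ) : ℝ≥0∞ :=
  ∫⁻ x : V, ENNReal.ofReal ((1 + ‖x‖) ^ N)⁻¹

theorem decayIntegral_lt_top {N : ℕ} (h : Module.finrank ℝ V < N) : decayIntegral V N < ⊤ := by
  have := finite_integral_one_add_norm (E := V) (μ := volume) (r := N) (by exact_mod_cast h)
  unfold decayIntegral
  convert this using 4 with x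
  rw [Real.rpow_neg (by positivity), Real.rpow_natCast]

theorem lintegral_boxKernel {A : V →L[ℝ] V} (hA : LinearMap.det (A : V →ₗ[ℝ] V) ≠ 0) (N : ℕ) :
    ∫⁻ x, ENNReal.ofReal (boxKernel A N x) = decayIntegral V N := by
  have h := lintegral_comp_linearMap (A : V →ₗ[ℝ] V) hA
    (fun x => ENNReal.ofReal ((1 + ‖x‖) ^ N)⁻¹)
  unfold boxKernel decayIntegral
  simp only [ENNReal.ofReal_mul (abs_nonneg _)]
  rw [lintegral_const_mul' _ _ ENNReal.ofReal_ne_top]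
  simp only [ContinuousLinearMap.coe_coe] at h
  rw [h, ← mul_assoc, ← ENNReal.ofReal_mul (abs_nonneg _), mul_inv_cancel₀ (by simpa using hA),
    ENNReal.ofReal_one, one_mul]

theorem lintegral_lintegral_conv {Φ : V → ℝ≥0∞} (hΦ : Measurable Φ) {g : V → ℝ≥0∞}
    (hg : AEMeasurable g) :
    ∫⁻ x, ∫⁻ y, Φ (x - y) * g y = (∫⁻ x, Φ x) * ∫⁻ y, g y := by
  rw [lintegral_lintegral_swap]
  · have : ∀ y, ∫⁻ x, Φ (x - y) * g y = (∫⁻ x, Φ x) * g y := by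
      intro y
      rw [lintegral_mul_const _ (by fun_prop), lintegral_sub_right_eq_self]
    simp only [this]
    rw [lintegral_const_mul'' _ hg]
  · exact (hΦ.comp (measurable_fst.sub measurable_snd)).aemeasurable.mul hg.comp_snd

theorem aemeasurable_conv {Φ : V → ℝ≥0∞} (hΦ : Measurable Φ) {g : V → ℝ≥0∞}
    (hg : AEMeasurable g) : AEMeasurable fun x => ∫⁻ y, Φ (x - y) * g y :=
  ((hΦ.comp (measurable_fst.sub measurable_snd)).aemeasurable.mul hg.comp_snd).lintegral_prod_right'

/-- Hölder's inequality against the weight `(1 + μ ‖x‖) ^ n` passes from an `L¹` bound to an `Lᵖ`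
bound, at the cost of the volume of the ball of radius `μ⁻¹`. -/
theorem lintegral_rpow_le_of_weight {G : V → ℝ≥0∞} (hG : AEMeasurable G) {μ p : ℝ} (hμ : 0 < μ)
    (hp0 : 0 < p) (hp1 : p ≤ 1) {n : ℕ} (hn : ((Module.finrank ℝ V : ℝ) + 1) * (1 - p) / p ≤ n) :
    ∫⁻ x, G x ^ p ≤ (∫⁻ x, G x * ENNReal.ofReal ((1 + μ * ‖x‖) ^ n)) ^ p *
      (ENNReal.ofReal (μ ^ Module.finrank ℝ V)⁻¹ *
        decayIntegral V (Module.finrank ℝ V + 1)) ^ (1 - p) := by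
  set D := Module.finrank ℝ V with hD
  let g : V → ℝ≥0∞ := fun x => ENNReal.ofReal ((1 + μ * ‖x‖) ^ (D + 1))⁻¹
  have hgm : Measurable g := by
    apply Measurable.ennreal_ofReal
    fun_prop
  have hg : ∫⁻ x, g x = ENNReal.ofReal (μ ^ D)⁻¹ * decayIntegral V (D + 1) := by
    have hdet : LinearMap.det (μ • (LinearMap.id : V →ₗ[ℝ] V)) = μ ^ D := by
      rw [LinearMap.det_smul, LinearMap.det_id, mul_one]
    have h := lintegral_comp_linearMap (μ • (LinearMap.id : V →ₗ[ℝ] V))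
      (by rw [hdet]; positivity) (fun x => ENNReal.ofReal ((1 + ‖x‖) ^ (D + 1))⁻¹)
    rw [hdet, abs_of_pos (by positivity)] at h
    simp only [LinearMap.smul_apply, LinearMap.id_apply, norm_smul, Real.norm_eq_abs,
      abs_of_pos hμ] at h
    exact h
  rw [← hg]
  refine le_trans ?_ (ENNReal.lintegral_mul_norm_pow_le (μ := volume)
    (f := fun x => G x * ENNReal.ofReal ((1 + μ * ‖x‖) ^ n)) (g := g)
    (hG.mul (Measurable.ennreal_ofReal (by fun_prop)).aemeasurable) hgm.aemeasurable hp0.le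
    (sub_nonneg.2 hp1) (by ring))
  apply lintegral_mono
  intro x
  have h1 : 1 ≤ 1 + μ * ‖x‖ := by
    have : 0 ≤ μ * ‖x‖ := by positivity
    linarith
  have h0 : 0 < 1 + μ * ‖x‖ := by linarith
  dsimp only [g]
  rw [ENNReal.mul_rpow_of_nonneg _ _ hp0.le, mul_assoc]
  apply le_mul_of_one_le_right (zero_le)
  rw [ENNReal.ofReal_rpow_of_pos (by positivity), ENNReal.ofReal_rpow_of_pos (by positivity),
    ← ENNReal.ofReal_mul (by positivity), ENNReal.one_le_ofReal]
  rw [← Real.rpow_natCast, ← Real.rpow_natCast, ← Real.rpow_neg h0.le, ← Real.rpow_mul h0.le,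
    ← Real.rpow_mul h0.le, ← Real.rpow_add h0]
  apply Real.one_le_rpow h1
  rw [div_le_iff₀ hp0] at hn
  push_cast
  linarith

end BoxKernels

/-! ### The operators of the single caps -/

section Pieces

open scoped ContDiff

variable {d : ℕ} {ρ : EuclideanSpace ℝ (Fin d) → ℝ} {φ : ℝ → ℂ} {j N : ℕ} {r R K : ℝ}

namespace CapDecomposition

variable (D : CapDecomposition ρ φ j N r R K)

/-- The linear map that takes the dual box of the `k`-th cap, dilated to frequencies of size `T`,
to the unit ball. -/
noncomputable def boxMap (T : ℝ) (k : Fin d → ℤ) :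
    EuclideanSpace ℝ (Fin d) →L[ℝ] EuclideanSpace ℝ (Fin d) :=
  stretch (T * capWidth j) (T * capWidth j ^ 2) (D.normal k)

variable {D}

theorem det_boxMap_ne_zero {T : ℝ} (hT : 0 < T) {k : Fin d → ℤ} (hk : k ∈ D.index) :
    LinearMap.det (D.boxMap T k : EuclideanSpace ℝ (Fin d) →ₗ[ℝ] EuclideanSpace ℝ (Fin d)) ≠ 0 := by
  have := capWidth_pos j
  exact det_stretch_ne_zero (D.norm_normal k hk) (by positivity) (by positivity)

theorem le_norm_boxMap {T : ℝ} (hT : 0 < T) {k : Fin d → ℤ} (hk : k ∈ D.index)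
    (x : EuclideanSpace ℝ (Fin d)) : T * capWidth j ^ 2 * ‖x‖ ≤ ‖D.boxMap T k x‖ := by
  have h0 := capWidth_pos j
  have h1 := capWidth_le_one j
  apply le_norm_stretch (D.norm_normal k hk) (by positivity) _ le_rfl
  gcongr
  nlinarith

theorem boxKernel_boxMap_le {T t : ℝ} (hT : 0 < T) (h1 : T ≤ t) (h2 : t ≤ 2 * T)
    (k : Fin d → ℤ) (x : EuclideanSpace ℝ (Fin d)) :
    boxKernel (D.boxMap t k) N x ≤ 2 ^ d * boxKernel (D.boxMap T k) N x := by
  have ht : 0 < t := hT.trans_le h1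
  have e : ∀ t x, D.boxMap t k x = t • stretch (capWidth j) (capWidth j ^ 2) (D.normal k) x :=
    fun t x => stretch_mul_left _ _ _ _ _
  have e2 : ∀ t, (D.boxMap t k : EuclideanSpace ℝ (Fin d) →ₗ[ℝ] EuclideanSpace ℝ (Fin d)) =
      t • (stretch (capWidth j) (capWidth j ^ 2) (D.normal k) :
        EuclideanSpace ℝ (Fin d) →ₗ[ℝ] EuclideanSpace ℝ (Fin d)) := by
    intro t
    ext1 x
    exact e t x
  unfold boxKernel
  rw [e2, e2, LinearMap.det_smul, LinearMap.det_smul, e, e, norm_smul, norm_smul,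
    finrank_euclideanSpace_fin, abs_mul, abs_mul, abs_of_pos (by positivity : 0 < t ^ d),
    abs_of_pos (by positivity : 0 < T ^ d), Real.norm_eq_abs, Real.norm_eq_abs, abs_of_pos ht,
    abs_of_pos hT]
  have h3 : t ^ d ≤ 2 ^ d * T ^ d := by
    rw [← mul_pow]
    gcongr
  calc _ ≤ (2 ^ d * T ^ d) * |LinearMap.det (stretch (capWidth j) (capWidth j ^ 2) (D.normal k) :
        EuclideanSpace ℝ (Fin d) →ₗ[ℝ] EuclideanSpace ℝ (Fin d))| *
        ((1 + T * ‖stretch (capWidth j) (capWidth j ^ 2) (D.normal k) x‖) ^ N)⁻¹ := by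
        gcongr
    _ = _ := by ring

theorem hasCompactSupport_symbol {k : Fin d → ℤ} (hk : k ∈ D.index) {t : ℝ} (ht : 0 < t) :
    HasCompactSupport (fun ξ => D.symbol k (t⁻¹ • ξ)) := by
  apply hasCompactSupport_of_norm_gt (R := t * R)
  intro ξ hξ
  by_contra h
  have := (D.symbol_support k hk _ h).2.1
  rw [norm_smul, norm_inv, Real.norm_eq_abs, abs_of_pos ht, inv_mul_le_iff₀ ht] at this
  linarith

theorem contDiff_symbol_smul {k : Fin d → ℤ} (hk : k ∈ D.index) (t : ℝ) :
    ContDiff ℝ ∞ (fun ξ => D.symbol k (t⁻¹ • ξ)) :=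
  (D.contDiff_symbol k hk).comp (contDiff_id.const_smul _)

theorem integrable_symbol {k : Fin d → ℤ} (hk : k ∈ D.index) {t : ℝ} (ht : 0 < t) :
    Integrable (fun ξ => D.symbol k (t⁻¹ • ξ)) :=
  (contDiff_symbol_smul hk t).continuous.integrable_of_hasCompactSupport
    (hasCompactSupport_symbol hk ht)

variable (D) in
/-- The part of the multiplier operator that belongs to the `k`-th cap. -/
noncomputable def piece (k : Fin d → ℤ) (f : EuclideanSpace ℝ (Fin d) → ℂ)
    (x : EuclideanSpace ℝ (Fin d)) (t : ℝ) : ℂ :=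
  𝓕⁻ (fun ξ => D.symbol k (t⁻¹ • ξ) * 𝓕 f ξ) x

variable {Kf : ℝ} {f : EuclideanSpace ℝ (Fin d) → ℂ}

theorem multiplierPiece_eq_sum (hf : IsBoundedOnUnitBall Kf f) {t : ℝ} (ht : 0 < t)
    (x : EuclideanSpace ℝ (Fin d)) :
    multiplierPiece ρ φ f x t = ∑ k ∈ D.index, D.piece k f x t := by
  have hi : ∀ k ∈ D.index, Integrable (fun ξ => D.symbol k (t⁻¹ • ξ) * 𝓕 f ξ) := fun k hk =>
    ((contDiff_symbol_smul hk t).continuous.mul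
      hf.contDiff_fourier.continuous).integrable_of_hasCompactSupport
      ((hasCompactSupport_symbol hk ht).mul_right)
  simp only [multiplierPiece, piece, Real.fourierInv_eq]
  rw [← integral_finsetSum]
  · congr 1
    ext ξ
    rw [D.sum_symbol, Finset.sum_mul, Finset.smul_sum]
  · intro k hk
    have := (Real.fourierIntegral_convergent_iff (V := EuclideanSpace ℝ (Fin d))
      (μ := volume) (f := fun ξ => D.symbol k (t⁻¹ • ξ) * 𝓕 f ξ) (-x)).2 (hi k hk)
    simpa using this

theorem enorm_multiplierPiece_le (hf : IsBoundedOnUnitBall Kf f) {t : ℝ} (ht : 0 < t)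
    (x : EuclideanSpace ℝ (Fin d)) :
    ‖multiplierPiece ρ φ f x t‖ₑ ≤ ∑ k ∈ D.index, ‖D.piece k f x t‖ₑ := by
  rw [multiplierPiece_eq_sum hf ht]
  exact enorm_sum_le _ _

theorem norm_kernel_le {k : Fin d → ℤ} (hk : k ∈ D.index) {t : ℝ} (ht : 0 < t)
    (x : EuclideanSpace ℝ (Fin d)) :
    ‖𝓕⁻ (fun ξ => D.symbol k (t⁻¹ • ξ)) x‖ ≤ K * boxKernel (D.boxMap t k) N x := by
  have h := D.kernel_le k hk (fun _ => 1) 1 contDiff_const (fun i _ η _ => by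
    rcases Nat.eq_zero_or_pos i with rfl | hi
    · simp
    · rw [iteratedFDeriv_const_of_ne (by omega)]
      simp) t ht x
  simp only [mul_one] at h
  exact h

/-- At frequencies `t ≈ T` the maximal function of a single cap is dominated by a convolution with
one fixed box kernel. -/
theorem enorm_kernel_le (hK : 0 ≤ K) {k : Fin d → ℤ} (hk : k ∈ D.index) {t T : ℝ} (hT : 0 < T)
    (h1 : T ≤ t) (h2 : t ≤ 2 * T) (x : EuclideanSpace ℝ (Fin d)) :
    ‖𝓕⁻ (fun ξ => D.symbol k (t⁻¹ • ξ)) x‖ₑ ≤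
      ENNReal.ofReal (K * 2 ^ d) * ENNReal.ofReal (boxKernel (D.boxMap T k) N x) := by
  rw [← ofReal_norm, ← ENNReal.ofReal_mul (by positivity)]
  apply ENNReal.ofReal_le_ofReal
  refine (norm_kernel_le hk (hT.trans_le h1) x).trans ?_
  rw [mul_assoc]
  gcongr
  exact boxKernel_boxMap_le hT h1 h2 k x

theorem enorm_piece_le (hK : 0 ≤ K) (hf : IsBoundedOnUnitBall Kf f) {k : Fin d → ℤ}
    (hk : k ∈ D.index) {t T : ℝ} (hT : 0 < T) (h1 : T ≤ t) (h2 : t ≤ 2 * T)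
    (x : EuclideanSpace ℝ (Fin d)) :
    ‖D.piece k f x t‖ₑ ≤ ENNReal.ofReal (K * 2 ^ d) *
      ∫⁻ y, ENNReal.ofReal (boxKernel (D.boxMap T k) N (x - y)) * ‖f y‖ₑ := by
  have ht := hT.trans_le h1
  rw [piece, fourierInv_mul_fourier (integrable_symbol hk ht) hf.integrable]
  refine (enorm_integral_le_lintegral_enorm _).trans ?_
  rw [← lintegral_const_mul' _ _ ENNReal.ofReal_ne_top]
  apply lintegral_mono
  intro y
  dsimp only
  rw [enorm_mul, ← mul_assoc]
  gcongr
  exact enorm_kernel_le hK hk hT h1 h2 _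

/-- A single cap contributes a bounded amount, for all `t` at once. -/
theorem enorm_piece_le_const (hK : 0 ≤ K) (hf : IsBoundedOnUnitBall Kf f) {k : Fin d → ℤ}
    (hk : k ∈ D.index) {t : ℝ} (ht : 0 < t) (x : EuclideanSpace ℝ (Fin d)) :
    ‖D.piece k f x t‖ₑ ≤ ENNReal.ofReal (K * 2 ^ d) *
      (ENNReal.ofReal Kf * decayIntegral (EuclideanSpace ℝ (Fin d)) N) := by
  refine (enorm_piece_le hK hf hk ht le_rfl (by linarith) x).trans ?_
  gcongr
  calc _ ≤ ∫⁻ y, ENNReal.ofReal (boxKernel (D.boxMap t k) N (x - y)) * ENNReal.ofReal Kf := by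
        apply lintegral_mono_ae
        filter_upwards [hf.bound] with y hy
        gcongr
        rw [← ofReal_norm]
        exact ENNReal.ofReal_le_ofReal hy
    _ = _ := by
        rw [lintegral_mul_const' _ _ ENNReal.ofReal_ne_top,
          lintegral_sub_left_eq_self (fun y => ENNReal.ofReal (boxKernel (D.boxMap t k) N y)),
          lintegral_boxKernel (det_boxMap_ne_zero ht hk), mul_comm]

end CapDecomposition

end Pieces

/-! ### Vanishing moments -/

section Moments

open scoped ContDiff

variable {V : Type*} [NormedAddCommGroup V] [InnerProductSpace ℝ V] [FiniteDimensional ℝ V]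
  [MeasurableSpace V] [BorelSpace V] {Kf : ℝ} {f : V → ℂ}

/-- The moments of `f` of order at most `M` vanish. The monomials are replaced by products of
`k ≤ M` linear forms, which is the shape in which they enter the derivatives of `𝓕 f`. -/
def HasVanishingMoments (M : ℕ) (f : V → ℂ) : Prop :=
  ∀ k ≤ M, ∀ v : Fin k → V, ∫ y, ((∏ i, inner ℝ y (v i) : ℝ) : ℂ) * f y = 0

theorem IsBoundedOnUnitBall.iteratedFDeriv_fourier_zero (hf : IsBoundedOnUnitBall Kf f) {M : ℕ}
    (hm : HasVanishingMoments M f) {k : ℕ} (hk : k ≤ M) :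
    iteratedFDeriv ℝ k (𝓕 f) 0 = 0 := by
  have hint : Integrable (fun v => VectorFourier.fourierPowSMulRight (innerSL ℝ) f v k) :=
    VectorFourier.integrable_fourierPowSMulRight _ (hf.integrable_pow_mul k)
      hf.aestronglyMeasurable
  rw [Real.iteratedFDeriv_fourier (N := ⊤) (fun n _ => hf.integrable_pow_mul n)
    hf.aestronglyMeasurable le_top]
  ext v
  rw [Real.fourier_continuousMultilinearMap_apply hint, Real.fourier_eq]
  simp only [inner_zero_right, neg_zero, AddChar.map_zero_eq_one, one_smul,
    zero_apply]
  have h := hm k hk v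
  have e : ∀ y, VectorFourier.fourierPowSMulRight (innerSL ℝ) f y k v =
      (-(2 * Real.pi * Complex.I)) ^ k * (((∏ i, inner ℝ y (v i) : ℝ) : ℂ) * f y) := by
    intro y
    rw [VectorFourier.fourierPowSMulRight_apply]
    simp [Complex.real_smul]
    exact Or.inl rfl
  simp only [e]
  rw [integral_const_mul, h, mul_zero]

theorem IsBoundedOnUnitBall.norm_iteratedFDeriv_fourier_le (hf : IsBoundedOnUnitBall Kf f) (k : ℕ)
    (η : V) : ‖iteratedFDeriv ℝ k (𝓕 f) η‖ ≤ (2 * Real.pi) ^ k * ∫ y, ‖f y‖ := by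
  rw [Real.iteratedFDeriv_fourier (N := ⊤) (fun n _ => hf.integrable_pow_mul n)
    hf.aestronglyMeasurable le_top]
  refine (VectorFourier.norm_fourierIntegral_le_integral_norm _ _ _ _ _).trans ?_
  rw [← integral_const_mul]
  apply integral_mono
  · exact (VectorFourier.integrable_fourierPowSMulRight _ (hf.integrable_pow_mul k)
      hf.aestronglyMeasurable).norm
  · exact hf.integrable.norm.const_mul _
  intro y
  refine (VectorFourier.norm_fourierPowSMulRight_le _ _ _ _).trans ?_
  by_cases hy : 1 < ‖y‖
  · rw [hf.eq_zero y hy]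
    simp only [norm_zero, mul_zero]
    positivity
  · have h1 : ‖innerSL (E := V) ℝ‖ ≤ 1 := norm_innerSL_le _
    have h2 : ‖y‖ ^ k ≤ 1 := pow_le_one₀ (norm_nonneg _) (not_lt.1 hy)
    calc _ ≤ (2 * Real.pi * 1) ^ k * 1 * ‖f y‖ := by gcongr
      _ = _ := by ring

/-- Vanishing moments make the Fourier transform vanish to order `M + 1` at the origin. -/
theorem IsBoundedOnUnitBall.norm_iteratedFDeriv_fourier_le_pow (hf : IsBoundedOnUnitBall Kf f)
    {M : ℕ} (hm : HasVanishingMoments M f) (i : ℕ) (hi : i ≤ M + 1) (η : V) :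
    ‖iteratedFDeriv ℝ (M + 1 - i) (𝓕 f) η‖ ≤ (2 * Real.pi) ^ (M + 1) * (∫ y, ‖f y‖) * ‖η‖ ^ i := by
  have hI : 0 ≤ ∫ y, ‖f y‖ := integral_nonneg fun y => norm_nonneg _
  induction i generalizing η with
  | zero =>
    rw [pow_zero, mul_one]
    exact hf.norm_iteratedFDeriv_fourier_le (M + 1) η
  | succ i ih =>
    have h0 := hf.iteratedFDeriv_fourier_zero hm (k := M + 1 - (i + 1)) (by omega)
    have hd : Differentiable ℝ (iteratedFDeriv ℝ (M + 1 - (i + 1)) (𝓕 f)) :=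
      hf.contDiff_fourier.differentiable_iteratedFDeriv
        (WithTop.coe_lt_coe.2 (ENat.natCast_lt_top (M + 1 - (i + 1))))
    have := Convex.norm_image_sub_le_of_norm_fderiv_le (𝕜 := ℝ)
      (f := iteratedFDeriv ℝ (M + 1 - (i + 1)) (𝓕 f)) (s := Metric.closedBall 0 ‖η‖)
      (C := (2 * Real.pi) ^ (M + 1) * (∫ y, ‖f y‖) * ‖η‖ ^ i) (x := 0) (y := η)
      (fun z _ => hd z) (fun z hz => by
        rw [norm_fderiv_iteratedFDeriv, show M + 1 - (i + 1) + 1 = M + 1 - i by omega]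
        refine (ih (by omega) z).trans ?_
        gcongr
        simpa using hz) (convex_closedBall _ _) (by simp) (by simp)
    rw [h0, sub_zero, sub_zero] at this
    refine this.trans_eq ?_
    ring

/-- Derivative bounds, uniform on bounded sets, for the dilates `𝓕 f (t ·)` with `t ≤ 1`. -/
theorem IsBoundedOnUnitBall.norm_iteratedFDeriv_fourier_smul_le (hf : IsBoundedOnUnitBall Kf f)
    {M : ℕ} (hm : HasVanishingMoments M f) {N i : ℕ} (hi : i ≤ N) {t R : ℝ} (ht : 0 < t)
    (ht1 : t ≤ 1) {η : V} (hη : ‖η‖ ≤ R) :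
    ‖iteratedFDeriv ℝ i (fun η => 𝓕 f (t • η)) η‖ ≤
      (2 * Real.pi) ^ (M + 1 + N) * (∫ y, ‖f y‖) * (1 + R) ^ (M + 1) * t ^ (M + 1) := by
  have hI : 0 ≤ ∫ y, ‖f y‖ := integral_nonneg fun y => norm_nonneg _
  have hR : 0 ≤ R := (norm_nonneg _).trans hη
  have hpi : 1 ≤ 2 * Real.pi := by linarith [Real.pi_gt_three]
  have h1 := norm_iteratedFDeriv_comp_affine_le hf.contDiff_fourier 0
    (t • ContinuousLinearMap.id ℝ V) i η
  simp only [zero_add, smul_apply, ContinuousLinearMap.id_apply] at h1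
  refine h1.trans ?_
  have h2 : ‖t • ContinuousLinearMap.id ℝ V‖ ≤ t := by
    rw [norm_smul, Real.norm_eq_abs, abs_of_pos ht]
    have := ContinuousLinearMap.norm_id_le (𝕜 := ℝ) (E := V)
    nlinarith
  have h3 : ‖t • ContinuousLinearMap.id ℝ V‖ ^ i ≤ t ^ i := by gcongr
  have hR1 : 1 ≤ 1 + R := by linarith
  rcases le_or_gt i (M + 1) with him | him
  · have h4 := hf.norm_iteratedFDeriv_fourier_le_pow hm (M + 1 - i) (by omega) (t • η)
    rw [show M + 1 - (M + 1 - i) = i by omega, norm_smul, Real.norm_eq_abs, abs_of_pos ht] at h4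
    calc _ ≤ ((2 * Real.pi) ^ (M + 1) * (∫ y, ‖f y‖) * (t * ‖η‖) ^ (M + 1 - i)) * t ^ i := by
          gcongr
      _ = (2 * Real.pi) ^ (M + 1) * (∫ y, ‖f y‖) * ‖η‖ ^ (M + 1 - i) * t ^ (M + 1 - i + i) := by
          rw [mul_pow, pow_add]
          ring
      _ ≤ (2 * Real.pi) ^ (M + 1 + N) * (∫ y, ‖f y‖) * (1 + R) ^ (M + 1) * t ^ (M + 1) := by
          rw [Nat.sub_add_cancel him]
          gcongr ?_ * _ * ?_ * _
          · exact pow_le_pow_right₀ hpi (by omega)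
          · calc ‖η‖ ^ (M + 1 - i) ≤ (1 + R) ^ (M + 1 - i) := by
                  gcongr
                  linarith
              _ ≤ (1 + R) ^ (M + 1) := pow_le_pow_right₀ hR1 (by omega)
  · have h4 := hf.norm_iteratedFDeriv_fourier_le i (t • η)
    calc _ ≤ ((2 * Real.pi) ^ i * (∫ y, ‖f y‖)) * t ^ i := by gcongr
      _ ≤ ((2 * Real.pi) ^ (M + 1 + N) * (∫ y, ‖f y‖)) * t ^ (M + 1) := by
          gcongr ?_ * _ * ?_
          · exact pow_le_pow_right₀ hpi (by omega)
          · exact pow_le_pow_of_le_one ht.le ht1 him.le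
      _ = (2 * Real.pi) ^ (M + 1 + N) * (∫ y, ‖f y‖) * 1 * t ^ (M + 1) := by ring
      _ ≤ _ := by
          gcongr
          exact one_le_pow₀ hR1

theorem IsBoundedOnUnitBall.integral_norm_le (hf : IsBoundedOnUnitBall Kf f) :
    ∫ y, ‖f y‖ ≤ volume.real (Metric.closedBall (0 : V) 1) * Kf := by
  have : ∫ x, ‖f x‖ ≤ ∫ x, (Metric.closedBall (0 : V) 1).indicator (fun _ => Kf) x := by
    apply integral_mono_ae hf.integrable.norm _ hf.norm_le_indicator
    rw [integrable_indicator_iff measurableSet_closedBall]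
    exact integrableOn_const (by exact measure_closedBall_lt_top.ne)
  refine this.trans_eq ?_
  rw [integral_indicator measurableSet_closedBall, setIntegral_const, smul_eq_mul]

end Moments

/-! ### Low frequencies, and decay away from the unit ball -/

section LowAndHighFrequencies

open scoped ContDiff

variable {d : ℕ} {ρ : EuclideanSpace ℝ (Fin d) → ℝ} {φ : ℝ → ℂ} {j N : ℕ} {r R K : ℝ}
  {Kf : ℝ} {f : EuclideanSpace ℝ (Fin d) → ℂ}

namespace CapDecomposition

variable {D : CapDecomposition ρ φ j N r R K}

/-- At low frequencies `𝓕 f` is absorbed into the symbol of the cap, and the vanishing moments make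
the kernel so obtained smaller by the factor `T ^ (M + 1)`. -/
theorem exists_enorm_piece_le_of_le_one (N M : ℕ) (R K Kf : ℝ) (hK : 0 ≤ K) :
    ∃ C : ℝ, 0 ≤ C ∧ ∀ (φ : ℝ → ℂ) (j : ℕ) (r : ℝ) (D : CapDecomposition ρ φ j N r R K)
      (f : EuclideanSpace ℝ (Fin d) → ℂ), IsBoundedOnUnitBall Kf f → HasVanishingMoments M f →
      ∀ k ∈ D.index, ∀ t T : ℝ, 0 < T → T ≤ t → t ≤ 2 * T → 2 * T ≤ 1 → ∀ x,
      ‖D.piece k f x t‖ₑ ≤ ENNReal.ofReal (C * T ^ (M + 1)) *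
        ENNReal.ofReal (boxKernel (D.boxMap T k) N x) := by
  set v : ℝ := volume.real (Metric.closedBall (0 : EuclideanSpace ℝ (Fin d)) 1) * |Kf| with hv
  have hv0 : 0 ≤ v := by positivity
  refine ⟨K * ((2 * Real.pi) ^ (M + 1 + N) * v * (1 + |R|) ^ (M + 1) * 2 ^ (M + 1)) * 2 ^ d,
    by positivity, ?_⟩
  intro φ j r D f hf hm k hk t T hT h1 h2 hT1 x
  have ht : 0 < t := hT.trans_le h1
  have hIv : ∫ y, ‖f y‖ ≤ v := by
    refine hf.integral_norm_le.trans ?_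
    rw [hv]
    gcongr
    exact le_abs_self _
  have hI : 0 ≤ ∫ y, ‖f y‖ := integral_nonneg fun y => norm_nonneg _
  have hu : ContDiff ℝ ∞ (fun η => 𝓕 f (t • η)) :=
    hf.contDiff_fourier.comp (contDiff_id.const_smul _)
  have h := D.kernel_le k hk (fun η => 𝓕 f (t • η)) _ hu (fun i hi η hη =>
    hf.norm_iteratedFDeriv_fourier_smul_le hm hi ht (h2.trans hT1) (hη.trans (le_abs_self R)))
    t ht x
  have e : (fun ξ => D.symbol k (t⁻¹ • ξ) * 𝓕 f (t • t⁻¹ • ξ)) =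
      fun ξ => D.symbol k (t⁻¹ • ξ) * 𝓕 f ξ := by
    funext ξ
    rw [smul_smul, mul_inv_cancel₀ ht.ne', one_smul]
  rw [e] at h
  rw [piece, ← ofReal_norm, ← ENNReal.ofReal_mul (by positivity)]
  apply ENNReal.ofReal_le_ofReal
  refine h.trans ?_
  have h3 : t ^ (M + 1) ≤ 2 ^ (M + 1) * T ^ (M + 1) := by
    rw [← mul_pow]
    gcongr
  calc _ ≤ K * ((2 * Real.pi) ^ (M + 1 + N) * v * (1 + |R|) ^ (M + 1) *
        (2 ^ (M + 1) * T ^ (M + 1))) * (2 ^ d * boxKernel (D.boxMap T k) N x) := by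
        gcongr
        · exact boxKernel_nonneg _ _ _
        · exact boxKernel_boxMap_le hT h1 h2 k x
    _ = _ := by ring

theorem measurable_ofReal_boxKernel {V : Type*} [NormedAddCommGroup V] [InnerProductSpace ℝ V]
    [MeasurableSpace V] [BorelSpace V] (A : V →L[ℝ] V) (N : ℕ) :
    Measurable fun x => ENNReal.ofReal (boxKernel A N x) :=
  (continuous_boxKernel A N).measurable.ennreal_ofReal

theorem lintegral_boxKernel_mul_weight_le {T : ℝ} (hT : 0 < T) {n N₀ : ℕ} {k : Fin d → ℤ}
    (hk : k ∈ D.index) :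
    ∫⁻ x, ENNReal.ofReal (boxKernel (D.boxMap T k) (N₀ + n) x) *
      ENNReal.ofReal ((1 + T * capWidth j ^ 2 * ‖x‖) ^ n) ≤
      decayIntegral (EuclideanSpace ℝ (Fin d)) N₀ := by
  rw [← lintegral_boxKernel (det_boxMap_ne_zero hT hk) N₀]
  apply lintegral_mono
  intro x
  dsimp only
  rw [← ENNReal.ofReal_mul (boxKernel_nonneg _ _ _)]
  apply ENNReal.ofReal_le_ofReal
  have := capWidth_pos j
  exact boxKernel_mul_weight_le (by positivity) (le_norm_boxMap hT hk) N₀ n x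

/-- Away from the support of `f` the weight may be moved from `x` to `x - y`. -/
theorem setLIntegral_conv_mul_weight_le (hf : IsBoundedOnUnitBall Kf f) {T : ℝ} (hT : 0 < T)
    {n N₀ : ℕ} {k : Fin d → ℤ} (hk : k ∈ D.index) :
    ∫⁻ x in {x | 2 < ‖x‖},
      (∫⁻ y, ENNReal.ofReal (boxKernel (D.boxMap T k) (N₀ + n) (x - y)) * ‖f y‖ₑ) *
      ENNReal.ofReal ((1 + T * capWidth j ^ 2 * ‖x‖) ^ n) ≤
      2 ^ n * decayIntegral (EuclideanSpace ℝ (Fin d)) N₀ * ∫⁻ y, ‖f y‖ₑ := by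
  have hμ : 0 < T * capWidth j ^ 2 := by
    have := capWidth_pos j
    positivity
  set μ := T * capWidth j ^ 2
  let Φ : EuclideanSpace ℝ (Fin d) → ℝ≥0∞ := fun z =>
    ENNReal.ofReal (boxKernel (D.boxMap T k) (N₀ + n) z) * ENNReal.ofReal ((1 + μ * ‖z‖) ^ n)
  have hΦ : Measurable Φ := (measurable_ofReal_boxKernel _ _).mul
    (Measurable.ennreal_ofReal (by fun_prop))
  calc _ ≤ ∫⁻ x in {x | 2 < ‖x‖}, 2 ^ n * ∫⁻ y, Φ (x - y) * ‖f y‖ₑ := by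
        apply setLIntegral_mono' (measurableSet_lt measurable_const measurable_norm)
        intro x hx
        rw [← lintegral_mul_const' _ _ ENNReal.ofReal_ne_top,
          ← lintegral_const_mul' _ _ (by finiteness)]
        apply lintegral_mono
        intro y
        by_cases hy : 1 < ‖y‖
        · simp [hf.eq_zero y hy]
        · dsimp only [Φ]
          simp only [Set.mem_ofPred_eq] at hx
          have h1 : ‖x‖ ≤ 2 * ‖x - y‖ := by
            have := norm_sub_norm_le x y
            linarith
          have h2 : ENNReal.ofReal ((1 + μ * ‖x‖) ^ n) ≤
              2 ^ n * ENNReal.ofReal ((1 + μ * ‖x - y‖) ^ n) := by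
            rw [show (2 : ℝ≥0∞) ^ n = ENNReal.ofReal (2 ^ n) by
              rw [ENNReal.ofReal_pow zero_le_two]; norm_num, ← ENNReal.ofReal_mul (by positivity),
              ← mul_pow]
            apply ENNReal.ofReal_le_ofReal
            gcongr
            nlinarith [mul_le_mul_of_nonneg_left h1 hμ.le]
          calc _ ≤ ENNReal.ofReal (boxKernel (D.boxMap T k) (N₀ + n) (x - y)) * ‖f y‖ₑ *
                (2 ^ n * ENNReal.ofReal ((1 + μ * ‖x - y‖) ^ n)) := by gcongr
            _ = _ := by ring
    _ ≤ ∫⁻ x, 2 ^ n * ∫⁻ y, Φ (x - y) * ‖f y‖ₑ := setLIntegral_le_lintegral _ _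
    _ = 2 ^ n * ((∫⁻ x, Φ x) * ∫⁻ y, ‖f y‖ₑ) := by
        rw [lintegral_const_mul' _ _ (by finiteness),
          lintegral_lintegral_conv hΦ hf.aestronglyMeasurable.enorm]
    _ ≤ _ := by
        rw [mul_assoc]
        gcongr
        exact lintegral_boxKernel_mul_weight_le hT hk

end CapDecomposition

end LowAndHighFrequencies

/-! ### Cutoffs to tubes -/

section TubeCutoffs

open scoped ContDiff

variable {V : Type*} [NormedAddCommGroup V] [InnerProductSpace ℝ V]

theorem stretch_inv_stretch {α β : ℝ} {n : V} (hn : ‖n‖ = 1) (hα : α ≠ 0) (hβ : β ≠ 0) (x : V) :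
    stretch α⁻¹ β⁻¹ n (stretch α β n x) = x := by
  rw [stretch_apply α⁻¹, inner_stretch hn, stretch_apply, smul_add, smul_smul, smul_smul,
    inv_mul_cancel₀ hα, one_smul, add_assoc, ← add_smul]
  have : α⁻¹ * ((β - α) * inner ℝ n x) + (β⁻¹ - α⁻¹) * (β * inner ℝ n x) = 0 := by
    field_simp
    ring
  rw [this, zero_smul, add_zero]

theorem norm_sub_inner_smul_comm {e f : V} (he : ‖e‖ = 1) (hf : ‖f‖ = 1) :
    ‖e - inner ℝ f e • f‖ = ‖f - inner ℝ e f • e‖ := by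
  rw [← sq_eq_sq₀ (norm_nonneg _) (norm_nonneg _), norm_sub_inner_smul_sq hf,
    norm_sub_inner_smul_sq he, he, hf, real_inner_comm]

variable [FiniteDimensional ℝ V] [MeasurableSpace V] [BorelSpace V]

/-- Smooth cutoffs to tubes of length `σ ^ 2` and width `σ` in the direction `e`, with the part
near the origin removed. -/
theorem exists_tube_cutoff (N : ℕ) {r R : ℝ} (hr : 0 < r) (hR : 0 < R) :
    ∃ C : ℝ, 0 < C ∧ ∀ (σ : ℝ) (e : V), 1 ≤ σ → ‖e‖ = 1 → ∃ χ : V → ℂ, ContDiff ℝ ∞ χ ∧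
      (∀ ξ, 8 * R * σ ^ 2 < ‖ξ‖ → χ ξ = 0) ∧ (∀ ξ, ‖χ ξ‖ ≤ 1) ∧
      (∀ ξ, r * σ ^ 2 ≤ ‖ξ‖ → ‖ξ‖ ≤ 2 * R * σ ^ 2 → ‖stretch σ⁻¹ (σ ^ 2)⁻¹ e ξ‖ ≤ 4 * R →
        χ ξ = 1) ∧
      (∀ ξ, χ ξ ≠ 0 → ξ ≠ 0 ∧ ‖ξ - inner ℝ e ξ • e‖ ≤ 16 * R / r * σ⁻¹ * ‖ξ‖) ∧
      ∀ x, ‖𝓕⁻ χ x‖ ≤ C * boxKernel (stretch σ (σ ^ 2) e) N x := by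
  obtain ⟨β, hβ, hβc, hβ1, hβ2, hβ3⟩ := exists_annulus_cutoff (V := V) hr (by linarith : 0 < 2 * R)
  let χ₀ : ContDiffBump (0 : V) := ⟨4 * R, 8 * R, by linarith, by linarith⟩
  have hβC : ContDiff ℝ ∞ (fun x => (β x : ℂ)) := Complex.ofRealCLM.contDiff.comp hβ
  have hχC : ContDiff ℝ ∞ (fun x => (χ₀ x : ℂ)) := Complex.ofRealCLM.contDiff.comp χ₀.contDiff
  obtain ⟨B₁, hB₁, hb₁⟩ := exists_forall_norm_iteratedFDeriv_le hβC
    (hβc.comp_left (g := fun y : ℝ => (y : ℂ)) (by simp)) N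
  obtain ⟨B₂, hB₂, hb₂⟩ := exists_forall_norm_iteratedFDeriv_le hχC
    (χ₀.hasCompactSupport.comp_left (g := fun y : ℝ => (y : ℂ)) (by simp)) N
  obtain ⟨C, hC, hbox⟩ := exists_norm_fourierInv_box_le (V := V) N (8 * R)
  refine ⟨C * (2 ^ N * (B₂ * B₁) + 1), by positivity, ?_⟩
  intro σ e hσ he
  have hσ0 : 0 < σ := by linarith
  have hσi : σ⁻¹ ≤ 1 := inv_le_one_of_one_le₀ hσ
  set χ : V → ℂ := fun ξ => χ₀ (stretch σ⁻¹ (σ ^ 2)⁻¹ e ξ) * β ((σ ^ 2)⁻¹ • ξ) with hχdef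
  have hχ : ContDiff ℝ ∞ χ := (hχC.comp (stretch σ⁻¹ (σ ^ 2)⁻¹ e).contDiff).mul
    (hβC.comp (contDiff_id.const_smul _))
  -- in the coordinates that turn the tube into a ball the cutoff has bounded derivatives
  have hcoord : ∀ ζ, χ (stretch σ (σ ^ 2) e ζ) = χ₀ ζ * β (0 + stretch σ⁻¹ 1 e ζ) := by
    intro ζ
    simp only [hχdef]
    rw [stretch_inv_stretch he (by positivity) (by positivity), zero_add, ← stretch_mul_left]
    congr 5
    · field_simp
    · field_simp
  have hne : ∀ ξ, χ ξ ≠ 0 → ‖stretch σ⁻¹ (σ ^ 2)⁻¹ e ξ‖ < 8 * R ∧ r / 2 < ‖(σ ^ 2)⁻¹ • ξ‖ := by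
    intro ξ h
    constructor
    · by_contra h2
      apply h
      simp only [hχdef]
      rw [χ₀.zero_of_le_dist (by simpa [χ₀] using h2)]
      simp
    · by_contra h2
      apply h
      simp only [hχdef]
      rw [hβ3 _ (not_lt.1 h2)]
      simp
  refine ⟨χ, hχ, ?_, ?_, ?_, ?_, ?_⟩
  · intro ξ hξ
    by_contra h
    have h1 := (hne ξ h).1
    have h2 := le_norm_stretch (α := σ⁻¹) (β := (σ ^ 2)⁻¹) (γ := (σ ^ 2)⁻¹) he (by positivity)
      (by gcongr; nlinarith) le_rfl ξ
    have h3 := h2.trans_lt h1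
    rw [inv_mul_lt_iff₀ (by positivity)] at h3
    linarith
  · intro ξ
    simp only [hχdef, norm_mul, Complex.norm_real, Real.norm_eq_abs]
    exact mul_le_one₀ (by rw [abs_of_nonneg χ₀.nonneg]; exact χ₀.le_one) (abs_nonneg _) (hβ1 _)
  · intro ξ h1 h2 h3
    simp only [hχdef]
    rw [χ₀.one_of_mem_closedBall (by simpa [χ₀] using h3), hβ2]
    · simp
    · rw [norm_smul, norm_inv, norm_pow, Real.norm_eq_abs, abs_of_pos hσ0,
        le_inv_mul_iff₀ (by positivity)]
      linarith
    · rw [norm_smul, norm_inv, norm_pow, Real.norm_eq_abs, abs_of_pos hσ0,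
        inv_mul_le_iff₀ (by positivity)]
      linarith
  · intro ξ h
    obtain ⟨h1, h2⟩ := hne ξ h
    rw [norm_smul, norm_inv, norm_pow, Real.norm_eq_abs, abs_of_pos hσ0,
      lt_inv_mul_iff₀ (by positivity)] at h2
    refine ⟨fun h0 => ?_, ?_⟩
    · rw [h0, norm_zero] at h2
      have : 0 < σ ^ 2 * (r / 2) := by positivity
      linarith
    · set y := stretch σ⁻¹ (σ ^ 2)⁻¹ e ξ
      have h3 : σ⁻¹ * ‖ξ - inner ℝ e ξ • e‖ ≤ ‖y‖ := by
        have h4 := stretch_sub_inner_smul (α := σ⁻¹) (β := (σ ^ 2)⁻¹) he ξ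
        have h5 := congrArg norm h4
        rw [norm_smul, Real.norm_eq_abs, abs_of_pos (by positivity)] at h5
        rw [← h5]
        apply le_of_sq_le_sq _ (norm_nonneg _)
        rw [norm_sub_inner_smul_sq he]
        linarith [sq_nonneg (inner ℝ e (stretch σ⁻¹ (σ ^ 2)⁻¹ e ξ))]
      rw [inv_mul_le_iff₀ hσ0] at h3
      have h6 : 16 * R / r * σ⁻¹ * (σ ^ 2 * (r / 2)) = 8 * R * σ := by
        field_simp
        ring
      have h7 : 16 * R / r * σ⁻¹ * (σ ^ 2 * (r / 2)) ≤ 16 * R / r * σ⁻¹ * ‖ξ‖ := by gcongr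
      nlinarith
  · intro x
    have hdet := det_stretch_ne_zero he hσ0 (by positivity : 0 < σ ^ 2)
    have := hbox (stretch σ (σ ^ 2) e : V →ₗ[ℝ] V) 0 χ (2 ^ N * (B₂ * B₁)) hdet
      (stretch_isSymmetric _ _ _) hχ (fun ζ hζ => by
        rw [zero_add, ContinuousLinearMap.coe_coe, hcoord, χ₀.zero_of_le_dist]
        · simp
        · simpa [χ₀] using hζ.le) (fun i hi ζ => by
        simp only [zero_add, ContinuousLinearMap.coe_coe]
        simp_rw [hcoord]
        refine norm_iteratedFDeriv_mul_le_of_le hχC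
          (hβC.comp (contDiff_const.add (stretch σ⁻¹ 1 e).contDiff)) (x := ζ)
          (fun i hi => hb₂ i hi ζ) (fun i hi => ?_) i hi
        refine (norm_iteratedFDeriv_comp_affine_le hβC 0 (stretch σ⁻¹ 1 e) i ζ).trans ?_
        have h1 : ‖stretch σ⁻¹ 1 e‖ ≤ 1 :=
          opNorm_stretch_le he (by rwa [abs_of_pos (by positivity)]) (by simp)
        calc _ ≤ B₁ * 1 := by
              gcongr
              · exact hb₁ i hi _
              · exact pow_le_one₀ (norm_nonneg _) h1
          _ = B₁ := mul_one _) x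
    refine this.trans ?_
    rw [ContinuousLinearMap.coe_coe, ← boxKernel]
    gcongr
    · exact boxKernel_nonneg _ _ _
    · linarith

end TubeCutoffs

/-! ### Almost orthogonality of the caps -/

section MiddleFrequencies

open scoped ContDiff

variable {d : ℕ} {ρ : EuclideanSpace ℝ (Fin d) → ℝ} {φ : ℝ → ℂ} {j N : ℕ} {r R K : ℝ}
  {Kf : ℝ} {f : EuclideanSpace ℝ (Fin d) → ℂ}

namespace CapDecomposition

variable (D : CapDecomposition ρ φ j N r R K)

/-- The direction of the center of the `k`-th cap. -/
noncomputable def direction (k : Fin d → ℤ) : EuclideanSpace ℝ (Fin d) :=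
  ‖D.center k‖⁻¹ • D.center k

variable {D}

theorem norm_direction (hr : 0 < r) {k : Fin d → ℤ} (hk : k ∈ D.index) : ‖D.direction k‖ = 1 := by
  have h := hr.trans_le (D.center_mem k hk).1
  rw [direction, norm_smul, norm_inv, norm_norm, inv_mul_cancel₀ h.ne']

theorem norm_smul_direction (hr : 0 < r) {k : Fin d → ℤ} (hk : k ∈ D.index) :
    ‖D.center k‖ • D.direction k = D.center k := by
  have h := hr.trans_le (D.center_mem k hk).1
  rw [direction, smul_smul, mul_inv_cancel₀ h.ne', one_smul]

/-- The dilated caps lie inside the tubes around their centers. -/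
theorem norm_stretch_direction_le (hr : 0 < r) (hR : 0 < R) {k : Fin d → ℤ} (hk : k ∈ D.index)
    {σ t : ℝ} (hσ : 1 ≤ σ) (hσj : σ * capWidth j ≤ 1) (h1 : σ ^ 2 ≤ t) (h2 : t ≤ 2 * σ ^ 2)
    {ξ : EuclideanSpace ℝ (Fin d)} (hξ : D.symbol k (t⁻¹ • ξ) ≠ 0) :
    r * σ ^ 2 ≤ ‖ξ‖ ∧ ‖ξ‖ ≤ 2 * R * σ ^ 2 ∧
      ‖stretch σ⁻¹ (σ ^ 2)⁻¹ (D.direction k) ξ‖ ≤ 4 * R := by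
  have hσ0 : 0 < σ := by linarith
  have ht : 0 < t := lt_of_lt_of_le (by positivity) h1
  have he := norm_direction hr hk
  obtain ⟨h3, h4, h5⟩ := D.symbol_support k hk _ hξ
  have h6 : ‖t⁻¹ • ξ‖ = t⁻¹ * ‖ξ‖ := by rw [norm_smul, norm_inv, Real.norm_eq_abs, abs_of_pos ht]
  rw [h6] at h3 h4
  rw [le_inv_mul_iff₀ ht] at h3
  rw [inv_mul_le_iff₀ ht] at h4
  refine ⟨by nlinarith, by nlinarith, ?_⟩
  set w := t⁻¹ • ξ - D.center k with hw
  -- the center lies on the axis of the tube, and the rest has size `O(s)`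
  have e : ξ = t • (‖D.center k‖ • D.direction k + w) := by
    rw [norm_smul_direction hr hk, hw, add_sub_cancel, smul_smul, mul_inv_cancel₀ ht.ne', one_smul]
  have e2 : stretch σ⁻¹ (σ ^ 2)⁻¹ (D.direction k) (D.direction k) =
      (σ ^ 2)⁻¹ • D.direction k := by
    rw [stretch_apply, real_inner_self_eq_norm_sq, he]
    module
  rw [e, map_smul, map_add, map_smul, e2, norm_smul, Real.norm_eq_abs, abs_of_pos ht]
  have h7 : ‖stretch σ⁻¹ (σ ^ 2)⁻¹ (D.direction k) w‖ ≤ σ⁻¹ * ‖w‖ := by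
    apply norm_stretch_le he
    · rw [abs_of_pos (by positivity)]
    · rw [abs_of_pos (by positivity)]
      gcongr
      nlinarith
  have h8 : ‖(‖D.center k‖ • (σ ^ 2)⁻¹ • D.direction k)‖ ≤ R * (σ ^ 2)⁻¹ := by
    rw [norm_smul, norm_smul, he, norm_norm, mul_one, norm_inv, norm_pow, Real.norm_eq_abs,
      abs_of_pos hσ0]
    gcongr
    exact (D.center_mem k hk).2
  calc _ ≤ 2 * σ ^ 2 * (R * (σ ^ 2)⁻¹ + σ⁻¹ * (R * capWidth j)) := by
        gcongr
        exact (norm_add_le _ _).trans (add_le_add h8 (h7.trans (by gcongr)))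
    _ = 2 * R + 2 * R * (σ * capWidth j) := by
        field_simp
    _ ≤ _ := by nlinarith

/-- Bounded overlap: a frequency lies in few tubes, because the directions of the caps of those
tubes are close to its own direction. -/
theorem sum_norm_sq_tube_le (hd : 2 ≤ d) (hr : 0 < r) (hR : 0 < R) {σ : ℝ} (hσ : 1 ≤ σ)
    (hσj : σ * capWidth j ≤ 1) {χ : (Fin d → ℤ) → EuclideanSpace ℝ (Fin d) → ℂ}
    (hχ1 : ∀ k ∈ D.index, ∀ ξ, ‖χ k ξ‖ ≤ 1)
    (hχ : ∀ k ∈ D.index, ∀ ξ, χ k ξ ≠ 0 → ξ ≠ 0 ∧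
      ‖ξ - inner ℝ (D.direction k) ξ • D.direction k‖ ≤ 16 * R / r * σ⁻¹ * ‖ξ‖)
    (ξ : EuclideanSpace ℝ (Fin d)) :
    ∑ k ∈ D.index, ‖χ k ξ‖ ^ 2 ≤ K * (capWidth j ^ (d - 1))⁻¹ * ((1 + 16 * R ^ 2 / r) * σ⁻¹) := by
  classical
  have hσ0 : 0 < σ := by linarith
  have hK : 0 ≤ K * (capWidth j ^ (d - 1))⁻¹ := (Nat.cast_nonneg _).trans D.card_le
  set J := D.index.filter (fun k => χ k ξ ≠ 0) with hJ
  have h1 : ∑ k ∈ D.index, ‖χ k ξ‖ ^ 2 ≤ J.card := by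
    rw [← Finset.sum_filter_of_ne (p := fun k => χ k ξ ≠ 0)
      (fun k _ h => by contrapose! h; simp [h])]
    calc _ ≤ ∑ k ∈ J, (1 : ℝ) := by
          apply Finset.sum_le_sum
          intro k hk
          exact pow_le_one₀ (norm_nonneg _) (hχ1 k (Finset.mem_filter.1 hk).1 ξ)
      _ = _ := by simp
  refine h1.trans ?_
  rcases J.eq_empty_or_nonempty with h0 | ⟨k₀, hk₀⟩
  · rw [h0, Finset.card_empty, Nat.cast_zero]
    positivity
  have hξ : ξ ≠ 0 := (hχ k₀ (Finset.mem_filter.1 hk₀).1 ξ (Finset.mem_filter.1 hk₀).2).1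
  have hξ0 : 0 < ‖ξ‖ := norm_pos_iff.2 hξ
  have hf : ‖(‖ξ‖⁻¹ • ξ)‖ = 1 := by
    rw [norm_smul, norm_inv, norm_norm, inv_mul_cancel₀ hξ0.ne']
  apply D.card_cone_le hd (‖ξ‖⁻¹ • ξ) _ hf _ J (Finset.filter_subset _ _)
  · intro k hk
    obtain ⟨hkI, hk0⟩ := Finset.mem_filter.1 hk
    have he := norm_direction hr hkI
    have h2 := (hχ k hkI ξ hk0).2
    set f := ‖ξ‖⁻¹ • ξ with hfdef
    set e := D.direction k with hedef
    have hξf : ξ = ‖ξ‖ • f := by rw [hfdef, smul_smul, mul_inv_cancel₀ hξ0.ne', one_smul]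
    have h3 : ‖f - inner ℝ e f • e‖ ≤ 16 * R / r * σ⁻¹ := by
      have e1 : ξ - inner ℝ e ξ • e = ‖ξ‖ • (f - inner ℝ e f • e) := by
        rw [hξf, norm_smul, norm_norm, hf, mul_one, real_inner_smul_right]
        module
      rw [e1, norm_smul, norm_norm, mul_comm] at h2
      exact le_of_mul_le_mul_right h2 hξ0
    have e2 : D.center k - inner ℝ f (D.center k) • f = ‖D.center k‖ • (e - inner ℝ f e • f) := by
      conv_lhs => rw [← norm_smul_direction hr hkI]
      rw [real_inner_smul_right]
      module
    rw [e2, norm_smul, norm_norm, norm_sub_inner_smul_comm he hf]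
    calc _ ≤ R * (16 * R / r * σ⁻¹) := by
          gcongr
          exact (D.center_mem k hkI).2
      _ = 16 * R ^ 2 / r * σ⁻¹ := by ring
      _ ≤ _ := by
          gcongr
          linarith
  · have : capWidth j ≤ σ⁻¹ := by
      rw [← one_div, le_div_iff₀ hσ0]
      linarith
    refine this.trans (le_mul_of_one_le_left (by positivity) ?_)
    have : 0 ≤ 16 * R ^ 2 / r := by positivity
    linarith

/-- By Cauchy–Schwarz over the caps, the overlap of the tubes saves `σ ^ (1/2)`. -/
theorem sum_sqrt_integral_tube_le (hd : 2 ≤ d) (hr : 0 < r) (hR : 0 < R) {σ : ℝ} (hσ : 1 ≤ σ)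
    (hσj : σ * capWidth j ≤ 1) (hf : IsBoundedOnUnitBall Kf f)
    {χ : (Fin d → ℤ) → EuclideanSpace ℝ (Fin d) → ℂ}
    (hχs : ∀ k ∈ D.index, ContDiff ℝ ∞ (χ k))
    (hχ0 : ∀ k ∈ D.index, ∀ ξ, 8 * R * σ ^ 2 < ‖ξ‖ → χ k ξ = 0)
    (hχ1 : ∀ k ∈ D.index, ∀ ξ, ‖χ k ξ‖ ≤ 1)
    (hχ : ∀ k ∈ D.index, ∀ ξ, χ k ξ ≠ 0 → ξ ≠ 0 ∧
      ‖ξ - inner ℝ (D.direction k) ξ • D.direction k‖ ≤ 16 * R / r * σ⁻¹ * ‖ξ‖) :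
    ∑ k ∈ D.index, √(∫ ξ, ‖χ k ξ * 𝓕 f ξ‖ ^ 2) ≤
      K * (capWidth j ^ (d - 1))⁻¹ * √((1 + 16 * R ^ 2 / r) *
        (volume.real (Metric.closedBall (0 : EuclideanSpace ℝ (Fin d)) 1) * Kf ^ 2)) * (√σ)⁻¹ := by
  have hσ0 : 0 < σ := by linarith
  set X := K * (capWidth j ^ (d - 1))⁻¹ with hX
  have hX0 : 0 ≤ X := (Nat.cast_nonneg _).trans D.card_le
  set Q := 1 + 16 * R ^ 2 / r with hQ
  have hQ0 : 0 < Q := by positivity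
  set v := volume.real (Metric.closedBall (0 : EuclideanSpace ℝ (Fin d)) 1) * Kf ^ 2 with hv
  have hv0 : 0 ≤ v := by positivity
  -- a cutoff that equals one on all the tubes
  let χ₁ : ContDiffBump (0 : EuclideanSpace ℝ (Fin d)) :=
    ⟨8 * R * σ ^ 2, 16 * R * σ ^ 2, by positivity, by nlinarith [mul_pos hR (pow_pos hσ0 2)]⟩
  have hi : ∀ k ∈ D.index, Integrable (fun ξ => ‖χ k ξ * 𝓕 f ξ‖ ^ 2) := by
    intro k hk
    apply Continuous.integrable_of_hasCompactSupport
    · exact (((hχs k hk).continuous.mul hf.contDiff_fourier.continuous).norm.pow 2)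
    · exact ((hasCompactSupport_of_norm_gt (hχ0 k hk)).mul_right (f' := 𝓕 f)).comp_left
        (g := fun z : ℂ => ‖z‖ ^ 2) (by simp)
  have hi1 : Integrable (fun ξ => χ₁ ξ ^ 2 * ‖𝓕 f ξ‖ ^ 2) := by
    apply Continuous.integrable_of_hasCompactSupport
    · exact (χ₁.continuous.pow 2).mul (hf.contDiff_fourier.continuous.norm.pow 2)
    · exact (χ₁.hasCompactSupport.comp_left (g := fun z : ℝ => z ^ 2) (by simp)).mul_right
  -- the bounded overlap and Bessel's inequality
  have hsum : ∑ k ∈ D.index, ∫ ξ, ‖χ k ξ * 𝓕 f ξ‖ ^ 2 ≤ X * (Q * σ⁻¹) * v := by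
    rw [← integral_finsetSum _ hi]
    calc _ ≤ ∫ ξ, X * (Q * σ⁻¹) * (χ₁ ξ ^ 2 * ‖𝓕 f ξ‖ ^ 2) := by
          apply integral_mono (integrable_finsetSum _ hi) (hi1.const_mul _)
          intro ξ
          dsimp only
          by_cases h : 8 * R * σ ^ 2 < ‖ξ‖
          · rw [Finset.sum_eq_zero]
            · positivity
            · intro k hk
              rw [hχ0 k hk ξ h]
              simp
          · rw [χ₁.one_of_mem_closedBall (by simpa [χ₁] using not_lt.1 h), one_pow, one_mul]
            simp only [norm_mul, mul_pow]
            rw [← Finset.sum_mul]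
            gcongr
            exact sum_norm_sq_tube_le hd hr hR hσ hσj hχ1 hχ ξ
      _ ≤ X * (Q * σ⁻¹) * v := by
          rw [integral_const_mul]
          gcongr
          exact (hf.integral_norm_sq_mul_fourier_le χ₁.contDiff χ₁.hasCompactSupport
            (fun x => χ₁.nonneg) (fun x => χ₁.le_one)).trans hf.integral_norm_sq_le
  apply le_of_sq_le_sq _ (by positivity)
  calc _ ≤ (D.index.card : ℝ) * ∑ k ∈ D.index, √(∫ ξ, ‖χ k ξ * 𝓕 f ξ‖ ^ 2) ^ 2 :=
        sq_sum_le_card_mul_sum_sq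
    _ ≤ X * (X * (Q * σ⁻¹) * v) := by
        gcongr
        · exact D.card_le
        · refine le_trans (le_of_eq ?_) hsum
          apply Finset.sum_congr rfl
          intro k hk
          exact Real.sq_sqrt (integral_nonneg fun ξ => by positivity)
    _ = _ := by
        rw [mul_pow, mul_pow, inv_pow, Real.sq_sqrt (by positivity), Real.sq_sqrt hσ0.le]
        ring

/-- At frequencies `t ≈ σ ^ 2` between `1` and `2 ^ j` the cancellation between the caps gains
`σ ^ (1/2)` over the trivial bound by the number of caps. -/
theorem exists_majorant_mid (ρ : EuclideanSpace ℝ (Fin d) → ℝ) (hd : 2 ≤ d) (hN : d < N)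
    (hr : 0 < r) (hR : 0 < R) (hK : 0 < K) (Kf : ℝ) :
    ∃ C : ℝ≥0∞, C ≠ ⊤ ∧ ∀ (φ : ℝ → ℂ) (j : ℕ) (_ : CapDecomposition ρ φ j N r R K)
      (f : EuclideanSpace ℝ (Fin d) → ℂ), IsBoundedOnUnitBall Kf f → ∀ σ : ℝ, 1 ≤ σ →
      σ * capWidth j ≤ 1 → ∃ G : EuclideanSpace ℝ (Fin d) → ℝ≥0∞, AEMeasurable G ∧
        (∀ t, σ ^ 2 ≤ t → t ≤ 2 * σ ^ 2 → ∀ x, ‖multiplierPiece ρ φ f x t‖ₑ ≤ G x) ∧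
        ∫⁻ x, G x ≤ C * ENNReal.ofReal (capWidth j ^ (d - 1))⁻¹ * ENNReal.ofReal (√σ)⁻¹ := by
  obtain ⟨C₁, hC₁, htube⟩ := exists_tube_cutoff (V := EuclideanSpace ℝ (Fin d)) (d + 1 + 1) hr hR
  set E := EuclideanSpace ℝ (Fin d)
  set w : ℝ :=
    √((1 + 16 * R ^ 2 / r) * (volume.real (Metric.closedBall (0 : E) 1) * Kf ^ 2)) with hw
  set A₁ : ℝ≥0∞ := ENNReal.ofReal K * ENNReal.ofReal w *
    volume (Metric.closedBall (0 : E) 2) ^ (1 / 2 : ℝ) with hA₁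
  set A₂ : ℝ≥0∞ := ENNReal.ofReal K * (ENNReal.ofReal C₁ * decayIntegral E (d + 1) *
    (volume (Metric.closedBall (0 : E) 1) * ENNReal.ofReal Kf)) with hA₂
  have hdN : decayIntegral E N ≠ ⊤ :=
    (decayIntegral_lt_top (by rwa [finrank_euclideanSpace_fin])).ne
  have hd1 : decayIntegral E (d + 1) ≠ ⊤ :=
    (decayIntegral_lt_top (by rw [finrank_euclideanSpace_fin]; omega)).ne
  have hv1 : volume (Metric.closedBall (0 : E) 1) ≠ ⊤ := measure_closedBall_lt_top.ne
  have hv2 : volume (Metric.closedBall (0 : E) 2) ^ (1 / 2 : ℝ) ≠ ⊤ :=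
    ENNReal.rpow_ne_top_of_nonneg (by norm_num) measure_closedBall_lt_top.ne
  refine ⟨ENNReal.ofReal (K * 2 ^ d) * decayIntegral E N * (A₁ + A₂), by finiteness, ?_⟩
  intro φ j D f hf σ hσ hσj
  have hσ0 : 0 < σ := by linarith
  have hT : 0 < σ ^ 2 := by positivity
  have hex := fun k (hk : k ∈ D.index) => htube σ (D.direction k) hσ (norm_direction hr hk)
  choose! χ hχs hχ0 hχ1 hχone hχne hχker using hex
  set X : ℝ := (capWidth j ^ (d - 1))⁻¹ with hX
  have hX0 : 0 ≤ X := by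
    have := capWidth_pos j
    positivity
  have hχc : ∀ k ∈ D.index, HasCompactSupport (χ k) := fun k hk =>
    hasCompactSupport_of_norm_gt (hχ0 k hk)
  -- the part of `f` with frequencies in the tube of the `k`-th cap
  let a : (Fin d → ℤ) → E → ℂ := fun k => 𝓕⁻ (fun ξ => χ k ξ * 𝓕 f ξ)
  have ham : ∀ k ∈ D.index, AEMeasurable (fun y => ‖a k y‖ₑ) := fun k hk =>
    (memLp_fourierInv ((hχs k hk).mul hf.contDiff_fourier) ((hχc k hk).mul_right) 1).1.enorm
  refine ⟨fun x => ∑ k ∈ D.index, ENNReal.ofReal (K * 2 ^ d) *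
    ∫⁻ y, ENNReal.ofReal (boxKernel (D.boxMap (σ ^ 2) k) N (x - y)) * ‖a k y‖ₑ, ?_, ?_, ?_⟩
  · apply Finset.aemeasurable_fun_sum
    intro k hk
    exact (aemeasurable_conv (measurable_ofReal_boxKernel _ _) (ham k hk)).const_mul _
  · intro t h1 h2 x
    have ht : 0 < t := hT.trans_le h1
    refine (enorm_multiplierPiece_le (D := D) hf ht x).trans (Finset.sum_le_sum fun k hk => ?_)
    rw [piece, fourierInv_mul_fourier_eq_of_cutoff hf (integrable_symbol hk ht) (hχs k hk)
      (hχc k hk) (fun ξ => by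
        by_cases h : D.symbol k (t⁻¹ • ξ) = 0
        · rw [h, zero_mul]
        · obtain ⟨h3, h4, h5⟩ := norm_stretch_direction_le hr hR hk hσ hσj h1 h2 h
          rw [hχone k hk ξ h3 h4 h5, mul_one])]
    refine (enorm_integral_le_lintegral_enorm _).trans ?_
    rw [← lintegral_const_mul' _ _ ENNReal.ofReal_ne_top]
    apply lintegral_mono
    intro y
    dsimp only
    rw [enorm_mul, ← mul_assoc]
    gcongr
    exact enorm_kernel_le hK.le hk hT h1 h2 _
  · have hcard : (D.index.card : ℝ≥0∞) ≤ ENNReal.ofReal K * ENNReal.ofReal X := by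
      rw [← ENNReal.ofReal_mul hK.le, ← ENNReal.ofReal_natCast]
      exact ENNReal.ofReal_le_ofReal D.card_le
    -- the kernel of a tube cutoff concentrates at scale `σ⁻¹`
    have hside : ∀ k ∈ D.index, ∫⁻ x in {x : E | 1 ≤ ‖x‖}, ‖𝓕⁻ (χ k) x‖ₑ ≤
        ENNReal.ofReal (√σ)⁻¹ * (ENNReal.ofReal C₁ * decayIntegral E (d + 1)) := by
      intro k hk
      have he := norm_direction hr hk
      have hlow : ∀ x, σ * ‖x‖ ≤ ‖stretch σ (σ ^ 2) (D.direction k) x‖ := fun x =>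
        le_norm_stretch he hσ0.le le_rfl (by nlinarith) x
      calc _ ≤ ∫⁻ x in {x : E | 1 ≤ ‖x‖}, ENNReal.ofReal (√σ)⁻¹ * (ENNReal.ofReal C₁ *
            ENNReal.ofReal (boxKernel (stretch σ (σ ^ 2) (D.direction k)) (d + 1) x)) := by
            apply setLIntegral_mono' (measurableSet_le measurable_const measurable_norm)
            intro x hx
            simp only [Set.mem_ofPred_eq] at hx
            have hb := boxKernel_nonneg (stretch σ (σ ^ 2) (D.direction k)) (d + 1) x
            rw [← ofReal_norm, ← ENNReal.ofReal_mul hC₁.le, ← ENNReal.ofReal_mul (by positivity)]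
            apply ENNReal.ofReal_le_ofReal
            refine (hχker k hk x).trans ?_
            have h1 := boxKernel_succ_le hσ0 hlow (d + 1) hx
            have h2 : σ⁻¹ ≤ (√σ)⁻¹ := by
              gcongr
              exact Real.sqrt_le_iff.2 ⟨hσ0.le, by nlinarith⟩
            calc _ ≤ C₁ * ((√σ)⁻¹ * boxKernel (stretch σ (σ ^ 2) (D.direction k)) (d + 1) x) := by
                  gcongr
                  exact h1.trans (by gcongr)
              _ = _ := by ring
        _ ≤ ∫⁻ x, ENNReal.ofReal (√σ)⁻¹ * (ENNReal.ofReal C₁ *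
            ENNReal.ofReal (boxKernel (stretch σ (σ ^ 2) (D.direction k)) (d + 1) x)) :=
            setLIntegral_le_lintegral _ _
        _ = _ := by
            rw [lintegral_const_mul' _ _ ENNReal.ofReal_ne_top,
              lintegral_const_mul' _ _ ENNReal.ofReal_ne_top,
              lintegral_boxKernel (det_stretch_ne_zero he hσ0 hT)]
    have hsq := sum_sqrt_integral_tube_le hd hr hR hσ hσj hf hχs hχ0 hχ1 hχne
    have hmain : ∑ k ∈ D.index, ∫⁻ x, ‖a k x‖ₑ ≤
        (A₁ + A₂) * ENNReal.ofReal X * ENNReal.ofReal (√σ)⁻¹ := by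
      calc _ ≤ ∑ k ∈ D.index, (ENNReal.ofReal √(∫ ξ, ‖χ k ξ * 𝓕 f ξ‖ ^ 2) *
              volume (Metric.closedBall (0 : E) 2) ^ (1 / 2 : ℝ) +
            (ENNReal.ofReal (√σ)⁻¹ * (ENNReal.ofReal C₁ * decayIntegral E (d + 1))) *
              (volume (Metric.closedBall (0 : E) 1) * ENNReal.ofReal Kf)) := by
            apply Finset.sum_le_sum
            intro k hk
            refine (lintegral_enorm_fourierInv_mul_fourier_le hf (hχs k hk) (hχc k hk)).trans ?_
            rw [ENNReal.ofReal_rpow_of_nonneg (integral_nonneg fun ξ => by positivity)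
              (by norm_num), ← Real.sqrt_eq_rpow]
            gcongr
            · exact hside k hk
            · exact hf.lintegral_enorm_le
        _ = ENNReal.ofReal (∑ k ∈ D.index, √(∫ ξ, ‖χ k ξ * 𝓕 f ξ‖ ^ 2)) *
              volume (Metric.closedBall (0 : E) 2) ^ (1 / 2 : ℝ) +
            D.index.card * ((ENNReal.ofReal (√σ)⁻¹ *
              (ENNReal.ofReal C₁ * decayIntegral E (d + 1))) *
              (volume (Metric.closedBall (0 : E) 1) * ENNReal.ofReal Kf)) := by
            rw [Finset.sum_add_distrib, ← Finset.sum_mul, Finset.sum_const, nsmul_eq_mul,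
              ENNReal.ofReal_sum_of_nonneg (fun k _ => Real.sqrt_nonneg _)]
        _ ≤ ENNReal.ofReal (K * X * w * (√σ)⁻¹) *
              volume (Metric.closedBall (0 : E) 2) ^ (1 / 2 : ℝ) +
            ENNReal.ofReal K * ENNReal.ofReal X * ((ENNReal.ofReal (√σ)⁻¹ *
              (ENNReal.ofReal C₁ * decayIntegral E (d + 1))) *
              (volume (Metric.closedBall (0 : E) 1) * ENNReal.ofReal Kf)) := by
            gcongr
        _ = _ := by
            rw [ENNReal.ofReal_mul (by positivity), ENNReal.ofReal_mul (by positivity),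
              ENNReal.ofReal_mul hK.le, hA₁, hA₂]
            ring
    rw [lintegral_finsetSum']
    · calc _ = ENNReal.ofReal (K * 2 ^ d) * decayIntegral E N *
            ∑ k ∈ D.index, ∫⁻ x, ‖a k x‖ₑ := by
            rw [Finset.mul_sum]
            apply Finset.sum_congr rfl
            intro k hk
            rw [lintegral_const_mul' _ _ ENNReal.ofReal_ne_top,
              lintegral_lintegral_conv (measurable_ofReal_boxKernel _ _) (ham k hk),
              lintegral_boxKernel (det_boxMap_ne_zero hT hk), mul_assoc]
        _ ≤ ENNReal.ofReal (K * 2 ^ d) * decayIntegral E N *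
            ((A₁ + A₂) * ENNReal.ofReal X * ENNReal.ofReal (√σ)⁻¹) := by gcongr
        _ = _ := by ring
    · intro k hk
      exact (aemeasurable_conv (measurable_ofReal_boxKernel _ _) (ham k hk)).const_mul _

end CapDecomposition

end MiddleFrequencies

/-! ### Integrable majorants -/

section Majorants

variable {V : Type*} [MeasureSpace V] {m : V → ℝ → ℝ≥0∞} {p : ℝ}

/-- On the set `Λ` of pairs `(x, t)`, the `p`-th power of `m x t` is dominated by a function of `x`
whose integral is at most `B`. -/
def HasIntegralMajorant (m : V → ℝ → ℝ≥0∞) (p : ℝ) (Λ : Set (V × ℝ)) (B : ℝ≥0∞) : Prop :=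
  ∃ S : V → ℝ≥0∞, AEMeasurable S ∧ (∀ x t, (x, t) ∈ Λ → m x t ^ p ≤ S x) ∧ ∫⁻ x, S x ≤ B

namespace HasIntegralMajorant

theorem mono {Λ Λ' : Set (V × ℝ)} {B B' : ℝ≥0∞} (h : HasIntegralMajorant m p Λ B) (hΛ : Λ' ⊆ Λ)
    (hB : B ≤ B') : HasIntegralMajorant m p Λ' B' := by
  obtain ⟨S, hS, h1, h2⟩ := h
  exact ⟨S, hS, fun x t hx => h1 x t (hΛ hx), h2.trans hB⟩

theorem union {Λ Λ' : Set (V × ℝ)} {B B' : ℝ≥0∞} (h : HasIntegralMajorant m p Λ B)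
    (h' : HasIntegralMajorant m p Λ' B') : HasIntegralMajorant m p (Λ ∪ Λ') (B + B') := by
  obtain ⟨S, hS, h1, h2⟩ := h
  obtain ⟨S', hS', h1', h2'⟩ := h'
  refine ⟨fun x => S x + S' x, hS.add hS', ?_, ?_⟩
  · rintro x t (hx | hx)
    · exact (h1 x t hx).trans le_self_add
    · exact (h1' x t hx).trans le_add_self
  · rw [lintegral_add_left' hS]
    gcongr

/-- Majorants with geometrically decaying integrals may be added. -/
theorem iUnion {Λ : ℕ → Set (V × ℝ)} {B q : ℝ≥0∞}
    (h : ∀ i, HasIntegralMajorant m p (Λ i) (B * q ^ i)) :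
    HasIntegralMajorant m p (⋃ i, Λ i) (B * (1 - q)⁻¹) := by
  choose S hS h1 h2 using h
  refine ⟨fun x => ∑' i, S i x, AEMeasurable.tsum hS, ?_, ?_⟩
  · intro x t hx
    obtain ⟨i, hi⟩ := Set.mem_iUnion.1 hx
    exact (h1 i x t hi).trans (ENNReal.le_tsum i)
  · rw [lintegral_tsum hS, ← ENNReal.tsum_geometric, ← ENNReal.tsum_mul_left]
    exact ENNReal.tsum_le_tsum h2

theorem lintegral_iSup_le (hp : 0 < p) {B : ℝ≥0∞}
    (h : HasIntegralMajorant m p {z | 0 < z.2} B) :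
    ∫⁻ x, (⨆ (t : ℝ) (_ : 0 < t), m x t) ^ p ≤ B := by
  obtain ⟨S, hS, h1, h2⟩ := h
  refine le_trans (lintegral_mono fun x => ?_) h2
  rw [← ENNReal.le_rpow_inv_iff hp]
  refine iSup_le fun t => iSup_le fun ht => ?_
  rw [ENNReal.le_rpow_inv_iff hp]
  exact h1 x t ht

end HasIntegralMajorant

end Majorants

/-! ### Summation over dyadic frequencies -/

section Regimes

open scoped ContDiff

variable {d : ℕ} {ρ : EuclideanSpace ℝ (Fin d) → ℝ} {φ : ℝ → ℂ} {j N : ℕ} {r R K : ℝ}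
  {Kf : ℝ} {f : EuclideanSpace ℝ (Fin d) → ℂ} {p : ℝ}

/-- Up to constants, the bound for `‖maximalPiece ρ φ f‖_p ^ p` when `f` is a normalized atom: the
`p`-th power of the number of caps, times the volume of the ball of radius `2 ^ j` to the power
`1 - p`. -/
noncomputable def capGrowth (d j : ℕ) (p : ℝ) : ℝ :=
  ((capWidth j ^ (d - 1))⁻¹) ^ p * (((capWidth j ^ 2) ^ d)⁻¹) ^ (1 - p)

theorem capGrowth_eq (hd : 1 ≤ d) (j : ℕ) (p : ℝ) :
    capGrowth d j p = (2 : ℝ) ^ ((j : ℝ) * (d - p * (d + 1) / 2)) := by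
  have h2 : (0 : ℝ) ≤ 2 := zero_le_two
  have e : ∀ n : ℕ, (capWidth j ^ n)⁻¹ = (2 : ℝ) ^ ((j : ℝ) / 2 * n) := by
    intro n
    rw [capWidth, ← Real.rpow_natCast, ← Real.rpow_mul h2, ← Real.rpow_neg h2]
    congr 1
    ring
  rw [capGrowth, ← pow_mul, e, e, ← Real.rpow_mul h2, ← Real.rpow_mul h2,
    ← Real.rpow_add zero_lt_two]
  congr 1
  push_cast [Nat.cast_sub hd]
  ring

theorem capGrowth_pos (d j : ℕ) (p : ℝ) : 0 < capGrowth d j p := by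
  have := capWidth_pos j
  unfold capGrowth
  positivity

/-- Hölder's inequality for a majorant that belongs to the frequencies `t ≈ T`: its box kernels live
on the ball of radius `2 ^ j / T`. -/
theorem lintegral_rpow_le_capGrowth {G : EuclideanSpace ℝ (Fin d) → ℝ≥0∞} (hG : AEMeasurable G)
    (hp0 : 0 < p) (hp1 : p ≤ 1) {n : ℕ} (hn : ((d : ℝ) + 1) * (1 - p) / p ≤ n) {T u : ℝ}
    (hT : 0 < T) (hu : 0 ≤ u) {A : ℝ≥0∞}
    (h : ∫⁻ x, G x * ENNReal.ofReal ((1 + T * capWidth j ^ 2 * ‖x‖) ^ n) ≤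
      A * ENNReal.ofReal (capWidth j ^ (d - 1))⁻¹ * ENNReal.ofReal u) :
    ∫⁻ x, G x ^ p ≤ A ^ p * decayIntegral (EuclideanSpace ℝ (Fin d)) (d + 1) ^ (1 - p) *
      ENNReal.ofReal (capGrowth d j p) * ENNReal.ofReal (u ^ p * ((T ^ d)⁻¹) ^ (1 - p)) := by
  have hs := capWidth_pos j
  have h1 := lintegral_rpow_le_of_weight hG (μ := T * capWidth j ^ 2) (n := n) (by positivity)
    hp0 hp1 (by rwa [finrank_euclideanSpace_fin])
  rw [finrank_euclideanSpace_fin] at h1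
  refine h1.trans ?_
  have hp' : 0 ≤ 1 - p := by linarith
  calc _ ≤ (A * ENNReal.ofReal (capWidth j ^ (d - 1))⁻¹ * ENNReal.ofReal u) ^ p *
        (ENNReal.ofReal ((T * capWidth j ^ 2) ^ d)⁻¹ *
          decayIntegral (EuclideanSpace ℝ (Fin d)) (d + 1)) ^ (1 - p) := by gcongr
    _ = _ := by
      rw [ENNReal.mul_rpow_of_nonneg _ _ hp0.le, ENNReal.mul_rpow_of_nonneg _ _ hp0.le,
        ENNReal.mul_rpow_of_nonneg _ _ hp', mul_pow, mul_inv,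
        ENNReal.ofReal_mul (by positivity), ENNReal.mul_rpow_of_nonneg _ _ hp', capGrowth,
        ENNReal.ofReal_mul (by positivity), ENNReal.ofReal_mul (by positivity),
        ENNReal.ofReal_rpow_of_nonneg (by positivity) hp0.le,
        ENNReal.ofReal_rpow_of_nonneg hu hp0.le,
        ENNReal.ofReal_rpow_of_nonneg (by positivity) hp',
        ENNReal.ofReal_rpow_of_nonneg (by positivity) hp']
      ring

namespace CapDecomposition

variable {D : CapDecomposition ρ φ j N r R K}

theorem card_index_le (D : CapDecomposition ρ φ j N r R K) (hK : 0 ≤ K) : (D.index.card : ℝ≥0∞) ≤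
    ENNReal.ofReal K * ENNReal.ofReal (capWidth j ^ (d - 1))⁻¹ := by
  rw [← ENNReal.ofReal_mul hK, ← ENNReal.ofReal_natCast]
  exact ENNReal.ofReal_le_ofReal D.card_le

theorem sum_index_le (D : CapDecomposition ρ φ j N r R K) (hK : 0 ≤ K) {g : (Fin d → ℤ) → ℝ≥0∞}
    {A : ℝ≥0∞} (hg : ∀ k ∈ D.index, g k ≤ A) :
    ∑ k ∈ D.index, g k ≤ ENNReal.ofReal K * ENNReal.ofReal (capWidth j ^ (d - 1))⁻¹ * A := by
  refine (Finset.sum_le_card_nsmul _ _ _ hg).trans ?_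
  rw [nsmul_eq_mul]
  gcongr
  exact D.card_index_le hK

variable (ρ) in
/-- Frequencies `t ≤ 1`, where the vanishing moments give decay. -/
theorem exists_majorant_low (hp0 : 0 < p) (hp1 : p ≤ 1)
    {M n N₀ : ℕ} (hn : ((d : ℝ) + 1) * (1 - p) / p ≤ n) (hN₀ : d < N₀)
    (hM : (d : ℝ) * (1 / p - 1) < (M : ℝ) + 1) (r R : ℝ) (hK : 0 ≤ K) (Kf : ℝ) :
    ∃ C : ℝ≥0∞, C ≠ ⊤ ∧ ∀ (φ : ℝ → ℂ) (j : ℕ) (_ : CapDecomposition ρ φ j (N₀ + n) r R K)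
      (f : EuclideanSpace ℝ (Fin d) → ℂ), IsBoundedOnUnitBall Kf f → HasVanishingMoments M f →
      HasIntegralMajorant (fun x t => ‖multiplierPiece ρ φ f x t‖ₑ) p {z | 0 < z.2 ∧ z.2 ≤ 1}
        (C * ENNReal.ofReal (capGrowth d j p)) := by
  have hdN : decayIntegral (EuclideanSpace ℝ (Fin d)) N₀ ≠ ⊤ :=
    (decayIntegral_lt_top (by rwa [finrank_euclideanSpace_fin])).ne
  have hd1 : decayIntegral (EuclideanSpace ℝ (Fin d)) (d + 1) ≠ ⊤ :=
    (decayIntegral_lt_top (by rw [finrank_euclideanSpace_fin]; omega)).ne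
  have hp' : 0 ≤ 1 - p := by linarith
  obtain ⟨C, hC, hlow⟩ := exists_enorm_piece_le_of_le_one (d := d) (ρ := ρ) (N₀ + n) M R K Kf hK
  set A : ℝ≥0∞ := ENNReal.ofReal K *
    (ENNReal.ofReal C * decayIntegral (EuclideanSpace ℝ (Fin d)) N₀) with hA
  -- the gain `T ^ ((M + 1) p)` beats the volume factor `T ^ (-d (1 - p))`
  set δ : ℝ := (M + 1) * p - d * (1 - p) with hδ
  have hδ0 : 0 < δ := by
    have := mul_lt_mul_of_pos_right hM hp0
    rw [hδ]
    have e : (d : ℝ) * (1 / p - 1) * p = d * (1 - p) := by field_simp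
    linarith
  set q : ℝ≥0∞ := ENNReal.ofReal ((1 / 2) ^ δ) with hq
  have hq1 : q < 1 := by
    rw [hq, ENNReal.ofReal_lt_one]
    exact Real.rpow_lt_one (by norm_num) (by norm_num) hδ0
  have hA0 : A ≠ ⊤ := by finiteness
  have hAp : A ^ p ≠ ⊤ := ENNReal.rpow_ne_top_of_nonneg hp0.le hA0
  have hdp : decayIntegral (EuclideanSpace ℝ (Fin d)) (d + 1) ^ (1 - p) ≠ ⊤ :=
    ENNReal.rpow_ne_top_of_nonneg hp' hd1
  have hq2 : (1 - q)⁻¹ ≠ ⊤ := ENNReal.inv_ne_top.2 (tsub_pos_of_lt hq1).ne'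
  refine ⟨A ^ p * decayIntegral (EuclideanSpace ℝ (Fin d)) (d + 1) ^ (1 - p) * (1 - q)⁻¹,
    by finiteness, ?_⟩
  intro φ j D f hf hm
  have hmaj : ∀ i : ℕ, HasIntegralMajorant (fun x t => ‖multiplierPiece ρ φ f x t‖ₑ) p
      {z : EuclideanSpace ℝ (Fin d) × ℝ | (1 / 2) ^ (i + 1) ≤ z.2 ∧ z.2 ≤ 2 * (1 / 2) ^ (i + 1)}
      (A ^ p * decayIntegral (EuclideanSpace ℝ (Fin d)) (d + 1) ^ (1 - p) *
        ENNReal.ofReal (capGrowth d j p) * q ^ i) := by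
    intro i
    set T : ℝ := (1 / 2) ^ (i + 1) with hT
    have hT0 : 0 < T := by positivity
    have hT1 : 2 * T ≤ 1 := by
      rw [hT, pow_succ]
      have : (1 / 2 : ℝ) ^ i ≤ 1 := pow_le_one₀ (by norm_num) (by norm_num)
      linarith
    let G : EuclideanSpace ℝ (Fin d) → ℝ≥0∞ := fun x =>
      ∑ k ∈ D.index, ENNReal.ofReal (C * T ^ (M + 1)) *
        ENNReal.ofReal (boxKernel (D.boxMap T k) (N₀ + n) x)
    have hG : Measurable G := Finset.measurable_fun_sum _ fun k _ =>
      (measurable_ofReal_boxKernel _ _).const_mul _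
    have hint : ∫⁻ x, G x * ENNReal.ofReal ((1 + T * capWidth j ^ 2 * ‖x‖) ^ n) ≤
        A * ENNReal.ofReal (capWidth j ^ (d - 1))⁻¹ * ENNReal.ofReal (T ^ (M + 1)) := by
      simp only [G, Finset.sum_mul, mul_assoc]
      rw [lintegral_finsetSum']
      · refine (D.sum_index_le hK (A := ENNReal.ofReal (C * T ^ (M + 1)) *
          decayIntegral (EuclideanSpace ℝ (Fin d)) N₀) fun k hk => ?_).trans_eq ?_
        · rw [lintegral_const_mul' _ _ ENNReal.ofReal_ne_top]
          gcongr
          simpa only [mul_assoc] using lintegral_boxKernel_mul_weight_le (n := n) (N₀ := N₀) hT0 hk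
        · rw [ENNReal.ofReal_mul hC, hA]
          ring
      · intro k hk
        exact (((measurable_ofReal_boxKernel _ _).mul
          (Measurable.ennreal_ofReal (by fun_prop))).const_mul _).aemeasurable
    refine ⟨fun x => G x ^ p, (hG.pow_const p).aemeasurable, ?_, ?_⟩
    · rintro x t ⟨h1, h2⟩
      refine ENNReal.rpow_le_rpow ?_ hp0.le
      refine (enorm_multiplierPiece_le (D := D) hf (hT0.trans_le h1) x).trans
        (Finset.sum_le_sum fun k hk => ?_)
      exact hlow φ j r D f hf hm k hk t T hT0 h1 h2 hT1 x
    · refine (lintegral_rpow_le_capGrowth hG.aemeasurable hp0 hp1 hn hT0 (by positivity)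
        hint).trans ?_
      gcongr
      have e : (T ^ (M + 1)) ^ p * ((T ^ d)⁻¹) ^ (1 - p) = ((1 / 2 : ℝ) ^ δ) ^ (i + 1) := by
        rw [← Real.rpow_natCast T, ← Real.rpow_natCast T, ← Real.rpow_neg hT0.le,
          ← Real.rpow_mul hT0.le, ← Real.rpow_mul hT0.le, ← Real.rpow_add hT0, hT,
          ← Real.rpow_natCast, ← Real.rpow_natCast, ← Real.rpow_mul (by norm_num),
          ← Real.rpow_mul (by norm_num)]
        congr 1
        rw [hδ]
        push_cast
        ring
      rw [e, hq, ENNReal.ofReal_pow (by positivity)]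
      exact pow_le_pow_of_le_one zero_le hq1.le (by omega)
  refine (HasIntegralMajorant.iUnion hmaj).mono ?_ (le_of_eq ?_)
  swap
  · ring
  rintro ⟨x, t⟩ ⟨h0, h1⟩
  obtain ⟨i, hi1, hi2⟩ := exists_nat_pow_near_of_lt_one h0 h1 (y := (1 / 2 : ℝ)) (by norm_num)
    (by norm_num)
  refine Set.mem_iUnion.2 ⟨i, hi1.le, ?_⟩
  rw [pow_succ]
  dsimp only at hi2 ⊢
  linarith

variable (ρ) in
/-- On a ball of fixed radius every cap contributes a bounded amount. -/
theorem exists_majorant_near (hp0 : 0 < p) (hp1 : p ≤ 1)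
    (hN : d < N) (r R : ℝ) (hK : 0 ≤ K) (Kf : ℝ) :
    ∃ C : ℝ≥0∞, C ≠ ⊤ ∧ ∀ (φ : ℝ → ℂ) (j : ℕ) (_ : CapDecomposition ρ φ j N r R K)
      (f : EuclideanSpace ℝ (Fin d) → ℂ), IsBoundedOnUnitBall Kf f →
      HasIntegralMajorant (fun x t => ‖multiplierPiece ρ φ f x t‖ₑ) p {z | 0 < z.2 ∧ ‖z.1‖ ≤ 2}
        (C * ENNReal.ofReal (capGrowth d j p)) := by
  have hdN : decayIntegral (EuclideanSpace ℝ (Fin d)) N ≠ ⊤ :=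
    (decayIntegral_lt_top (by rwa [finrank_euclideanSpace_fin])).ne
  set A : ℝ≥0∞ := ENNReal.ofReal K * (ENNReal.ofReal (K * 2 ^ d) *
    (ENNReal.ofReal Kf * decayIntegral (EuclideanSpace ℝ (Fin d)) N)) with hA
  have hA0 : A ≠ ⊤ := by finiteness
  have hAp : A ^ p ≠ ⊤ := ENNReal.rpow_ne_top_of_nonneg hp0.le hA0
  have hv : volume (Metric.closedBall (0 : EuclideanSpace ℝ (Fin d)) 2) ≠ ⊤ :=
    measure_closedBall_lt_top.ne
  refine ⟨A ^ p * volume (Metric.closedBall (0 : EuclideanSpace ℝ (Fin d)) 2), by finiteness, ?_⟩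
  intro φ j D f hf
  have hs := capWidth_pos j
  refine ⟨(Metric.closedBall (0 : EuclideanSpace ℝ (Fin d)) 2).indicator
    (fun _ => (A * ENNReal.ofReal (capWidth j ^ (d - 1))⁻¹) ^ p),
    (measurable_const.indicator measurableSet_closedBall).aemeasurable, ?_, ?_⟩
  · rintro x t ⟨ht, hx⟩
    rw [Set.indicator_of_mem (by simpa using hx)]
    refine ENNReal.rpow_le_rpow ?_ hp0.le
    refine (enorm_multiplierPiece_le (D := D) hf ht x).trans ?_
    refine (D.sum_index_le hK fun k hk => enorm_piece_le_const hK hf hk ht x).trans_eq ?_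
    rw [hA]
    ring
  · rw [lintegral_indicator_const measurableSet_closedBall,
      ENNReal.mul_rpow_of_nonneg _ _ hp0.le,
      ENNReal.ofReal_rpow_of_nonneg (by positivity) hp0.le]
    have h1 : ((capWidth j ^ (d - 1))⁻¹) ^ p ≤ capGrowth d j p := by
      unfold capGrowth
      refine le_mul_of_one_le_right (by positivity) (Real.one_le_rpow ?_ (by linarith))
      apply (one_le_inv₀ (by positivity)).2
      exact pow_le_one₀ (by positivity) (pow_le_one₀ hs.le (capWidth_le_one j))
    calc _ ≤ A ^ p * ENNReal.ofReal (capGrowth d j p) *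
          volume (Metric.closedBall (0 : EuclideanSpace ℝ (Fin d)) 2) := by
          gcongr
      _ = _ := by ring

variable (ρ) in
/-- Frequencies `t ≥ 1` for `p < 1`, where the volume factor of Hölder's inequality decays. -/
theorem exists_majorant_high_of_lt_one (hd : 1 ≤ d)
    (hp0 : 0 < p) (hp1 : p < 1) {n N₀ : ℕ} (hn : ((d : ℝ) + 1) * (1 - p) / p ≤ n) (hN₀ : d < N₀)
    (r R : ℝ) (hK : 0 ≤ K) (Kf : ℝ) :
    ∃ C : ℝ≥0∞, C ≠ ⊤ ∧ ∀ (φ : ℝ → ℂ) (j : ℕ) (_ : CapDecomposition ρ φ j (N₀ + n) r R K)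
      (f : EuclideanSpace ℝ (Fin d) → ℂ), IsBoundedOnUnitBall Kf f →
      HasIntegralMajorant (fun x t => ‖multiplierPiece ρ φ f x t‖ₑ) p {z | 1 ≤ z.2 ∧ 2 < ‖z.1‖}
        (C * ENNReal.ofReal (capGrowth d j p)) := by
  have hdN : decayIntegral (EuclideanSpace ℝ (Fin d)) N₀ ≠ ⊤ :=
    (decayIntegral_lt_top (by rwa [finrank_euclideanSpace_fin])).ne
  have hd1 : decayIntegral (EuclideanSpace ℝ (Fin d)) (d + 1) ≠ ⊤ :=
    (decayIntegral_lt_top (by rw [finrank_euclideanSpace_fin]; omega)).ne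
  have hv1 : volume (Metric.closedBall (0 : EuclideanSpace ℝ (Fin d)) 1) ≠ ⊤ :=
    measure_closedBall_lt_top.ne
  have hp' : 0 < 1 - p := by linarith
  set A : ℝ≥0∞ := ENNReal.ofReal K * (ENNReal.ofReal (K * 2 ^ d) *
    (2 ^ n * decayIntegral (EuclideanSpace ℝ (Fin d)) N₀ *
    (volume (Metric.closedBall (0 : EuclideanSpace ℝ (Fin d)) 1) * ENNReal.ofReal Kf))) with hA
  set δ : ℝ := d * (1 - p) with hδ
  have hδ0 : 0 < δ := by
    have : (1 : ℝ) ≤ d := by exact_mod_cast hd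
    positivity
  set q : ℝ≥0∞ := ENNReal.ofReal ((1 / 2) ^ δ) with hq
  have hq1 : q < 1 := by
    rw [hq, ENNReal.ofReal_lt_one]
    exact Real.rpow_lt_one (by norm_num) (by norm_num) hδ0
  have hA0 : A ≠ ⊤ := by finiteness
  have hAp : A ^ p ≠ ⊤ := ENNReal.rpow_ne_top_of_nonneg hp0.le hA0
  have hdp : decayIntegral (EuclideanSpace ℝ (Fin d)) (d + 1) ^ (1 - p) ≠ ⊤ :=
    ENNReal.rpow_ne_top_of_nonneg hp'.le hd1
  have hq2 : (1 - q)⁻¹ ≠ ⊤ := ENNReal.inv_ne_top.2 (tsub_pos_of_lt hq1).ne'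
  refine ⟨A ^ p * decayIntegral (EuclideanSpace ℝ (Fin d)) (d + 1) ^ (1 - p) * (1 - q)⁻¹,
    by finiteness, ?_⟩
  intro φ j D f hf
  have hΩ : MeasurableSet {x : EuclideanSpace ℝ (Fin d) | 2 < ‖x‖} :=
    measurableSet_lt measurable_const measurable_norm
  have hmaj : ∀ i : ℕ, HasIntegralMajorant (fun x t => ‖multiplierPiece ρ φ f x t‖ₑ) p
      {z : EuclideanSpace ℝ (Fin d) × ℝ | (2 ^ i ≤ z.2 ∧ z.2 ≤ 2 * 2 ^ i) ∧ 2 < ‖z.1‖}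
      (A ^ p * decayIntegral (EuclideanSpace ℝ (Fin d)) (d + 1) ^ (1 - p) *
        ENNReal.ofReal (capGrowth d j p) * q ^ i) := by
    intro i
    set T : ℝ := 2 ^ i with hT
    have hT0 : 0 < T := by positivity
    let G₀ : EuclideanSpace ℝ (Fin d) → ℝ≥0∞ := fun x => ∑ k ∈ D.index, ENNReal.ofReal (K * 2 ^ d) *
      ∫⁻ y, ENNReal.ofReal (boxKernel (D.boxMap T k) (N₀ + n) (x - y)) * ‖f y‖ₑ
    have hconv : ∀ k, AEMeasurable fun x =>
        ∫⁻ y, ENNReal.ofReal (boxKernel (D.boxMap T k) (N₀ + n) (x - y)) * ‖f y‖ₑ := fun k =>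
      aemeasurable_conv (measurable_ofReal_boxKernel _ _) hf.aestronglyMeasurable.enorm
    have hG₀ : AEMeasurable G₀ := Finset.aemeasurable_fun_sum _ fun k _ => (hconv k).const_mul _
    let G : EuclideanSpace ℝ (Fin d) → ℝ≥0∞ := {x : EuclideanSpace ℝ (Fin d) | 2 < ‖x‖}.indicator G₀
    have hG : AEMeasurable G := hG₀.indicator hΩ
    have hint : ∫⁻ x, G x * ENNReal.ofReal ((1 + T * capWidth j ^ 2 * ‖x‖) ^ n) ≤
        A * ENNReal.ofReal (capWidth j ^ (d - 1))⁻¹ * ENNReal.ofReal 1 := by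
      have e : ∀ x, G x * ENNReal.ofReal ((1 + T * capWidth j ^ 2 * ‖x‖) ^ n) =
          {x : EuclideanSpace ℝ (Fin d) | 2 < ‖x‖}.indicator
            (fun x => G₀ x * ENNReal.ofReal ((1 + T * capWidth j ^ 2 * ‖x‖) ^ n)) x := by
        intro x
        by_cases hx : x ∈ {x : EuclideanSpace ℝ (Fin d) | 2 < ‖x‖}
        · simp only [G, Set.indicator_of_mem hx]
        · simp only [G, Set.indicator_of_notMem hx, zero_mul]
      simp only [e]
      rw [lintegral_indicator hΩ]
      simp only [G₀, Finset.sum_mul, mul_assoc]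
      rw [lintegral_finsetSum']
      · refine (D.sum_index_le hK (A := ENNReal.ofReal (K * 2 ^ d) *
          (2 ^ n * decayIntegral (EuclideanSpace ℝ (Fin d)) N₀ *
          (volume (Metric.closedBall (0 : EuclideanSpace ℝ (Fin d)) 1) * ENNReal.ofReal Kf)))
          fun k hk => ?_).trans_eq ?_
        · rw [lintegral_const_mul' _ _ ENNReal.ofReal_ne_top]
          gcongr
          have h := setLIntegral_conv_mul_weight_le (n := n) (N₀ := N₀) hf hT0 hk
          simp only [mul_assoc] at h ⊢
          refine h.trans ?_
          gcongr
          exact hf.lintegral_enorm_le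
        · rw [hA, ENNReal.ofReal_one]
          ring
      · intro k hk
        exact (((hconv k).mul
          (Measurable.ennreal_ofReal (by fun_prop)).aemeasurable).const_mul _).restrict
    refine ⟨fun x => G x ^ p, hG.pow_const p, ?_, ?_⟩
    · rintro x t ⟨⟨h1, h2⟩, hx⟩
      refine ENNReal.rpow_le_rpow ?_ hp0.le
      simp only [G]
      rw [Set.indicator_of_mem (by exact hx)]
      refine (enorm_multiplierPiece_le (D := D) hf (hT0.trans_le h1) x).trans
        (Finset.sum_le_sum fun k hk => ?_)
      exact enorm_piece_le hK hf hk hT0 h1 h2 x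
    · refine (lintegral_rpow_le_capGrowth hG hp0 hp1.le hn hT0 zero_le_one hint).trans ?_
      gcongr
      have e : (1 : ℝ) ^ p * ((T ^ d)⁻¹) ^ (1 - p) = ((1 / 2 : ℝ) ^ δ) ^ i := by
        have h2 : (0 : ℝ) ≤ 2 := zero_le_two
        rw [Real.one_rpow, one_mul, hT, one_div, Real.inv_rpow h2, ← Real.rpow_neg h2,
          ← Real.rpow_natCast, ← Real.rpow_natCast, ← Real.rpow_natCast, ← Real.rpow_mul h2,
          ← Real.rpow_neg h2, ← Real.rpow_mul h2, ← Real.rpow_mul h2]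
        congr 1
        rw [hδ]
        ring
      rw [e, hq, ENNReal.ofReal_pow (by positivity)]
  refine (HasIntegralMajorant.iUnion hmaj).mono ?_ (le_of_eq ?_)
  swap
  · ring
  rintro ⟨x, t⟩ ⟨h0, h1⟩
  obtain ⟨i, hi1, hi2⟩ := exists_nat_pow_near h0 (y := (2 : ℝ)) (by norm_num)
  refine Set.mem_iUnion.2 ⟨i, ⟨hi1, ?_⟩, h1⟩
  rw [pow_succ] at hi2
  dsimp only at hi2 ⊢
  linarith

end CapDecomposition

end Regimes

/-! ### High frequencies at the endpoint -/

section EndpointRegimes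

variable {d : ℕ} {ρ : EuclideanSpace ℝ (Fin d) → ℝ} {φ : ℝ → ℂ} {j N : ℕ} {r R K : ℝ}
  {Kf : ℝ} {f : EuclideanSpace ℝ (Fin d) → ℂ} {p : ℝ}

theorem capGrowth_one (d j : ℕ) : capGrowth d j 1 = (capWidth j ^ (d - 1))⁻¹ := by
  simp [capGrowth]

namespace CapDecomposition

variable (ρ) in
/-- Frequencies `1 ≤ t < 2 ^ j` for `p = 1`, where the caps are almost orthogonal. -/
theorem exists_majorant_mid_of_eq_one (hd : 2 ≤ d) (hN : d < N) (hr : 0 < r) (hR : 0 < R)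
    (hK : 0 < K) (Kf : ℝ) :
    ∃ C : ℝ≥0∞, C ≠ ⊤ ∧ ∀ (φ : ℝ → ℂ) (j : ℕ) (_ : CapDecomposition ρ φ j N r R K)
      (f : EuclideanSpace ℝ (Fin d) → ℂ), IsBoundedOnUnitBall Kf f →
      HasIntegralMajorant (fun x t => ‖multiplierPiece ρ φ f x t‖ₑ) 1 {z | 1 ≤ z.2 ∧ z.2 < 2 ^ j}
        (C * ENNReal.ofReal (capGrowth d j 1)) := by
  obtain ⟨C, hC, h⟩ := exists_majorant_mid ρ hd hN hr hR hK Kf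
  set q : ℝ≥0∞ := ENNReal.ofReal ((1 / 2) ^ (1 / 4 : ℝ)) with hq
  have hq1 : q < 1 := by
    rw [hq, ENNReal.ofReal_lt_one]
    exact Real.rpow_lt_one (by norm_num) (by norm_num) (by norm_num)
  have hq2 : (1 - q)⁻¹ ≠ ⊤ := ENNReal.inv_ne_top.2 (tsub_pos_of_lt hq1).ne'
  refine ⟨C * (1 - q)⁻¹, by finiteness, ?_⟩
  intro φ j D f hf
  have hs := capWidth_pos j
  have hmaj : ∀ i : ℕ, HasIntegralMajorant (fun x t => ‖multiplierPiece ρ φ f x t‖ₑ) 1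
      {z : EuclideanSpace ℝ (Fin d) × ℝ | i ≤ j ∧ 2 ^ i ≤ z.2 ∧ z.2 ≤ 2 * 2 ^ i}
      (C * ENNReal.ofReal (capGrowth d j 1) * q ^ i) := by
    intro i
    by_cases hij : i ≤ j
    · have h2i : (1 : ℝ) ≤ 2 ^ i := one_le_pow₀ (by norm_num)
      have hsq : √((2 : ℝ) ^ i) ^ 2 = 2 ^ i := Real.sq_sqrt (by positivity)
      have hσj : √((2 : ℝ) ^ i) * capWidth j ≤ 1 := by
        rw [← sq_le_one_iff₀ (by positivity), mul_pow, hsq,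
          ← inv_inv (capWidth j ^ 2), capWidth_sq_inv, ← div_eq_mul_inv,
          div_le_one (by positivity)]
        exact pow_le_pow_right₀ one_le_two hij
      obtain ⟨G, hG, h1, h2⟩ := h φ j D f hf √(2 ^ i) (Real.one_le_sqrt.2 h2i) hσj
      rw [hsq] at h1
      refine ⟨G, hG, ?_, h2.trans_eq ?_⟩
      · rintro x t ⟨-, h3, h4⟩
        rw [ENNReal.rpow_one]
        exact h1 t h3 h4 x
      · rw [capGrowth_one, hq, ← ENNReal.ofReal_pow (by positivity)]
        congr 2
        have h2 : (0 : ℝ) ≤ 2 := zero_le_two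
        rw [Real.sqrt_eq_rpow, Real.sqrt_eq_rpow, one_div 2, Real.inv_rpow h2,
          ← Real.rpow_natCast, ← Real.rpow_natCast, ← Real.rpow_mul h2, ← Real.rpow_mul h2,
          ← Real.rpow_neg h2, ← Real.rpow_neg h2, ← Real.rpow_mul h2]
        congr 1
        ring
    · exact ⟨fun _ => 0, aemeasurable_const, fun x t hx => absurd hx.1 hij, by simp⟩
  refine (HasIntegralMajorant.iUnion hmaj).mono ?_ (le_of_eq ?_)
  swap
  · ring
  rintro ⟨x, t⟩ ⟨h0, h1⟩
  obtain ⟨i, hi1, hi2⟩ := exists_nat_pow_near h0 (y := (2 : ℝ)) (by norm_num)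
  dsimp only at h1 hi1 hi2
  refine Set.mem_iUnion.2 ⟨i, ?_, hi1, ?_⟩
  · exact ((pow_lt_pow_iff_right₀ (one_lt_two (α := ℝ))).1 (hi1.trans_lt h1)).le
  · rw [pow_succ] at hi2
    dsimp only
    linarith

variable (ρ) in
/-- Frequencies `t ≥ 2 ^ j` for `p = 1`: away from the support of `f` the box kernels are small. -/
theorem exists_majorant_high_of_eq_one (hN : d + 1 < N) (r R : ℝ) (hK : 0 ≤ K) (Kf : ℝ) :
    ∃ C : ℝ≥0∞, C ≠ ⊤ ∧ ∀ (φ : ℝ → ℂ) (j : ℕ) (_ : CapDecomposition ρ φ j N r R K)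
      (f : EuclideanSpace ℝ (Fin d) → ℂ), IsBoundedOnUnitBall Kf f →
      HasIntegralMajorant (fun x t => ‖multiplierPiece ρ φ f x t‖ₑ) 1
        {z | 2 ^ j ≤ z.2 ∧ 2 < ‖z.1‖} (C * ENNReal.ofReal (capGrowth d j 1)) := by
  obtain ⟨N', rfl⟩ : ∃ N', N = N' + 1 := ⟨N - 1, by omega⟩
  have hdN : decayIntegral (EuclideanSpace ℝ (Fin d)) N' ≠ ⊤ :=
    (decayIntegral_lt_top (by rw [finrank_euclideanSpace_fin]; omega)).ne
  have hv1 : volume (Metric.closedBall (0 : EuclideanSpace ℝ (Fin d)) 1) ≠ ⊤ :=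
    measure_closedBall_lt_top.ne
  set A : ℝ≥0∞ := ENNReal.ofReal K * (ENNReal.ofReal (K * 2 ^ d) *
    (decayIntegral (EuclideanSpace ℝ (Fin d)) N' *
      (volume (Metric.closedBall (0 : EuclideanSpace ℝ (Fin d)) 1) * ENNReal.ofReal Kf))) with hA
  have hA0 : A ≠ ⊤ := by finiteness
  have hq2 : (1 - 2⁻¹ : ℝ≥0∞)⁻¹ ≠ ⊤ :=
    ENNReal.inv_ne_top.2 (tsub_pos_of_lt (ENNReal.inv_lt_one.2 ENNReal.one_lt_two)).ne'
  refine ⟨A * (1 - 2⁻¹)⁻¹, by finiteness, ?_⟩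
  intro φ j D f hf
  have hs := capWidth_pos j
  have hmaj : ∀ i : ℕ, HasIntegralMajorant (fun x t => ‖multiplierPiece ρ φ f x t‖ₑ) 1
      {z : EuclideanSpace ℝ (Fin d) × ℝ |
        (2 ^ j * 2 ^ i ≤ z.2 ∧ z.2 ≤ 2 * (2 ^ j * 2 ^ i)) ∧ 2 < ‖z.1‖}
      (A * ENNReal.ofReal (capGrowth d j 1) * 2⁻¹ ^ i) := by
    intro i
    set T : ℝ := 2 ^ j * 2 ^ i with hT
    have hT0 : 0 < T := by positivity
    have hTs : T * capWidth j ^ 2 = 2 ^ i := by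
      rw [hT, ← capWidth_sq_inv j]
      field_simp
    have hconv : ∀ k, AEMeasurable fun x =>
        ∫⁻ y, ENNReal.ofReal (boxKernel (D.boxMap T k) N' (x - y)) * ‖f y‖ₑ := fun k =>
      aemeasurable_conv (measurable_ofReal_boxKernel _ _) hf.aestronglyMeasurable.enorm
    refine ⟨fun x => ∑ k ∈ D.index, ENNReal.ofReal (K * 2 ^ d) * (2⁻¹ ^ i *
      ∫⁻ y, ENNReal.ofReal (boxKernel (D.boxMap T k) N' (x - y)) * ‖f y‖ₑ), ?_, ?_, ?_⟩
    · exact Finset.aemeasurable_fun_sum _ fun k _ => ((hconv k).const_mul _).const_mul _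
    · rintro x t ⟨⟨h1, h2⟩, hx⟩
      rw [ENNReal.rpow_one]
      refine (enorm_multiplierPiece_le (D := D) hf (hT0.trans_le h1) x).trans
        (Finset.sum_le_sum fun k hk => ?_)
      refine (enorm_piece_le hK hf hk hT0 h1 h2 x).trans ?_
      gcongr
      rw [← lintegral_const_mul' _ _ (by finiteness)]
      apply lintegral_mono
      intro y
      by_cases hy : 1 < ‖y‖
      · simp [hf.eq_zero y hy]
      · dsimp only at hx ⊢
        have hxy : 1 ≤ ‖x - y‖ := by
          have := norm_sub_norm_le x y
          linarith
        rw [← mul_assoc]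
        gcongr
        have hlow := le_norm_boxMap hT0 hk
        rw [hTs] at hlow
        have h3 := boxKernel_succ_le (by positivity) hlow N' hxy
        refine (ENNReal.ofReal_le_ofReal h3).trans_eq ?_
        rw [ENNReal.ofReal_mul (by positivity), ENNReal.ofReal_inv_of_pos (by positivity),
          ENNReal.ofReal_pow zero_le_two, ENNReal.ofReal_ofNat, ENNReal.inv_pow]
    · rw [lintegral_finsetSum']
      · refine (D.sum_index_le hK (A := ENNReal.ofReal (K * 2 ^ d) * (2⁻¹ ^ i *
          (decayIntegral (EuclideanSpace ℝ (Fin d)) N' *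
          (volume (Metric.closedBall (0 : EuclideanSpace ℝ (Fin d)) 1) * ENNReal.ofReal Kf))))
          fun k hk => ?_).trans_eq ?_
        · rw [lintegral_const_mul' _ _ ENNReal.ofReal_ne_top, lintegral_const_mul' _ _
            (by finiteness), lintegral_lintegral_conv (measurable_ofReal_boxKernel _ _)
            hf.aestronglyMeasurable.enorm, lintegral_boxKernel (det_boxMap_ne_zero hT0 hk)]
          gcongr
          exact hf.lintegral_enorm_le
        · rw [hA, capGrowth_one]
          ring
      · intro k hk
        exact ((hconv k).const_mul _).const_mul _
  refine (HasIntegralMajorant.iUnion hmaj).mono ?_ (le_of_eq ?_)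
  swap
  · ring
  rintro ⟨x, t⟩ ⟨h0, h1⟩
  dsimp only at h0 h1
  obtain ⟨i, hi1, hi2⟩ := exists_nat_pow_near (x := t / 2 ^ j)
    ((one_le_div₀ (by positivity)).2 h0) (y := (2 : ℝ)) (by norm_num)
  rw [le_div_iff₀ (by positivity)] at hi1
  rw [div_lt_iff₀ (by positivity), pow_succ] at hi2
  refine Set.mem_iUnion.2 ⟨i, ⟨?_, ?_⟩, h1⟩
  · dsimp only
    linarith
  · dsimp only
    linarith

end CapDecomposition

/-- The estimate for atoms that are normalized to the unit ball. -/
theorem exists_lintegral_maximalPiece_rpow_le {b : ℝ} (hρ : IsHomogeneousDistance ρ b)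
    (hd : 1 ≤ d) (C : ℕ → ℝ) (hp0 : 0 < p) (hp1 : p ≤ 1) (hdp : d = 1 → p < 1) {M : ℕ}
    (hM : (d : ℝ) * (1 / p - 1) < (M : ℝ) + 1) (Kf : ℝ) :
    ∃ A : ℝ≥0∞, A ≠ ⊤ ∧ ∀ j : ℕ, 1 ≤ j → ∀ φ : ℝ → ℂ, IsLocalizer C j φ →
      ∀ f : EuclideanSpace ℝ (Fin d) → ℂ, IsBoundedOnUnitBall Kf f → HasVanishingMoments M f →
      ∫⁻ x, maximalPiece ρ φ f x ^ p ≤ A * ENNReal.ofReal (capGrowth d j p) := by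
  obtain ⟨n, hn⟩ := exists_nat_ge (((d : ℝ) + 1) * (1 - p) / p)
  obtain ⟨r, R, K, hr, hR, hK, hD⟩ := exists_capDecomposition hρ hd C (d + 2 + n)
  obtain ⟨C₁, hC₁, h₁⟩ := CapDecomposition.exists_majorant_low ρ hp0 hp1 hn
    (by omega : d < d + 2) hM r R hK.le Kf
  obtain ⟨C₂, hC₂, h₂⟩ := CapDecomposition.exists_majorant_near ρ hp0 hp1
    (by omega : d < d + 2 + n) r R hK.le Kf
  have hhigh : ∃ C₃ : ℝ≥0∞, C₃ ≠ ⊤ ∧ ∀ (φ : ℝ → ℂ) (j : ℕ)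
      (_ : CapDecomposition ρ φ j (d + 2 + n) r R K)
      (f : EuclideanSpace ℝ (Fin d) → ℂ), IsBoundedOnUnitBall Kf f →
      HasIntegralMajorant (fun x t => ‖multiplierPiece ρ φ f x t‖ₑ) p {z | 1 ≤ z.2 ∧ 2 < ‖z.1‖}
        (C₃ * ENNReal.ofReal (capGrowth d j p)) := by
    rcases hp1.lt_or_eq with hp | rfl
    · exact CapDecomposition.exists_majorant_high_of_lt_one ρ hd hp0 hp hn (by omega) r R hK.le Kf
    · have hd2 : 2 ≤ d := by
        by_contra h
        exact lt_irrefl _ (hdp (by omega))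
      obtain ⟨C₃, hC₃, h₃⟩ := CapDecomposition.exists_majorant_mid_of_eq_one ρ hd2
        (by omega : d < d + 2 + n) hr hR hK Kf
      obtain ⟨C₄, hC₄, h₄⟩ := CapDecomposition.exists_majorant_high_of_eq_one ρ
        (by omega : d + 1 < d + 2 + n) r R hK.le Kf
      refine ⟨C₃ + C₄, by finiteness, fun φ j D f hf => ?_⟩
      refine ((h₃ φ j D f hf).union (h₄ φ j D f hf)).mono ?_ (by rw [add_mul])
      rintro ⟨x, t⟩ ⟨ht, hx⟩
      rcases lt_or_ge t (2 ^ j) with h | h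
      · exact Or.inl ⟨ht, h⟩
      · exact Or.inr ⟨h, hx⟩
  obtain ⟨C₃, hC₃, h₃⟩ := hhigh
  refine ⟨C₁ + (C₂ + C₃), by finiteness, fun j hj φ hφ f hf hm => ?_⟩
  obtain ⟨D⟩ := hD j hj φ hφ
  refine HasIntegralMajorant.lintegral_iSup_le hp0 (m := fun x t => ‖multiplierPiece ρ φ f x t‖ₑ) ?_
  refine ((h₁ φ j D f hf hm).union ((h₂ φ j D f hf).union (h₃ φ j D f hf))).mono ?_
    (by rw [add_mul, add_mul])
  rintro ⟨x, t⟩ ht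
  rcases le_or_gt t 1 with h | h
  · exact Or.inl ⟨ht, h⟩
  · rcases le_or_gt ‖x‖ 2 with hx | hx
    · exact Or.inr (Or.inl ⟨ht, hx⟩)
    · exact Or.inr (Or.inr ⟨h.le, hx⟩)

end EndpointRegimes

/-! ### Reduction to atoms on the unit ball -/

section Scaling

variable {d : ℕ}

theorem integral_comp_add_smul {V F : Type*} [NormedAddCommGroup V] [InnerProductSpace ℝ V]
    [FiniteDimensional ℝ V] [MeasurableSpace V] [BorelSpace V] [NormedAddCommGroup F]
    [NormedSpace ℝ F] (c : V) {r : ℝ} (hr : 0 < r) (g : V → F) :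
    ∫ y, g (c + r • y) = (r ^ Module.finrank ℝ V)⁻¹ • ∫ x, g x := by
  rw [Measure.integral_comp_smul volume (fun x => g (c + x)) r, abs_of_pos (by positivity),
    integral_add_left_eq_self]

theorem lintegral_comp_add_smul {V : Type*} [NormedAddCommGroup V] [InnerProductSpace ℝ V]
    [FiniteDimensional ℝ V] [MeasurableSpace V] [BorelSpace V] (c : V) {r : ℝ} (hr : 0 < r)
    (g : V → ℝ≥0∞) :
    ∫⁻ y, g (c + r • y) = ENNReal.ofReal (r ^ Module.finrank ℝ V)⁻¹ * ∫⁻ x, g x := by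
  have hdet : LinearMap.det (r • (LinearMap.id : V →ₗ[ℝ] V)) = r ^ Module.finrank ℝ V := by
    rw [LinearMap.det_smul, LinearMap.det_id, mul_one]
  have h := lintegral_comp_linearMap (r • (LinearMap.id : V →ₗ[ℝ] V))
    (by rw [hdet]; positivity) (fun x => g (c + x))
  rw [hdet, abs_of_pos (by positivity)] at h
  simp only [LinearMap.smul_apply, LinearMap.id_apply] at h
  rw [h, lintegral_add_left_eq_self]

theorem fourier_comp_add_smul (a : EuclideanSpace ℝ (Fin d) → ℂ) (c : EuclideanSpace ℝ (Fin d))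
    {r : ℝ} (hr : 0 < r) (η : EuclideanSpace ℝ (Fin d)) :
    𝓕 (fun y => a (c + r • y)) (r • η) =
      (r ^ d)⁻¹ • ((Real.fourierChar (inner ℝ c η) : ℂ) * 𝓕 a η) := by
  rw [Real.fourier_eq, Real.fourier_eq, ← integral_const_mul]
  have h := integral_comp_add_smul c hr
    (fun x => (Real.fourierChar (inner ℝ c η) : ℂ) * (Real.fourierChar (-inner ℝ x η) • a x))
  rw [finrank_euclideanSpace_fin] at h
  rw [← h]
  congr 1
  ext y
  rw [Circle.smul_def, Circle.smul_def, smul_eq_mul, smul_eq_mul, ← mul_assoc, ← Circle.coe_mul,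
    ← AddChar.map_add_eq_mul]
  congr 3
  rw [inner_add_left, real_inner_smul_left, real_inner_smul_right]
  ring

theorem multiplierPiece_comp_add_smul (ρ : EuclideanSpace ℝ (Fin d) → ℝ) (φ : ℝ → ℂ)
    (a : EuclideanSpace ℝ (Fin d) → ℂ) (c : EuclideanSpace ℝ (Fin d)) {r : ℝ} (hr : 0 < r)
    (y : EuclideanSpace ℝ (Fin d)) (t : ℝ) :
    multiplierPiece ρ φ (fun y => a (c + r • y)) y t =
      multiplierPiece ρ φ a (c + r • y) (t / r) := by
  rw [multiplierPiece, multiplierPiece, Real.fourierInv_eq, Real.fourierInv_eq]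
  have h := integral_comp_add_smul (0 : EuclideanSpace ℝ (Fin d)) hr (fun ξ =>
    Real.fourierChar (inner ℝ ξ y) • (φ (ρ (t⁻¹ • ξ)) * 𝓕 (fun y => a (c + r • y)) ξ))
  rw [finrank_euclideanSpace_fin, eq_inv_smul_iff₀ (by positivity)] at h
  rw [← h, ← integral_smul]
  congr 1
  ext η
  rw [zero_add, fourier_comp_add_smul a c hr, smul_smul, div_eq_mul_inv, mul_inv, inv_inv,
    mul_comm t⁻¹ r, Circle.smul_def, Circle.smul_def, smul_eq_mul, smul_eq_mul, mul_smul_comm,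
    mul_smul_comm, smul_smul, mul_inv_cancel₀ (by positivity), one_smul, inner_add_right,
    AddChar.map_add_eq_mul, Circle.coe_mul, real_inner_smul_left, real_inner_smul_right,
    real_inner_comm c, mul_comm r t⁻¹]
  ring

theorem multiplierPiece_const_mul (ρ : EuclideanSpace ℝ (Fin d) → ℝ) (φ : ℝ → ℂ) (l : ℂ)
    (a : EuclideanSpace ℝ (Fin d) → ℂ) (x : EuclideanSpace ℝ (Fin d)) (t : ℝ) :
    multiplierPiece ρ φ (fun y => l * a y) x t = l * multiplierPiece ρ φ a x t := by
  have e : 𝓕 (fun y => l * a y) = fun ξ => l * 𝓕 a ξ := by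
    ext ξ
    rw [Real.fourier_eq, Real.fourier_eq, ← integral_const_mul]
    congr 1
    ext y
    rw [Circle.smul_def, Circle.smul_def, smul_eq_mul, smul_eq_mul]
    ring
  rw [multiplierPiece, multiplierPiece, e, Real.fourierInv_eq, Real.fourierInv_eq,
    ← integral_const_mul]
  congr 1
  ext ξ
  rw [Circle.smul_def, Circle.smul_def, smul_eq_mul, smul_eq_mul]
  ring

theorem maximalPiece_const_mul_comp_add_smul (ρ : EuclideanSpace ℝ (Fin d) → ℝ) (φ : ℝ → ℂ) (l : ℂ)
    (a : EuclideanSpace ℝ (Fin d) → ℂ) (c : EuclideanSpace ℝ (Fin d)) {r : ℝ} (hr : 0 < r)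
    (y : EuclideanSpace ℝ (Fin d)) :
    maximalPiece ρ φ (fun y => l * a (c + r • y)) y = ‖l‖ₑ * maximalPiece ρ φ a (c + r • y) := by
  unfold maximalPiece
  simp only [multiplierPiece_const_mul ρ φ l (fun y => a (c + r • y)),
    multiplierPiece_comp_add_smul ρ φ a c hr, enorm_mul, ENNReal.mul_iSup]
  apply le_antisymm
  · refine iSup₂_le fun t ht => ?_
    exact le_iSup₂_of_le (t / r) (by positivity) le_rfl
  · refine iSup₂_le fun t ht => ?_
    refine le_iSup₂_of_le (t * r) (by positivity) ?_
    rw [mul_div_cancel_right₀ _ hr.ne']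

/-- The maximal function of the `Lᵖ`-normalized translate and dilate of `a` has the same `Lᵖ` norm
as that of `a`. -/
theorem lintegral_maximalPiece_comp_add_smul (ρ : EuclideanSpace ℝ (Fin d) → ℝ) (φ : ℝ → ℂ)
    (a : EuclideanSpace ℝ (Fin d) → ℂ) (c : EuclideanSpace ℝ (Fin d)) {r p : ℝ} (hr : 0 < r)
    (hp : 0 < p) :
    ∫⁻ y, maximalPiece ρ φ (fun y => ((r ^ (d / p) : ℝ) : ℂ) * a (c + r • y)) y ^ p =
      ∫⁻ x, maximalPiece ρ φ a x ^ p := by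
  simp only [maximalPiece_const_mul_comp_add_smul ρ φ _ a c hr]
  have e : ‖((r ^ (d / p) : ℝ) : ℂ)‖ₑ ^ p = ENNReal.ofReal (r ^ d) := by
    rw [← ofReal_norm, Complex.norm_real, Real.norm_eq_abs, abs_of_pos (by positivity),
      ENNReal.ofReal_rpow_of_pos (by positivity), ← Real.rpow_mul hr.le, div_mul_cancel₀ _ hp.ne',
      Real.rpow_natCast]
  simp only [ENNReal.mul_rpow_of_nonneg _ _ hp.le, e]
  rw [lintegral_const_mul' _ _ ENNReal.ofReal_ne_top,
    lintegral_comp_add_smul c hr (fun x => maximalPiece ρ φ a x ^ p), finrank_euclideanSpace_fin,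
    ← mul_assoc, ← ENNReal.ofReal_mul (by positivity), mul_inv_cancel₀ (by positivity),
    ENNReal.ofReal_one, one_mul]

theorem quasiMeasurePreserving_add_smul {V : Type*} [NormedAddCommGroup V] [InnerProductSpace ℝ V]
    [FiniteDimensional ℝ V] [MeasurableSpace V] [BorelSpace V] (c : V) {r : ℝ} (hr : 0 < r) :
    Measure.QuasiMeasurePreserving (fun y : V => c + r • y) volume volume := by
  refine (measurePreserving_add_left volume c).quasiMeasurePreserving.comp
    ⟨measurable_const_smul r, ?_⟩
  rw [Measure.map_addHaar_smul volume hr.ne']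
  exact Measure.smul_absolutelyContinuous

/-- The `Lᵖ`-normalized dilate of a function on a ball, of the size prescribed for atoms. -/
theorem isBoundedOnUnitBall_of_eLpNorm_le {a : EuclideanSpace ℝ (Fin d) → ℂ} {p : ℝ}
    (ha : AEStronglyMeasurable a) {c : EuclideanSpace ℝ (Fin d)} {r : ℝ} (hr : 0 < r)
    (hsupp : Function.support a ⊆ Metric.closedBall c r)
    (hbound : eLpNorm a ⊤ volume ≤
      ENNReal.ofReal (volume.real (Metric.closedBall c r) ^ (-(1 / p)))) :
    IsBoundedOnUnitBall
      (volume.real (Metric.closedBall (0 : EuclideanSpace ℝ (Fin d)) 1) ^ (-(1 / p)))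
      (fun y => ((r ^ (d / p) : ℝ) : ℂ) * a (c + r • y)) := by
  have hq := quasiMeasurePreserving_add_smul c hr
  refine ⟨(ha.comp_quasiMeasurePreserving hq).const_mul _, ?_, ?_⟩
  · intro y hy
    have : a (c + r • y) = 0 := by
      by_contra h
      have h2 := hsupp h
      rw [mem_closedBall_iff_norm, add_sub_cancel_left, norm_smul, Real.norm_eq_abs,
        abs_of_pos hr] at h2
      nlinarith
    rw [this, mul_zero]
  · rw [eLpNorm_exponent_top] at hbound
    have h1 : ∀ᵐ x, ‖a x‖ ≤ volume.real (Metric.closedBall c r) ^ (-(1 / p)) := by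
      filter_upwards [enorm_ae_le_eLpNormEssSup a volume] with x hx
      have := hx.trans hbound
      rw [← ofReal_norm, ENNReal.ofReal_le_ofReal_iff (by positivity)] at this
      exact this
    filter_upwards [hq.ae h1] with y hy
    rw [norm_mul, Complex.norm_real, Real.norm_eq_abs, abs_of_pos (by positivity)]
    have hv : volume.real (Metric.closedBall c r) =
        r ^ d * volume.real (Metric.closedBall (0 : EuclideanSpace ℝ (Fin d)) 1) := by
      rw [Measure.addHaar_real_closedBall' volume c hr.le, finrank_euclideanSpace_fin]
    refine (mul_le_mul_of_nonneg_left hy (by positivity)).trans_eq ?_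
    rw [hv, Real.mul_rpow (by positivity) (by positivity), ← mul_assoc, ← Real.rpow_natCast,
      ← Real.rpow_mul hr.le, ← Real.rpow_add hr]
    have : (d : ℝ) / p + d * (-(1 / p)) = 0 := by ring
    rw [this, Real.rpow_zero, one_mul]

theorem hasVanishingMoments_of_forall_polynomial {a : EuclideanSpace ℝ (Fin d) → ℂ} {M : ℕ}
    (ha : ∀ P : MvPolynomial (Fin d) ℝ, P.totalDegree ≤ M →
      ∫ x, a x * ((MvPolynomial.eval (fun i => x i) P : ℝ) : ℂ) = 0)
    (l : ℂ) (c : EuclideanSpace ℝ (Fin d)) {r : ℝ} (hr : 0 < r) :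
    HasVanishingMoments M (fun y => l * a (c + r • y)) := by
  intro k hk v
  -- the polynomial `x ↦ ∏ i, ⟪r⁻¹ (x - c), v i⟫`
  let P : MvPolynomial (Fin d) ℝ := ∏ i, ∑ m, MvPolynomial.C (r⁻¹ * v i m) *
    (MvPolynomial.X m - MvPolynomial.C (c m))
  have hP : P.totalDegree ≤ M := by
    refine (MvPolynomial.totalDegree_finsetProd _ _).trans ?_
    calc _ ≤ ∑ i : Fin k, 1 := by
          apply Finset.sum_le_sum
          intro i _
          refine MvPolynomial.totalDegree_finsetSum_le fun m _ => ?_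
          refine (MvPolynomial.totalDegree_mul _ _).trans ?_
          rw [MvPolynomial.totalDegree_C, zero_add]
          refine (MvPolynomial.totalDegree_sub _ _).trans ?_
          rw [MvPolynomial.totalDegree_X, MvPolynomial.totalDegree_C]
          simp
      _ ≤ M := by simpa using hk
  have hev : ∀ y : EuclideanSpace ℝ (Fin d),
      MvPolynomial.eval (fun i => (c + r • y) i) P = ∏ i, inner ℝ y (v i) := by
    intro y
    simp only [P, map_prod, map_sum, map_mul, map_sub, MvPolynomial.eval_C, MvPolynomial.eval_X,
      PiLp.inner_apply, RCLike.inner_apply, conj_trivial, PiLp.add_apply, PiLp.smul_apply,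
      smul_eq_mul]
    refine Finset.prod_congr rfl fun i _ => Finset.sum_congr rfl fun m _ => ?_
    field_simp
    ring
  have h := integral_comp_add_smul c hr
    (fun x => l * (a x * ((MvPolynomial.eval (fun i => x i) P : ℝ) : ℂ)))
  rw [integral_const_mul l fun x : EuclideanSpace ℝ (Fin d) =>
    a x * ((MvPolynomial.eval (fun i => x i) P : ℝ) : ℂ), ha P hP, mul_zero, smul_zero] at h
  rw [← h]
  congr 1
  ext y
  rw [hev]
  ring

end Scaling

theorem proposition8p3 (d : ℕ) (hd : 1 ≤ d)
    (ρ : EuclideanSpace ℝ (Fin d) → ℝ) (b : ℝ) (hρ : IsHomogeneousDistance ρ b)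
    (C : ℕ → ℝ)
    (p : ℝ) (hp0 : 0 < p) (hp1 : p ≤ 1) (hdp : d = 1 → p < 1)
    (M : ℕ) (hM : (d : ℝ) * (1 / p - 1) < (M : ℝ) + 1) :
    ∃ A : ℝ, 0 < A ∧
      ∀ (j : ℕ), 1 ≤ j → ∀ φ : ℝ → ℂ, IsLocalizer C j φ →
        ∀ a : EuclideanSpace ℝ (Fin d) → ℂ, IsHardyAtom p M a →
          eLpNorm (maximalPiece ρ φ a) (ENNReal.ofReal p) volume ≤
            ENNReal.ofReal
              (A * (2 : ℝ) ^ ((j : ℝ) * ((d : ℝ) * (1 / p - 1 / 2) - 1 / 2))) := by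
  obtain ⟨A, hA, h⟩ := exists_lintegral_maximalPiece_rpow_le hρ hd C hp0 hp1 hdp hM
    (volume.real (Metric.closedBall (0 : EuclideanSpace ℝ (Fin d)) 1) ^ (-(1 / p)))
  have hA' : A ^ (1 / p) ≠ ⊤ := ENNReal.rpow_ne_top_of_nonneg (by positivity) hA
  refine ⟨(A ^ (1 / p)).toReal + 1, by positivity, ?_⟩
  rintro j hj φ hφ a ⟨ham, ⟨c, r, hr, hsupp, hbound⟩, hmom⟩
  have h1 := h j hj φ hφ _ (isBoundedOnUnitBall_of_eLpNorm_le ham hr hsupp hbound)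
    (hasVanishingMoments_of_forall_polynomial hmom _ c hr)
  rw [lintegral_maximalPiece_comp_add_smul ρ φ a c hr hp0] at h1
  rw [eLpNorm_eq_lintegral_rpow_enorm_toReal (by simpa using hp0) ENNReal.ofReal_ne_top,
    ENNReal.toReal_ofReal hp0.le]
  simp only [enorm_eq_self]
  calc _ ≤ (A * ENNReal.ofReal (capGrowth d j p)) ^ (1 / p) := by gcongr
    _ = A ^ (1 / p) * ENNReal.ofReal
        ((2 : ℝ) ^ ((j : ℝ) * ((d : ℝ) * (1 / p - 1 / 2) - 1 / 2))) := by
        rw [ENNReal.mul_rpow_of_nonneg _ _ (by positivity),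
          ENNReal.ofReal_rpow_of_pos (capGrowth_pos d j p), capGrowth_eq hd,
          ← Real.rpow_mul zero_le_two]
        congr 3
        field_simp
        ring
    _ ≤ _ := by
        rw [ENNReal.ofReal_mul (by positivity)]
        gcongr
        rw [← ENNReal.ofReal_toReal hA']
        apply ENNReal.ofReal_le_ofReal
        rw [ENNReal.toReal_ofReal ENNReal.toReal_nonneg]
        linarith
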